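/- **Setting.** Let $\mathbb U=[-1,1]^{\mathbb N}$ with the product topology. For $s>1$ let $\mathcal E_s=\{(w+w^{-1})/2: 1\le|w|\le s\}$ and $\mathcal O_s=\{w\in\mathbb C:\operatorname{dist}(w,[-1,1])\le s-1\}$; for a sequence $\rho=(\rho_j)_{j\ge1}$ with all $\rho_j>1$ let $\mathcal E_\rho=\prod_j\mathcal E_{\rho_j}$ and $\mathcal O_\rho=\prod_j\mathcal O_{\rho_j}$. Given $b=(b_j)_{j\ge 1}$, $b_j\ge0$, and $\varepsilon>0$, such a $\rho$ is $(b,\varepsilon)$-admissible if $\sum_j(\rho_j-1)b_j\le\varepsilon$. A holomorphic extension of $u:\mathbb U\to X$ ($X$ a complex Banach space) to $\mathcal O_\rho$ is a map on $\mathcal O_\rho$ that agrees with $u$ on $\mathbb U$ and is complex differentiable in each variable $z_j\in\mathcal O_{\rho_j}$ separately. For $p\in(0,1)$ the map $u$ is $(b,p,\varepsilon)$-holomorphic if $b\in\ell^p$, $u$ is bounded, and there is a constant $C_\varepsilon$ such that for every $(b,\varepsilon)$-admissible $\rho$ there is a holomorphic extension of $u$ to $\mathcal O_\rho$ that is bounded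 by $C_\varepsilon$ on $\mathcal E_\rho$. Let $\hat\Gamma\subset\mathbb R^3$ be a bounded Lipschitz boundary or, more generally, a bounded set with a finite decomposition $\mathcal G$ into relatively open, pairwise disjoint patches $\tau=\chi_\tau(\tilde\tau)$, with $\tilde\tau\subset\mathbb R^2$ open, $\chi_\tau$ bi-Lipschitz on $\tilde\tau$, $\hat\Gamma=\bigcup_\tau\overline\tau$, and $\hat\Gamma\setminus\bigcup_\tau\tau$ of zero area; fix such a $\mathcal G$. Let $\varphi_0,\varphi_j:\hat\Gamma\to\mathbb R^3$ ($j\ge1$) be Lipschitz, let $b_j=\|\varphi_j\|_{C^{0,1}(\hat\Gamma)}$ (supremum norm plus Lipschitz constant), and assume $b=(b_j)_{j\ge1}\in\ell^p$ for some $p\in(0,1)$. For $y\in\mathbb U$ let $r_y=\varphi_0+\sum_{j\ge1}y_j\varphi_j$, and assume that $r_y$ is bi-Lipschitz from $\hat\Gamma$ onto $\Gamma_y:=r_y(\hat\Gamma)$ for each $y\in\mathbb U$. For complex $z$ let $r_z=\varphi_0+\sum_j z_j\varphi_j$, with values in $\mathbb C^3$. Surface integrals are $\int_{\Gamma_y}f\,ds=\sum_{\tau}\int_{\tilde\tau}(f\circ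 r_y\circ\chi_\tau)\sqrt{\det(D^\top D)}\,du$ with $D=D(r_y\circ\chi_\tau)$. Let $\mathfrak U=\{\zeta\in\mathbb C^3:\operatorname{Re}(\zeta\cdot\zeta)>0\}$ with the bilinear product $\zeta\cdot\zeta=\sum_i\zeta_i^2$. For each $y\in\mathbb U$ let $\mathsf a=\mathsf a_y:\Gamma_y\times\mathfrak U\to\mathbb C$ be a measurable kernel, let $c\in\mathbb C$ be a constant, and set $$(\mathsf A_y\varphi)(x)=c\,\varphi(x)+\int_{\Gamma_y}\mathsf a_y(x',x-x')\,\varphi(x')\,ds_{x'},\qquad \varphi\in L^2(\Gamma_y),$$ $$\hat{\mathsf A}_y=\tau_y\mathsf A_y\tau_y^{-1}\ \text{ on } L^2(\hat\Gamma),\qquad \tau_y\varphi=\varphi\circ r_y .$$ (A purely integral operator is the case $c=0$.) **Hypotheses.** There is $\varepsilon>0$ such that: 1. for all $\tau\in\mathcal G$, $u\in\tilde\tau$, $\zeta\in\mathfrak U$, the map $\mathbb U\ni y\mapsto\mathsf a_y(r_y(\chi_\tau(u)),\zeta)\in\mathbb C$ is $(b,p,\varepsilon)$-holomorphic and continuous;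 and, for every $(b,\varepsilon)$-admissible $\rho$, the maps in 1 have holomorphic extensions to $\mathcal O_\rho$, written $z\mapsto\mathsf a_z(r_z(\chi_\tau(u)),\zeta)$, such that 2. for all $\tau$, $u\in\tilde\tau$ and $z\in\mathcal O_\rho$, the map $\zeta\mapsto\mathsf a_z(r_z(\chi_\tau(u)),\zeta)$ is holomorphic on $\mathfrak U$; 3. there are $C_{\mathsf a}>0$ and $\nu\in[0,2)$ such that for all $\tau$, $u\in\tilde\tau$, $z\in\mathcal O_\rho$ and $\hat x\in\hat\Gamma$ with $\hat x\neq\hat y:=\chi_\tau(u)$ and $r_z(\hat x)-r_z(\hat y)\in\mathfrak U$, $$|\mathsf a_z(r_z(\hat y),\,r_z(\hat x)-r_z(\hat y))|\le C_{\mathsf a}\,\|r_z(\hat x)-r_z(\hat y)\|^{-\nu}.$$ Moreover, $\hat{\mathsf A}_y$ is a bounded operator on $L^2(\hat\Gamma)$ with bounded inverse for each $y\in\mathbb U$, and $\mathbb U\ni y\mapsto\hat f_y\in L^2(\hat\Gamma)$ is continuous and, for some $\varepsilon>0$ (possibly different from the one above), $(b,p,\varepsilon)$-holomorphic. **Conclusion.**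 There is $\varepsilon'>0$ such that the parameter-to-solution map $\mathbb U\to L^2(\hat\Gamma)$, $y\mapsto\hat{\mathsf A}_y^{-1}\hat f_y$, is $(b,p,\varepsilon')$-holomorphic and continuous. -/

import Mathlib

open Set MeasureTheory Filter Topology
open scoped NNReal ENNReal

noncomputable section

namespace ShapeHolomorphy

/-! ### Parametric holomorphy -/

/-- The parameter space `[-1,1]^ℕ`, with the product topology. -/
abbrev ParamSpace : Type := ℕ → Set.Icc (-1 : ℝ) 1

/-- A real parameter, viewed as a complex sequence. -/
def ParamSpace.toComplex (y : ParamSpace) : ℕ → ℂ := fun j => ((y j : ℝ) : ℂ)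

/-- The interval `[-1,1]` as a subset of `ℂ`. -/
def realInterval : Set ℂ := (fun t : ℝ => (t : ℂ)) '' Set.Icc (-1 : ℝ) 1

/-- The Bernstein ellipse `{(z + z⁻¹)/2 : 1 ≤ |z| ≤ s}`. -/
def bernsteinEllipse (s : ℝ) : Set ℂ :=
  {w | ∃ z : ℂ, 1 ≤ ‖z‖ ∧ ‖z‖ ≤ s ∧ w = (z + z⁻¹) / 2}

/-- The poly-ellipse. -/
def polyEllipse (ρ : ℕ → ℝ) : Set (ℕ → ℂ) := {z | ∀ j, z j ∈ bernsteinEllipse (ρ j)}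

/-- `{z : dist(z, [-1,1]) ≤ s - 1}`. -/
def stadium (s : ℝ) : Set ℂ := {z | Metric.infDist z realInterval ≤ s - 1}

/-- The product of the sets `stadium (ρ j)`. -/
def polyStadium (ρ : ℕ → ℝ) : Set (ℕ → ℂ) := {z | ∀ j, z j ∈ stadium (ρ j)}

/-- `ρ` is a `(b,ε)`-admissible sequence of numbers strictly larger than one. -/
def IsAdmissible (b : ℕ → ℝ) (ε : ℝ) (ρ : ℕ → ℝ) : Prop :=
  (∀ j, 1 < ρ j) ∧ Summable (fun j => (ρ j - 1) * b j) ∧ ∑' j, (ρ j - 1) * b j ≤ ε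

/-- `v` is an extension of `u` that is complex differentiable on `polyStadium ρ` with respect to
each variable separately (increments staying in the set). Values of `v` elsewhere are irrelevant. -/
def IsHolomorphicExtension {X : Type*} [NormedAddCommGroup X] [NormedSpace ℂ X]
    (ρ : ℕ → ℝ) (u : ParamSpace → X) (v : (ℕ → ℂ) → X) : Prop :=
  (∀ y : ParamSpace, v y.toComplex = u y) ∧
  ∀ z ∈ polyStadium ρ, ∀ j : ℕ,
    DifferentiableOn ℂ (fun w : ℂ => v (Function.update z j w)) (stadium (ρ j))

/-- `(b,p,ε)`-holomorphy of a map from the parameter space into a complex normed space. -/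
def IsBPEHolomorphic {X : Type*} [NormedAddCommGroup X] [NormedSpace ℂ X]
    (b : ℕ → ℝ) (p ε : ℝ) (u : ParamSpace → X) : Prop :=
  ((∀ j, 0 ≤ b j) ∧ Summable (fun j => b j ^ p)) ∧
  (∃ C₀ : ℝ, ∀ y, ‖u y‖ ≤ C₀) ∧
  ∃ Cε : ℝ, ∀ ρ : ℕ → ℝ, IsAdmissible b ε ρ →
    ∃ v : (ℕ → ℂ) → X, IsHolomorphicExtension ρ u v ∧ ∀ z ∈ polyEllipse ρ, ‖v z‖ ≤ Cε

/-! ### Reference surface -/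

abbrev R2 : Type := EuclideanSpace ℝ (Fin 2)
abbrev R3 : Type := EuclideanSpace ℝ (Fin 3)
abbrev C3 : Type := EuclideanSpace ℂ (Fin 3)

/-- `f` is bi-Lipschitz on `s`. -/
def IsBiLipschitzOn {E F : Type*} [PseudoEMetricSpace E] [PseudoEMetricSpace F]
    (f : E → F) (s : Set E) : Prop :=
  (∃ K : ℝ≥0, LipschitzOnWith K f s) ∧ ∃ K : ℝ≥0, AntilipschitzWith K (s.domRestrict f)

/-- A decomposition of the surface `Γ` into finitely many (index set `ι`) relatively open, disjoint
patches `chart τ '' dom τ`, each a bi-Lipschitz image of an open planar set, whose closures cover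
`Γ`; the part of `Γ` that lies in no patch has zero area. -/
structure PatchDecomposition (Γ : Set R3) (ι : Type*) where
  dom : ι → Set R2
  chart : ι → R2 → R3
  isOpen_dom : ∀ τ, IsOpen (dom τ)
  biLipschitz : ∀ τ, IsBiLipschitzOn (chart τ) (dom τ)
  isOpen_patch : ∀ τ, ∃ O : Set R3, IsOpen O ∧ chart τ '' dom τ = O ∩ Γ
  disjoint_patch : Pairwise (Function.onFun Disjoint fun τ => chart τ '' dom τ)
  cover : Γ = ⋃ τ, closure (chart τ '' dom τ)
  null_rest : μH[2] (Γ \ ⋃ τ, chart τ '' dom τ) = 0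

/-- The Gram determinant `det (Dχᵀ Dχ)` of a parametrization `χ`. -/
def gramDet (χ : R2 → R3) (u : R2) : ℝ :=
  (Matrix.gram ℝ fun i : Fin 2 => fderiv ℝ χ u (EuclideanSpace.single i 1)).det

/-- The surface measure of `r(Γ)`, for `r` bi-Lipschitz on `Γ`:
`∫ f ds = ∑_τ ∫_{dom τ} f(r(χ_τ(u))) √(g_{τ}(u)) du`, where `g_τ` is the Gram determinant of
`r ∘ χ_τ`. -/
def surfaceMeasure {Γ : Set R3} {ι : Type*} [Fintype ι] (G : PatchDecomposition Γ ι)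
    (r : R3 → R3) : Measure R3 :=
  ∑ τ, ((volume.restrict (G.dom τ)).withDensity
    (fun u => ENNReal.ofReal (Real.sqrt (gramDet (r ∘ G.chart τ) u)))).map (r ∘ G.chart τ)

/-- The norm of `C^{0,1}(Γ; ℝ³)`: supremum norm plus best Lipschitz constant. -/
def lipNorm (Γ : Set R3) (φ : R3 → R3) : ℝ :=
  (⨆ x : Γ, ‖φ x‖) + ⨆ q : Γ × Γ, ‖φ q.1 - φ q.2‖ / ‖(q.1 : R3) - q.2‖

/-! ### Affine-parametric boundaries -/

/-- The parametrization `r_y(x) = φ₀(x) + ∑_j y_j φ_j(x)`; its image of `Γ` is `Γ_y`. -/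
def rReal (φ₀ : R3 → R3) (φ : ℕ → R3 → R3) (y : ParamSpace) (x : R3) : R3 :=
  φ₀ x + ∑' j, (y j : ℝ) • φ j x

/-- The inclusion `ℝ³ ⊂ ℂ³`. -/
def complexify (x : R3) : C3 := WithLp.toLp 2 fun i => ((x i : ℝ) : ℂ)

/-- The complex extension `r_z(x) = φ₀(x) + ∑_j z_j φ_j(x)`. -/
def rComplex (φ₀ : R3 → R3) (φ : ℕ → R3 → R3) (z : ℕ → ℂ) (x : R3) : C3 :=
  complexify (φ₀ x) + ∑' j, z j • complexify (φ j x)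

/-- The standing assumption on the boundary transformations. -/
structure IsAdmissibleFamily (Γ : Set R3) (φ₀ : R3 → R3) (φ : ℕ → R3 → R3) (p : ℝ) : Prop where
  lipschitz_zero : ∃ K : ℝ≥0, LipschitzOnWith K φ₀ Γ
  lipschitz : ∀ j, ∃ K : ℝ≥0, LipschitzOnWith K (φ j) Γ
  biLipschitz : ∀ y, IsBiLipschitzOn (rReal φ₀ φ y) Γ
  summable : Summable fun j => lipNorm Γ (φ j) ^ p

/-! ### Boundary integral operators -/

/-- The bounded operator `T : L²(μ) → L²(ν)` with `T φ = F φ` a.e. for every `φ`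
(zero if there is no such operator). -/
def boundedOperator (μ ν : Measure R3) (F : (R3 → ℂ) → R3 → ℂ) : Lp ℂ 2 μ →L[ℂ] Lp ℂ 2 ν :=
  open Classical in
  if h : ∃ T : Lp ℂ 2 μ →L[ℂ] Lp ℂ 2 ν, ∀ φ : Lp ℂ 2 μ, T φ =ᵐ[ν] F φ then h.choose else 0

/-- The operator `(A φ)(x) = c φ(x) + ∫ a(x', x - x') φ(x') ds(x')` on `L²` of a surface with
surface measure `σ`. -/
def boundaryOperator (c : ℂ) (a : R3 → C3 → ℂ) (σ : Measure R3) : Lp ℂ 2 σ →L[ℂ] Lp ℂ 2 σ :=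
  boundedOperator σ σ fun φ x => c * φ x + ∫ x', a x' (complexify (x - x')) * φ x' ∂σ

section Pullback

variable {Γ : Set R3} {ι : Type*} [Fintype ι] (G : PatchDecomposition Γ ι)

/-- The surface measure of the reference surface `Γ`. -/
abbrev refMeasure : Measure R3 := surfaceMeasure G id

/-- The pullback `φ ↦ φ ∘ r` from `L²(r(Γ))` to `L²(Γ)`. -/
def pullback (r : R3 → R3) : Lp ℂ 2 (surfaceMeasure G r) →L[ℂ] Lp ℂ 2 (refMeasure G) :=
  boundedOperator _ _ fun φ => φ ∘ r

/-- The operator `τ A τ⁻¹` on `L²(Γ)`, where `A` is the boundary operator on `L²(r(Γ))` and `τ` is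
the pullback. -/
def pulledBackOperator (c : ℂ) (a : R3 → C3 → ℂ) (r : R3 → R3) :
    Lp ℂ 2 (refMeasure G) →L[ℂ] Lp ℂ 2 (refMeasure G) :=
  pullback G r ∘L boundaryOperator c a (surfaceMeasure G r) ∘L (pullback G r).inverse

end Pullback

/-- `{ζ ∈ ℂ³ : Re (ζ · ζ) > 0}`, with the bilinear product. -/
def kernelDomain : Set C3 := {ζ | 0 < (∑ i, ζ i * ζ i).re}

/-- The assumptions on a kernel with an integrable singularity. The kernel `a y` lives on
`Γ_y × kernelDomain`. For an admissible `ρ`, `K τ u z ζ` is the holomorphic extension in the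
parameter, written `a(r_z(χ_τ(u)), ζ)`. -/
structure IsHolomorphicSingularKernel {Γ : Set R3} {ι : Type*} (G : PatchDecomposition Γ ι)
    (φ₀ : R3 → R3) (φ : ℕ → R3 → R3) (p ε : ℝ) (a : ParamSpace → R3 → C3 → ℂ) : Prop where
  holomorphic_param : ∀ τ, ∀ u ∈ G.dom τ, ∀ ζ ∈ kernelDomain,
    IsBPEHolomorphic (fun j => lipNorm Γ (φ j)) p ε
      (fun y => a y (rReal φ₀ φ y (G.chart τ u)) ζ) ∧
    Continuous (fun y => a y (rReal φ₀ φ y (G.chart τ u)) ζ)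
  extension : ∀ ρ : ℕ → ℝ, IsAdmissible (fun j => lipNorm Γ (φ j)) ε ρ →
    ∃ K : ι → R2 → (ℕ → ℂ) → C3 → ℂ,
      (∀ τ, ∀ u ∈ G.dom τ, ∀ ζ ∈ kernelDomain,
        IsHolomorphicExtension ρ (fun y => a y (rReal φ₀ φ y (G.chart τ u)) ζ)
          (fun z => K τ u z ζ)) ∧
      (∀ τ, ∀ u ∈ G.dom τ, ∀ z ∈ polyStadium ρ,
        DifferentiableOn ℂ (fun ζ => K τ u z ζ) kernelDomain) ∧
      ∃ C > 0, ∃ ν : ℝ, 0 ≤ ν ∧ ν < 2 ∧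
        ∀ τ, ∀ u ∈ G.dom τ, ∀ z ∈ polyStadium ρ, ∀ x ∈ Γ, x ≠ G.chart τ u →
          rComplex φ₀ φ z x - rComplex φ₀ φ z (G.chart τ u) ∈ kernelDomain →
          ‖K τ u z (rComplex φ₀ φ z x - rComplex φ₀ φ z (G.chart τ u))‖ ≤
            C / ‖rComplex φ₀ φ z x - rComplex φ₀ φ z (G.chart τ u)‖ ^ ν

end ShapeHolomorphy

end

/-!
The parameters are extended to the complex sequences `z` at distance `∑_j b_j dist(z_j, [-1,1]) < η`
from the parameter space, all but finitely many of whose coordinates are real (`finDomain`). There a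
separately holomorphic extension is determined by its real values
(`IsHolomorphicExtension.eq_of_finite`). A bounded one is Lipschitz for the norm `∑_j b_j |z_j|`, by
Cauchy's estimate (`IsBoundedSepHolomorphic.norm_sub_le`), and so extends to all of `fullDomain` by a
limit.

The inverse of a bounded operator family of this kind is again of this kind on a smaller
neighbourhood: its real values are invertible with inverses bounded uniformly, by compactness, and
invertibility survives small perturbations. This is `isBPEHolomorphic_inverse_apply`, and it reduces
the theorem to the construction of a bounded, separately holomorphic operator family `H` whose values
at the real parameters are the transported operators, and to their Lipschitz continuity there.

The family `H(z)` is `c` plus the sum, over the charts, of the integral operators with kernels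
`a_z(r_z(χ(u)), r_z(x) - r_z(χ(u))) J_z(u)` (`surfaceKernel`).

* Near the real parameters the chords `r_z(x) - r_z(x')` lie in the domain of the kernel and are
  comparable to `x - x'` (`IsControlledFamily.mem_kernelDomain`), because the lower Lipschitz
  constants of the `r_y` are bounded below by compactness. The surface element `J_z` is the square
  root of a bilinear Gram determinant in the right half-plane
  (`exists_isBoundedSepHolomorphic_jacobian`).
* The hypotheses provide an extension of the kernel and a bound for each admissible sequence
  separately. The extensions agree where both are defined, and the bounds are uniform on a small
  neighbourhood (`exists_isExtendedKernel`), because points where they get worse and worse would fit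
  into the domain of one admissible sequence.
* The kernel depends on `z_j` through the parameter and through the chord. It is holomorphic in each
  of the two, with no bound in both together, so joint holomorphy needs Hartogs' theorem
  (`SepHolomorphicOn.differentiableAt_diag`).
* The kernels are dominated by `|x - χ(u)|^{-ν}` with `ν < 2`, and the Schur test turns pointwise
  bounds and holomorphy of the kernels into bounds and holomorphy in operator norm
  (`IsKernelOp.norm_le`, `differentiableAt_of_isKernelOp`). Measurability of the extended kernel
  follows from that at the real parameters (`measurable_of_measurable_realInterval`).
* Lipschitz continuity between arbitrary real parameters needs continuity of the kernel along a
  sequence that changes the coordinates one after another. The hypotheses give it for a fixed chord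
  only; moving finitely many coordinates by a small amount restores the chord
  (`tendsto_of_continuous_of_fixed`).

Coordinates with `b_j = 0` do not matter: the surfaces do not depend on them, and the kernel does not
either, by Liouville's theorem (`IsBPEHolomorphic.apply_restrictReal`).
-/

noncomputable section

namespace ShapeHolomorphy

/-! ### Separately holomorphic functions of two variables -/

section CauchyEstimates

variable {E : Type*} [NormedAddCommGroup E] [NormedSpace ℂ E]

theorem norm_sub_le_of_bounded_ball {f : ℂ → E} {c z : ℂ} {r M : ℝ}
    (hd : DifferentiableOn ℂ f (Metric.ball c r)) (hM : ∀ z ∈ Metric.ball c r, ‖f z‖ ≤ M)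
    (hz : z ∈ Metric.ball c r) : ‖f z - f c‖ ≤ 2 * M / r * ‖z - c‖ := by
  have hr : 0 < r := Metric.nonempty_ball.1 ⟨z, hz⟩
  have h := Complex.dist_le_div_mul_dist_of_mapsTo_ball (R₂ := 2 * M) hd (fun w hw => by
    rw [mem_closedBall_iff_norm]
    linarith [norm_sub_le (f w) (f c), hM w hw, hM c (Metric.mem_ball_self hr)]) hz
  simpa [dist_eq_norm] using h

theorem norm_deriv_le_of_bounded_ball {f : ℂ → E} {c : ℂ} {r M : ℝ} (hr : 0 < r)
    (hd : DifferentiableOn ℂ f (Metric.ball c r)) (hM : ∀ z ∈ Metric.ball c r, ‖f z‖ ≤ M) :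
    ‖deriv f c‖ ≤ 2 * M / r :=
  Complex.norm_deriv_le_div_of_mapsTo_ball hd (fun w hw => by
    rw [mem_closedBall_iff_norm]
    linarith [norm_sub_le (f w) (f c), hM w hw, hM c (Metric.mem_ball_self hr)]) hr

/-- Quantitative first order Taylor expansion of a bounded holomorphic function: a Schwarz lemma
of second order. -/
theorem norm_sub_sub_smul_deriv_le {f : ℂ → E} {c z : ℂ} {r M : ℝ}
    (hd : DifferentiableOn ℂ f (Metric.ball c r)) (hM : ∀ z ∈ Metric.ball c r, ‖f z‖ ≤ M)
    (hz : z ∈ Metric.ball c r) :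
    ‖f z - f c - (z - c) • deriv f c‖ ≤ 4 * M / r ^ 2 * ‖z - c‖ ^ 2 := by
  have hr : 0 < r := Metric.nonempty_ball.1 ⟨z, hz⟩
  have hc := Metric.mem_ball_self (x := c) hr
  have hfc : HasDerivAt f (deriv f c) c :=
    (hd.differentiableAt (Metric.ball_mem_nhds c hr)).hasDerivAt
  have hM0 : 0 ≤ M := (norm_nonneg _).trans (hM c hc)
  have h := Complex.dist_le_mul_div_pow_of_mapsTo_ball_of_isLittleO (n := 1) (R₂ := 4 * M)
    (f := fun z => f z - (z - c) • deriv f c) (c := c) (R₁ := r) (z := z)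
    (hd.sub (by fun_prop)) ?_ ?_ hz
  · simp only [dist_eq_norm, sub_self, zero_smul, sub_zero] at h
    rw [show f z - f c - (z - c) • deriv f c = f z - (z - c) • deriv f c - f c by abel]
    refine h.trans_eq ?_
    norm_num; ring
  · intro w hw
    rw [mem_closedBall_iff_norm]
    have h1 := hM w hw
    have h2 := hM c hc
    have h3 := norm_deriv_le_of_bounded_ball hr hd hM
    have h4 : ‖w - c‖ < r := by rwa [mem_ball_iff_norm] at hw
    have h5 : ‖(w - c) • deriv f c‖ ≤ 2 * M := by
      rw [norm_smul]
      calc ‖w - c‖ * ‖deriv f c‖ ≤ r * (2 * M / r) := by gcongr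
        _ = 2 * M := by field_simp
    simp only [sub_self, zero_smul, sub_zero]
    calc ‖f w - (w - c) • deriv f c - f c‖ ≤ ‖f w‖ + ‖(w - c) • deriv f c‖ + ‖f c‖ :=
          (norm_sub_le _ _).trans (by gcongr; exact norm_sub_le _ _)
      _ ≤ 4 * M := by linarith
  · have := hasDerivAt_iff_isLittleO.1 hfc
    simp only [sub_self, zero_smul, sub_zero, pow_one]
    refine (this.congr_left fun w => by abel).norm_right

theorem hasDerivAt_of_quadratic_bound {f : ℂ → E} {f' : E} {c : ℂ} {C : ℝ}
    (h : ∀ᶠ z in 𝓝 c, ‖f z - f c - (z - c) • f'‖ ≤ C * ‖z - c‖ ^ 2) : HasDerivAt f f' c := by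
  rw [hasDerivAt_iff_isLittleO]
  have h1 : (fun z => f z - f c - (z - c) • f') =O[𝓝 c] fun z => (z - c) ^ 2 :=
    Asymptotics.IsBigO.of_bound C (h.mono fun z hz => by simpa [norm_pow] using hz)
  refine h1.trans_isLittleO ?_
  have h2 : (fun z : ℂ => ‖z - c‖ ^ 2) =o[𝓝 c] fun z => z - c :=
    Asymptotics.isLittleO_pow_sub_sub c one_lt_two
  exact Asymptotics.IsLittleO.of_norm_left (by simpa only [norm_pow] using h2)

end CauchyEstimates

/-- `g` is holomorphic on `U ×ˢ V` in each of its two variables separately. -/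
structure SepHolomorphicOn (g : ℂ → ℂ → ℂ) (U V : Set ℂ) : Prop where
  fst : ∀ s ∈ V, DifferentiableOn ℂ (fun w => g w s) U
  snd : ∀ w ∈ U, DifferentiableOn ℂ (g w) V

theorem SepHolomorphicOn.mono {g : ℂ → ℂ → ℂ} {U V U' V' : Set ℂ} (h : SepHolomorphicOn g U V)
    (hU : U' ⊆ U) (hV : V' ⊆ V) : SepHolomorphicOn g U' V' :=
  ⟨fun s hs => (h.fst s (hV hs)).mono hU, fun w hw => (h.snd w (hU hw)).mono hV⟩

theorem SepHolomorphicOn.swap {g : ℂ → ℂ → ℂ} {U V : Set ℂ} (h : SepHolomorphicOn g U V) :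
    SepHolomorphicOn (fun s w => g w s) V U := ⟨h.snd, h.fst⟩

/-- The derivative in one variable is a uniform limit of difference quotients, hence holomorphic in
the other variable. -/
theorem SepHolomorphicOn.differentiableOn_deriv_fst {g : ℂ → ℂ → ℂ} {U V : Set ℂ} {M : ℝ}
    (h : SepHolomorphicOn g U V) (hU : IsOpen U) (hV : IsOpen V)
    (hM : ∀ w ∈ U, ∀ s ∈ V, ‖g w s‖ ≤ M) {a : ℂ} (ha : a ∈ U) :
    DifferentiableOn ℂ (fun s => deriv (fun w => g w s) a) V := by
  obtain ⟨r, hr, hrU⟩ := Metric.isOpen_iff.1 hU a ha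
  let e : ℕ → ℂ := fun n => ((r / 2 / (n + 1) : ℝ) : ℂ)
  have hepos : ∀ n : ℕ, 0 < r / 2 / ((n : ℝ) + 1) := fun n => by positivity
  have hnorm : ∀ n, ‖e n‖ = r / 2 / ((n : ℝ) + 1) := fun n => by
    rw [Complex.norm_real, Real.norm_of_nonneg (hepos n).le]
  have he0 : ∀ n, e n ≠ 0 := fun n => norm_pos_iff.1 (by rw [hnorm]; exact hepos n)
  have hmem : ∀ n, a + e n ∈ Metric.ball a r := fun n => by
    rw [mem_ball_iff_norm, add_sub_cancel_left, hnorm]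
    have : r / 2 / ((n : ℝ) + 1) ≤ r / 2 := div_le_self (by positivity) (by simp)
    linarith
  have hlim : Tendsto (fun n => 4 * M / r ^ 2 * ‖e n‖) atTop (𝓝 0) := by
    simp_rw [hnorm]
    have h1 := (tendsto_one_div_add_atTop_nhds_zero_nat (𝕜 := ℝ)).const_mul (r / 2)
    have h2 := h1.const_mul (4 * M / r ^ 2)
    simpa [div_eq_mul_inv] using h2
  have hunif : TendstoUniformlyOn (fun n s => (e n)⁻¹ * (g (a + e n) s - g a s))
      (fun s => deriv (fun w => g w s) a) atTop V := by
    rw [Metric.tendstoUniformlyOn_iff]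
    intro δ hδ
    filter_upwards [hlim.eventually (gt_mem_nhds hδ)] with n hn s hs
    refine lt_of_le_of_lt ?_ hn
    have h1 := norm_sub_sub_smul_deriv_le ((h.fst s hs).mono hrU)
      (fun w hw => hM w (hrU hw) s hs) (hmem n)
    rw [add_sub_cancel_left, smul_eq_mul] at h1
    rw [dist_comm, dist_eq_norm]
    have h2 : (e n)⁻¹ * (g (a + e n) s - g a s) - deriv (fun w => g w s) a
        = (e n)⁻¹ * (g (a + e n) s - g a s - e n * deriv (fun w => g w s) a) := by
      field_simp [he0 n]
    rw [h2, norm_mul, norm_inv]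
    calc ‖e n‖⁻¹ * ‖g (a + e n) s - g a s - e n * deriv (fun w => g w s) a‖
        ≤ ‖e n‖⁻¹ * (4 * M / r ^ 2 * ‖e n‖ ^ 2) := by gcongr
      _ = 4 * M / r ^ 2 * ‖e n‖ := by
        have := norm_ne_zero_iff.2 (he0 n)
        field_simp
  refine hunif.tendstoLocallyUniformlyOn.differentiableOn (Eventually.of_forall fun n => ?_) hV
  exact (((h.snd _ (hrU (hmem n))).sub (h.snd _ ha)).const_mul _)

/-- Restriction of a bounded separately holomorphic function to the diagonal. -/
theorem SepHolomorphicOn.differentiableAt_diag_of_bounded {g : ℂ → ℂ → ℂ} {a : ℂ} {r M : ℝ}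
    (hr : 0 < r) (h : SepHolomorphicOn g (Metric.ball a r) (Metric.ball a r))
    (hM : ∀ w ∈ Metric.ball a r, ∀ s ∈ Metric.ball a r, ‖g w s‖ ≤ M) :
    DifferentiableAt ℂ (fun t => g t t) a := by
  have ha := Metric.mem_ball_self (x := a) hr
  set D : ℂ → ℂ := fun s => deriv (fun w => g w s) a with hD
  have hDd : DifferentiableAt ℂ D a :=
    (h.differentiableOn_deriv_fst Metric.isOpen_ball Metric.isOpen_ball hM ha).differentiableAt
      (Metric.ball_mem_nhds a hr)
  have hg2 : DifferentiableAt ℂ (g a) a := (h.snd a ha).differentiableAt (Metric.ball_mem_nhds a hr)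
  have hq : HasDerivAt (fun t => g t t - g a t - (t - a) * D t) 0 a := by
    refine hasDerivAt_of_quadratic_bound (C := 4 * M / r ^ 2) ?_
    filter_upwards [Metric.ball_mem_nhds a hr] with t ht
    have := norm_sub_sub_smul_deriv_le (h.fst t ht) (fun w hw => hM w hw t ht) ht
    simpa [hD] using this
  have : DifferentiableAt ℂ
      (fun t => (g t t - g a t - (t - a) * D t) + (t - a) * D t + g a t) a :=
    (hq.differentiableAt.add ((differentiableAt_id.sub_const a).mul hDd)).add hg2
  exact this.congr_of_eventuallyEq (Eventually.of_forall fun t => by ring)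

/-- The Taylor coefficients in one variable of a bounded separately holomorphic function are
holomorphic in the other variable. -/
theorem SepHolomorphicOn.differentiableOn_iteratedDeriv_snd (n : ℕ) :
    ∀ {g : ℂ → ℂ → ℂ} {U : Set ℂ} {b : ℂ} {r M : ℝ}, IsOpen U → 0 < r →
      SepHolomorphicOn g U (Metric.ball b r) →
      (∀ w ∈ U, ∀ s ∈ Metric.ball b r, ‖g w s‖ ≤ M) →
      DifferentiableOn ℂ (fun w => iteratedDeriv n (g w) b) U := by
  induction n with
  | zero =>
    intro g U b r M _ hr h _
    simpa using h.fst b (Metric.mem_ball_self hr)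
  | succ n ih =>
    intro g U b r M hU hr h hM
    simp_rw [iteratedDeriv_succ']
    have hsub : Metric.ball b (r / 2) ⊆ Metric.ball b r := Metric.ball_subset_ball (by linarith)
    refine ih (g := fun w => deriv (g w)) (r := r / 2) (M := 2 * M / (r / 2)) hU (by linarith)
      ⟨fun s hs => ?_, fun w hw => ?_⟩ fun w hw s hs => ?_
    · exact h.swap.differentiableOn_deriv_fst Metric.isOpen_ball hU
        (fun s hs w hw => hM w hw s hs) (hsub hs)
    · exact ((h.snd w hw).deriv Metric.isOpen_ball).mono hsub
    · have hs' : Metric.ball s (r / 2) ⊆ Metric.ball b r := by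
        refine Metric.ball_subset_ball' ?_
        rw [Metric.mem_ball] at hs
        linarith
      exact norm_deriv_le_of_bounded_ball (by linarith) ((h.snd w hw).mono hs')
        fun t ht => hM w hw t (hs' ht)

/-- Baire category: a separately holomorphic function is bounded on a strip. -/
theorem SepHolomorphicOn.exists_bounded_strip {g : ℂ → ℂ → ℂ} {a : ℂ} {R η : ℝ}
    (h : SepHolomorphicOn g (Metric.ball a R) (Metric.ball a R)) (hη : 0 < η) (hηR : η < R) :
    ∃ b ∈ Metric.ball a η, ∃ r > 0, ∃ M : ℝ, ∀ w ∈ Metric.closedBall a η,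
      ∀ s ∈ Metric.ball b r, ‖g w s‖ ≤ M := by
  have hsub : Metric.closedBall a η ⊆ Metric.ball a R := Metric.closedBall_subset_ball hηR
  let A : ℕ → Set ℂ := fun k =>
    Metric.closedBall a η ∩ {s | ∀ w ∈ Metric.closedBall a η, s ∈ Metric.closedBall a η →
      ‖g w s‖ ≤ k}
  have hA : ∀ k, IsClosed (A k) := by
    intro k
    have : A k = ⋂ w ∈ Metric.closedBall a η,
        Metric.closedBall a η ∩ (fun s => ‖g w s‖) ⁻¹' Set.Iic (k : ℝ) := by
      ext s
      simp only [A, mem_inter_iff, mem_iInter, mem_preimage, mem_Iic, mem_ofPred_eq]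
      exact ⟨fun hs w hw => ⟨hs.1, hs.2 w hw hs.1⟩, fun hs =>
        ⟨(hs a (Metric.mem_closedBall_self hη.le)).1, fun w hw _ => (hs w hw).2⟩⟩
    rw [this]
    refine isClosed_biInter fun w hw => ?_
    exact (((h.snd w (hsub hw)).continuousOn.mono hsub).norm).preimage_isClosed_of_isClosed
      Metric.isClosed_closedBall isClosed_Iic
  have hU : ⋃ k, (A k ∪ (Metric.ball a η)ᶜ) = univ := by
    refine eq_univ_of_forall fun s => ?_
    by_cases hs : s ∈ Metric.ball a η
    · have hs' := Metric.ball_subset_closedBall hs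
      obtain ⟨C, hC⟩ := (isCompact_closedBall a η).exists_bound_of_continuousOn
        ((h.fst s (hsub hs')).continuousOn.mono hsub)
      obtain ⟨k, hk⟩ := exists_nat_ge C
      exact mem_iUnion.2 ⟨k, Or.inl ⟨hs', fun w hw _ => (hC w hw).trans hk⟩⟩
    · exact mem_iUnion.2 ⟨0, Or.inr hs⟩
  have hdense := dense_iUnion_interior_of_closed
    (fun k => (hA k).union Metric.isOpen_ball.isClosed_compl) hU
  obtain ⟨b, hb, hb'⟩ := hdense.inter_open_nonempty _ Metric.isOpen_ball
    ⟨a, Metric.mem_ball_self hη⟩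
  obtain ⟨k, hk⟩ := mem_iUnion.1 hb'
  obtain ⟨r, hr, hrs⟩ := Metric.isOpen_iff.1 (isOpen_interior.inter Metric.isOpen_ball) b ⟨hk, hb⟩
  refine ⟨b, hb, r, hr, k, fun w hw s hs => ?_⟩
  have hs1 := hrs hs
  rcases interior_subset hs1.1 with h1 | h1
  · exact h1.2 w hw h1.1
  · exact absurd hs1.2 h1

/-- The sub-mean value property of `log ‖f‖`, in the form of a two-constants estimate: if `‖f‖ ≤ 1`
on a circle and `‖f‖ ≤ q` there outside of `B`, the value at the centre is controlled by the
fraction of the circle that `B` covers. -/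
theorem norm_le_rpow_of_circleAverage_indicator_le {f : ℂ → ℂ} {w : ℂ} {t q θ : ℝ} {B : Set ℂ}
    (ht : 0 < t) (hf : AnalyticOnNhd ℂ f (Metric.closedBall w t)) (hq : 0 < q) (hq1 : q ≤ 1)
    (h1 : ∀ z ∈ Metric.closedBall w t, ‖f z‖ ≤ 1)
    (hB : MeasurableSet B) (h2 : ∀ z ∈ Metric.closedBall w t, z ∉ B → ‖f z‖ ≤ q)
    (hθ : Real.circleAverage (B.indicator fun _ => (1 : ℝ)) w t ≤ θ) :
    ‖f w‖ ≤ q ^ (1 - θ) := by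
  by_cases hfw : f w = 0
  · rw [hfw, norm_zero]; positivity
  have habs : |t| = t := abs_of_pos ht
  have hlogq : Real.log q ≤ 0 := Real.log_nonpos hq.le hq1
  have hint := hf.mono (Metric.sphere_subset_closedBall) |>.meromorphicOn
  rw [← habs] at hint
  have hlogint := hint.circleIntegrable_log_norm
  have hindint : CircleIntegrable (B.indicator fun _ => (1 : ℝ)) w t := by
    rw [CircleIntegrable, intervalIntegrable_iff]
    refine Measure.integrableOn_of_bounded (M := 1) (by simp [ENNReal.mul_eq_top]) ?_ ?_
    · refine (Measurable.aestronglyMeasurable ?_)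
      exact (measurable_const.indicator hB).comp (continuous_circleMap w t).measurable
    · refine Eventually.of_forall fun x => ?_
      by_cases hx : circleMap w t x ∈ B <;> simp [hx]
  -- at zeros of `f` the junk value `log 0 = 0` is replaced by `log q`
  let L : ℂ → ℝ := fun z => if f z = 0 then Real.log q else Real.log ‖f z‖
  have hzero : f ⁻¹' {0}ᶜ ∈ codiscreteWithin (Metric.closedBall w t) :=
    hf.preimage_zero_mem_codiscreteWithin hfw (Metric.mem_closedBall_self ht.le)
      ⟨⟨w, Metric.mem_closedBall_self ht.le⟩, (convex_closedBall w t).isPreconnected⟩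
  have hL : (fun z => Real.log ‖f z‖) =ᶠ[codiscreteWithin (Metric.sphere w |t|)] L := by
    have := codiscreteWithin_mono (Metric.sphere_subset_closedBall (x := w) (ε := t)) hzero
    rw [habs]
    filter_upwards [this] with z hz
    simp only [mem_preimage, mem_compl_iff, mem_singleton_iff] at hz
    simp [L, hz]
  have hLint : CircleIntegrable L w t := hlogint.congr_codiscreteWithin hL
  have hup : Real.circleAverage L w t ≤
      Real.circleAverage (fun z => Real.log q - Real.log q * B.indicator (fun _ => (1 : ℝ)) z) w t := by
    refine Real.circleAverage_mono hLint ?_ fun z hz => ?_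
    · exact (circleIntegrable_const _ _ _).sub (hindint.const_mul _)
    · rw [habs] at hz
      have hz' := Metric.sphere_subset_closedBall hz
      by_cases hzB : z ∈ B
      · simp only [hzB, indicator_of_mem, mul_one, sub_self]
        by_cases hz0 : f z = 0
        · simpa [L, hz0] using hlogq
        · simpa [L, hz0] using Real.log_nonpos (norm_nonneg _) (h1 z hz')
      · simp only [hzB, not_false_eq_true, indicator_of_notMem, mul_zero, sub_zero]
        by_cases hz0 : f z = 0
        · simp [L, hz0]
        · simpa [L, hz0] using Real.log_le_log (norm_pos_iff.2 hz0) (h2 z hz' hzB)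
  have hcalc : Real.circleAverage
      (fun z => Real.log q - Real.log q * B.indicator (fun _ => (1 : ℝ)) z) w t
      = Real.log q - Real.log q * Real.circleAverage (B.indicator fun _ => (1 : ℝ)) w t := by
    have hindint' : CircleIntegrable (fun z => Real.log q * B.indicator (fun _ => (1 : ℝ)) z) w t :=
      hindint.const_mul (Real.log q)
    have e1 := Real.circleAverage_fun_sub (circleIntegrable_const (Real.log q) w t) hindint'
    have e2 := Real.circleAverage_fun_smul (a := Real.log q) (c := w) (R := t)
      (f := B.indicator fun _ => (1 : ℝ))
    simp only [smul_eq_mul] at e2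
    rw [e1, Real.circleAverage_const]
    rw [e2]
  have hjensen : Real.log ‖f w‖ ≤ Real.circleAverage L w t := by
    rw [← Real.circleAverage_congr_codiscreteWithin hL ht.ne',
      AnalyticOnNhd.circleAverage_log_norm ht.ne' (by rwa [habs]) hfw]
    refine le_add_of_nonneg_left (finsum_nonneg fun u => ?_)
    by_cases hu : u ∈ Metric.closedBall w |t|
    · refine mul_nonneg ?_ ?_
      · exact_mod_cast (MeromorphicOn.AnalyticOnNhd.divisor_nonneg (by rwa [habs])) u
      · by_cases hwu : w = u
        · simp [hwu]
        refine Real.log_nonneg ?_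
        have h3 : 0 < ‖w - u‖ := norm_pos_iff.2 (sub_ne_zero.2 hwu)
        rw [habs, mem_closedBall_iff_norm, norm_sub_rev] at hu
        rw [← div_eq_mul_inv, one_le_div h3]
        exact hu
    · simp [Function.locallyFinsuppWithin.apply_eq_zero_of_notMem _ hu]
  rw [← Real.log_le_log_iff (norm_pos_iff.2 hfw) (Real.rpow_pos_of_pos hq _), Real.log_rpow hq]
  nlinarith

/-- A set of small area covers only a small fraction of some circle around a given point. -/
theorem exists_circleAverage_indicator_le {B : Set ℂ} (hB : MeasurableSet B) {w : ℂ} {T θ : ℝ}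
    (hT : 0 < T) (hθ : 0 < θ)
    (hvol : volume B < ENNReal.ofReal (T ^ 2 * θ)) :
    ∃ t, T < t ∧ t < 2 * T ∧ Real.circleAverage (B.indicator fun _ => (1 : ℝ)) w t ≤ θ := by
  by_contra! hcon
  have hm : Measurable fun z : ℂ => (B.indicator (fun _ => (1 : ℝ≥0∞))) (w + z) :=
    (measurable_const.indicator hB).comp (measurable_const_add w)
  have hps : Measurable fun p : ℝ × ℝ => Complex.polarCoord.symm p := by
    simp only [Complex.polarCoord_symm_apply]
    fun_prop
  have h0 : ∫⁻ z : ℂ, B.indicator (fun _ => (1 : ℝ≥0∞)) (w + z) = volume B := by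
    rw [lintegral_add_left_eq_self (f := B.indicator fun _ => (1 : ℝ≥0∞)) w,
      lintegral_indicator_const hB, one_mul]
  rw [← Complex.lintegral_comp_polarCoord_symm] at h0
  have hcirc : ∀ t, T < t → t < 2 * T → ENNReal.ofReal (2 * Real.pi * θ) ≤
      ∫⁻ α in Ioo (-Real.pi) Real.pi,
        B.indicator (fun _ => (1 : ℝ≥0∞)) (w + Complex.polarCoord.symm (t, α)) := by
    intro t ht1 ht2
    have h1 := (hcon t ht1 ht2).le
    rw [Real.circleAverage_eq_integral_add (-Real.pi), smul_eq_mul,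
      intervalIntegral.integral_comp_add_right
        (fun α => B.indicator (fun _ => (1 : ℝ)) (circleMap w t α)),
      show (0 : ℝ) + -Real.pi = -Real.pi by ring, show 2 * Real.pi + -Real.pi = Real.pi by ring,
      intervalIntegral.integral_of_le (by linarith [Real.pi_pos]),
      integral_Ioc_eq_integral_Ioo] at h1
    have hmt : Measurable fun α => B.indicator (fun _ => (1 : ℝ)) (circleMap w t α) :=
      (measurable_const.indicator hB).comp (continuous_circleMap w t).measurable
    have h2 : 2 * Real.pi * θ ≤
        ∫ α in Ioo (-Real.pi) Real.pi, B.indicator (fun _ => (1 : ℝ)) (circleMap w t α) := by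
      rw [inv_mul_eq_div, le_div_iff₀ (by positivity)] at h1
      linarith
    have hnn : ∀ z, 0 ≤ B.indicator (fun _ => (1 : ℝ)) z := fun z =>
      indicator_nonneg (fun _ _ => zero_le_one) z
    refine (ENNReal.ofReal_le_ofReal h2).trans ?_
    rw [ofReal_integral_eq_lintegral_ofReal]
    · refine lintegral_mono fun α => ?_
      have : w + Complex.polarCoord.symm (t, α) = circleMap w t α := by
        rw [Complex.polarCoord_symm_apply, circleMap, Complex.exp_mul_I]
        push_cast
        rfl
      rw [this]
      by_cases hz : circleMap w t α ∈ B <;> simp [hz]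
    · refine Measure.integrableOn_of_bounded (M := 1) (by simp)
        hmt.aestronglyMeasurable ?_
      refine Eventually.of_forall fun α => ?_
      by_cases hz : circleMap w t α ∈ B <;> simp [hz]
    · exact Eventually.of_forall fun α => hnn _
  have hsub : Ioo T (2 * T) ×ˢ Ioo (-Real.pi) Real.pi ⊆ polarCoord.target := by
    rw [polarCoord_target]
    exact prod_mono (fun t ht => hT.trans ht.1) subset_rfl
  have hlow : ENNReal.ofReal (T ^ 2 * θ) ≤ volume B := by
    rw [← h0]
    refine le_trans ?_ (lintegral_mono_set hsub)
    have hmeas : Measurable fun p : ℝ × ℝ => ENNReal.ofReal p.1 •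
        B.indicator (fun _ => (1 : ℝ≥0∞)) (w + Complex.polarCoord.symm p) := by
      exact (ENNReal.measurable_ofReal.comp measurable_fst).smul (hm.comp hps)
    rw [Measure.volume_eq_prod, ← Measure.prod_restrict, lintegral_prod _ hmeas.aemeasurable]
    calc ENNReal.ofReal (T ^ 2 * θ)
        ≤ ∫⁻ _ in Ioo T (2 * T), ENNReal.ofReal T * ENNReal.ofReal (2 * Real.pi * θ) := by
          rw [lintegral_const, Measure.restrict_apply_univ, Real.volume_Ioo,
            ← ENNReal.ofReal_mul hT.le, ← ENNReal.ofReal_mul (by positivity)]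
          refine ENNReal.ofReal_le_ofReal ?_
          have : (1 : ℝ) ≤ 2 * Real.pi := by linarith [Real.pi_gt_three]
          have h3 : 0 ≤ T ^ 2 * θ := by positivity
          nlinarith
      _ ≤ _ := by
          refine setLIntegral_mono' measurableSet_Ioo fun t ht => ?_
          simp only [smul_eq_mul]
          rw [lintegral_const_mul]
          · gcongr
            · exact ht.1.le
            · exact hcirc t ht.1 ht.2
          · exact hm.comp (hps.comp measurable_prodMk_left)
  exact absurd hvol (not_lt.2 hlow)

/-- **Hartogs' lemma**: a uniformly bounded sequence of holomorphic functions that decays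
geometrically at each point decays geometrically, with any worse ratio, near a given point. -/
theorem exists_uniform_geometric_bound {c : ℕ → ℂ → ℂ} {a : ℂ} {R q θ : ℝ} (hR : 0 < R)
    (hc : ∀ n, DifferentiableOn ℂ (c n) (Metric.ball a R))
    (h1 : ∀ n, ∀ w ∈ Metric.ball a R, ‖c n w‖ ≤ 1) (hq : 0 < q)
    (h2 : ∀ w ∈ Metric.ball a R, ∃ C : ℝ, ∀ n, ‖c n w‖ ≤ C * q ^ n) (hθ : 0 < θ) (hθ1 : θ ≤ 1) :
    ∃ C : ℝ, ∀ n, ∀ w ∈ Metric.ball a (R / 4), ‖c n w‖ ≤ C * (q ^ n) ^ (1 - θ) := by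
  -- `B k` collects the points where the geometric decay holds with no constant below `k`
  let B : ℕ → Set ℂ := fun k => Metric.ball a R ∩ ⋃ n, {w | (k : ℝ) * q ^ n < ‖c n w‖}
  have hBopen : ∀ k, IsOpen (B k) := fun k => by
    simp only [B, inter_iUnion]
    refine isOpen_iUnion fun n => ?_
    exact ((hc n).continuousOn.norm).isOpen_inter_preimage Metric.isOpen_ball isOpen_Ioi
  have hanti : Antitone B := fun k l hkl w hw => by
    refine ⟨hw.1, ?_⟩
    obtain ⟨n, hn⟩ := mem_iUnion.1 hw.2
    have hn' : (l : ℝ) * q ^ n < ‖c n w‖ := hn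
    refine mem_iUnion.2 ⟨n, show (k : ℝ) * q ^ n < ‖c n w‖ from lt_of_le_of_lt ?_ hn'⟩
    have : (k : ℝ) ≤ l := by exact_mod_cast hkl
    gcongr
  have hempty : ⋂ k, B k = ∅ := by
    refine eq_empty_of_forall_notMem fun w hw => ?_
    have hw0 := (mem_iInter.1 hw 0).1
    obtain ⟨C, hC⟩ := h2 w hw0
    obtain ⟨k, hk⟩ := exists_nat_ge C
    obtain ⟨n, hn⟩ := mem_iUnion.1 (mem_iInter.1 hw k).2
    refine absurd (hn.trans_le (hC n)) (not_lt.2 ?_)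
    gcongr
  have hlim : Tendsto (fun k => volume (B k)) atTop (𝓝 0) := by
    have := tendsto_measure_iInter_atTop (μ := volume) (s := B)
      (fun k => (hBopen k).measurableSet.nullMeasurableSet) hanti
      ⟨0, ne_top_of_le_ne_top (measure_ball_lt_top (x := a) (r := R)).ne
        (measure_mono inter_subset_left)⟩
    rwa [hempty, measure_empty] at this
  have hpos : 0 < ENNReal.ofReal ((R / 4) ^ 2 * θ) := ENNReal.ofReal_pos.2 (by positivity)
  obtain ⟨k, hk, hk1⟩ := ((hlim.eventually (gt_mem_nhds hpos)).and (eventually_ge_atTop 1)).exists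
  have hk1' : (1 : ℝ) ≤ k := by exact_mod_cast hk1
  refine ⟨(k : ℝ) ^ (1 - θ), fun n w hw => ?_⟩
  rw [← Real.mul_rpow (by positivity) (by positivity)]
  rw [Metric.mem_ball] at hw
  have hwR : w ∈ Metric.ball a R := by rw [Metric.mem_ball]; linarith
  rcases le_or_gt ((k : ℝ) * q ^ n) 1 with hle | hgt
  · obtain ⟨t, ht1, ht2, ht3⟩ :=
      exists_circleAverage_indicator_le (hBopen k).measurableSet (w := w) (T := R / 4)
        (by positivity) hθ hk
    have hsub : Metric.closedBall w t ⊆ Metric.ball a R :=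
      Metric.closedBall_subset_ball' (by linarith)
    refine norm_le_rpow_of_circleAverage_indicator_le (t := t) (B := B k) (by linarith)
      (fun z hz => (hc n).analyticAt (Metric.isOpen_ball.mem_nhds (hsub hz))) (by positivity) hle
      (fun z hz => h1 n z (hsub hz)) (hBopen k).measurableSet (fun z hz hzB => ?_) ht3
    by_contra! hlt
    exact hzB ⟨hsub hz, mem_iUnion.2 ⟨n, hlt⟩⟩
  · exact (h1 n w hwR).trans (Real.one_le_rpow hgt.le (by linarith))

/-- **Hartogs' theorem** on separate holomorphy, restricted to the diagonal. -/
theorem SepHolomorphicOn.differentiableAt_diag {g : ℂ → ℂ → ℂ} {a : ℂ} {R : ℝ} (hR : 0 < R)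
    (h : SepHolomorphicOn g (Metric.ball a R) (Metric.ball a R)) :
    DifferentiableAt ℂ (fun t => g t t) a := by
  set η : ℝ := R / 16 with hη
  have hη0 : 0 < η := by positivity
  obtain ⟨b, hb, r, hr, M, hM⟩ := h.exists_bounded_strip hη0 (by linarith)
  rw [Metric.mem_ball] at hb
  obtain ⟨r, hr, hrR, hM⟩ : ∃ r > 0, Metric.ball b r ⊆ Metric.ball a R ∧
      ∀ w ∈ Metric.ball a η, ∀ s ∈ Metric.ball b r, ‖g w s‖ ≤ M := by
    refine ⟨min r (R / 2), lt_min hr (by positivity), Metric.ball_subset_ball' ?_,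
      fun w hw s hs => hM w (Metric.ball_subset_closedBall hw) s
        (Metric.ball_subset_ball (min_le_left _ _) hs)⟩
    linarith [min_le_right r (R / 2)]
  have hηR : Metric.ball a η ⊆ Metric.ball a R := Metric.ball_subset_ball (by linarith)
  have hM0 : 0 ≤ M := (norm_nonneg _).trans
    (hM a (Metric.mem_ball_self hη0) b (Metric.mem_ball_self hr))
  let T : ℕ → ℂ → ℂ := fun n w => (n.factorial : ℂ)⁻¹ * iteratedDeriv n (g w) b
  have hfac : ∀ n : ℕ, ‖((n.factorial : ℂ))⁻¹‖ = (n.factorial : ℝ)⁻¹ := fun n => by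
    rw [norm_inv, Complex.norm_natCast]
  have hcauchy : ∀ (n : ℕ) (w : ℂ) (ρ C : ℝ), 0 < ρ → Metric.closedBall b ρ ⊆ Metric.ball a R →
      w ∈ Metric.ball a R → (∀ s ∈ Metric.closedBall b ρ, ‖g w s‖ ≤ C) →
      ‖T n w‖ ≤ C / ρ ^ n := by
    intro n w ρ C hρ hsub hw hC
    have h1 := Complex.norm_iteratedDeriv_le_of_forall_mem_sphere_norm_le (f := g w) n hρ
      (((h.snd w hw).mono hsub).diffContOnCl_ball subset_rfl)
      (fun z hz => hC z (Metric.sphere_subset_closedBall hz))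
    have hn : (0 : ℝ) < n.factorial := by exact_mod_cast n.factorial_pos
    rw [norm_mul, hfac]
    calc (n.factorial : ℝ)⁻¹ * ‖iteratedDeriv n (g w) b‖
        ≤ (n.factorial : ℝ)⁻¹ * (n.factorial * C / ρ ^ n) := by gcongr
      _ = C / ρ ^ n := by field_simp
  -- normalized coefficients, bounded by one
  let N : ℝ := max M 1
  have hN : 0 < N := lt_of_lt_of_le one_pos (le_max_right _ _)
  let c : ℕ → ℂ → ℂ := fun n w => (((r / 2) ^ n / N : ℝ) : ℂ) * T n w
  have hcn : ∀ n w, ‖c n w‖ = (r / 2) ^ n / N * ‖T n w‖ := fun n w => by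
    rw [norm_mul, Complex.norm_real, Real.norm_of_nonneg (by positivity)]
  have hc1 : ∀ n, ∀ w ∈ Metric.ball a η, ‖c n w‖ ≤ 1 := by
    intro n w hw
    have hsub : Metric.closedBall b (r / 2) ⊆ Metric.ball b r :=
      Metric.closedBall_subset_ball (by linarith)
    have h1 := hcauchy n w (r / 2) N (by positivity) (hsub.trans hrR) (hηR hw)
      (fun s hs => (hM w hw s (hsub hs)).trans (le_max_left _ _))
    rw [hcn]
    calc (r / 2) ^ n / N * ‖T n w‖ ≤ (r / 2) ^ n / N * (N / (r / 2) ^ n) := by gcongr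
      _ = 1 := by field_simp
  have hR2 : Metric.closedBall b (R / 2) ⊆ Metric.ball a R :=
    Metric.closedBall_subset_ball' (by linarith)
  set q : ℝ := r / R with hq
  have hq0 : 0 < q := by positivity
  have hc2 : ∀ w ∈ Metric.ball a η, ∃ C : ℝ, ∀ n, ‖c n w‖ ≤ C * q ^ n := by
    intro w hw
    obtain ⟨C, hC⟩ := (isCompact_closedBall b (R / 2)).exists_bound_of_continuousOn
      (((h.snd w (hηR hw)).continuousOn).mono hR2)
    refine ⟨C / N, fun n => ?_⟩
    have h1 := hcauchy n w (R / 2) C (by positivity) hR2 (hηR hw) hC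
    rw [hcn]
    calc (r / 2) ^ n / N * ‖T n w‖ ≤ (r / 2) ^ n / N * (C / (R / 2) ^ n) := by gcongr
      _ = C / N * q ^ n := by rw [hq, div_pow, div_pow, div_pow]; field_simp
  obtain ⟨θ, hθ0, hθ1, hθ⟩ : ∃ θ : ℝ, 0 < θ ∧ θ ≤ 1 ∧ (q⁻¹) ^ θ < 2 := by
    have hcont : Tendsto (fun θ : ℝ => (q⁻¹) ^ θ) (𝓝[>] 0) (𝓝 1) := by
      have := (Real.continuousAt_const_rpow (a := q⁻¹) (b := 0) (by positivity)).tendsto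
      rw [Real.rpow_zero] at this
      exact this.mono_left nhdsWithin_le_nhds
    obtain ⟨θ, h1, h2⟩ := ((hcont.eventually (gt_mem_nhds one_lt_two)).and
      (Ioc_mem_nhdsGT (zero_lt_one' ℝ))).exists
    exact ⟨θ, h2.1, h2.2, h1⟩
  obtain ⟨C, hC⟩ := exists_uniform_geometric_bound (c := c) hη0
    (fun n => ((SepHolomorphicOn.differentiableOn_iteratedDeriv_snd n Metric.isOpen_ball hr
      (h.mono hηR hrR) hM).const_mul _).const_mul _) hc1 hq0 hc2 hθ0 hθ1
  have hratio : q ^ (1 - θ) * (2 / r) * (2 * η) ≤ 1 / 2 := by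
    rw [Real.rpow_sub hq0, Real.rpow_one, div_eq_mul_inv, ← Real.inv_rpow hq0.le]
    calc q * q⁻¹ ^ θ * (2 / r) * (2 * η) = (1 / 4) * q⁻¹ ^ θ := by
          rw [hη, hq]; field_simp; ring
      _ ≤ 1 / 2 := by linarith
  refine SepHolomorphicOn.differentiableAt_diag_of_bounded (r := η / 4) (M := N * C * 2)
    (by positivity) (h.mono (Metric.ball_subset_ball (by linarith))
      (Metric.ball_subset_ball (by linarith))) fun w hw s hs => ?_
  have hwη : w ∈ Metric.ball a η := Metric.ball_subset_ball (by linarith) hw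
  have hsb : ‖s - b‖ ≤ 2 * η := by
    rw [← dist_eq_norm]
    rw [Metric.mem_ball] at hs
    linarith [dist_triangle_right s b a]
  have hsb' : s ∈ Metric.ball b (R / 2) := by
    rw [mem_ball_iff_norm]; linarith
  rw [← Complex.taylorSeries_eq_on_ball' hsb'
    (((h.snd w (hηR hwη)).mono (Metric.ball_subset_closedBall.trans hR2)))]
  refine tsum_of_norm_bounded (hasSum_geometric_two.mul_left (N * C)) fun n => ?_
  have h1 := hC n w hw
  have h2 : ‖T n w‖ = N * (2 / r) ^ n * ‖c n w‖ := by
    rw [hcn, div_pow, div_pow]; field_simp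
  have hC0 : 0 ≤ C * (q ^ n) ^ (1 - θ) := (norm_nonneg _).trans h1
  rw [norm_mul, norm_pow]
  change ‖T n w‖ * ‖s - b‖ ^ n ≤ _
  have h3 : (q ^ n) ^ (1 - θ) = (q ^ (1 - θ)) ^ n := by
    rw [← Real.rpow_natCast, ← Real.rpow_mul hq0.le, mul_comm, Real.rpow_mul hq0.le,
      Real.rpow_natCast]
  have hC1 : 0 ≤ C := by
    by_contra! hneg
    have : 0 < (q ^ n) ^ (1 - θ) := by positivity
    nlinarith
  calc ‖T n w‖ * ‖s - b‖ ^ n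
      ≤ (N * (2 / r) ^ n * (C * (q ^ n) ^ (1 - θ))) * (2 * η) ^ n := by
        rw [h2]; gcongr
    _ = N * C * (q ^ (1 - θ) * (2 / r) * (2 * η)) ^ n := by
        rw [h3]; simp only [mul_pow]; ring
    _ ≤ N * C * (1 / 2) ^ n := by gcongr

/-! ### Measurable dependence on a parameter under holomorphic continuation -/

/-- A family of holomorphic functions that depends measurably on a parameter at each point of
`[-1,1]` does so at each point of a disc around a point of `[-1,1]`: its Taylor coefficients are
limits of difference quotients within `[-1,1]`. -/
theorem measurable_of_measurable_realInterval {Ω : Type*} [MeasurableSpace Ω] {F : Ω → ℂ → ℂ}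
    {O : Set ℂ} (hO : IsOpen O) (hI : realInterval ⊆ O) (hF : ∀ ω, DifferentiableOn ℂ (F ω) O)
    (hm : ∀ t ∈ realInterval, Measurable fun ω => F ω t) {x w : ℂ} {r : ℝ} (hx : x ∈ realInterval)
    (hr : Metric.ball x r ⊆ O) (hw : w ∈ Metric.ball x r) : Measurable fun ω => F ω w := by
  have key : ∀ (n : ℕ) (F : Ω → ℂ → ℂ), (∀ ω, DifferentiableOn ℂ (F ω) O) →
      (∀ t ∈ realInterval, Measurable fun ω => F ω t) →
      ∀ t ∈ realInterval, Measurable fun ω => iteratedDeriv n (F ω) t := by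
    intro n
    induction n with
    | zero => intro F _ hm t ht; simpa using hm t ht
    | succ n ih =>
      intro F hF hm
      simp_rw [iteratedDeriv_succ']
      refine ih (fun ω => deriv (F ω)) (fun ω => (hF ω).deriv hO) fun t ht => ?_
      obtain ⟨t, ht', rfl⟩ := ht
      -- a sign that points from `t` into the interval
      obtain ⟨σ, hσ0, hσ⟩ : ∃ σ : ℝ, σ ≠ 0 ∧ ∀ u ∈ Icc (0 : ℝ) 1, t + σ * u ∈ Icc (-1 : ℝ) 1 := by
        rcases le_total t 0 with h | h
        · exact ⟨1, one_ne_zero, fun u hu => ⟨by linarith [ht'.1, hu.1], by linarith [hu.2]⟩⟩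
        · exact ⟨-1, by norm_num, fun u hu => ⟨by linarith [hu.2], by linarith [ht'.2, hu.1]⟩⟩
      let e : ℕ → ℝ := fun n => 1 / ((n : ℝ) + 1)
      have he0 : ∀ n, 0 < e n := fun n => by positivity
      have he1 : ∀ n, e n ≤ 1 := fun n => by
        simp only [e]; rw [div_le_one (by positivity)]; simp
      have helim : Tendsto e atTop (𝓝 0) := tendsto_one_div_add_atTop_nhds_zero_nat
      have hseq : Tendsto (fun n => ((t + σ * e n : ℝ) : ℂ)) atTop (𝓝[≠] (t : ℂ)) := by
        rw [tendsto_nhdsWithin_iff]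
        refine ⟨?_, Eventually.of_forall fun n => ?_⟩
        · have h1 : Tendsto (fun n => t + σ * e n) atTop (𝓝 t) := by
            simpa using (helim.const_mul σ).const_add t
          exact (Complex.continuous_ofReal.tendsto t).comp h1
        · simp [hσ0, (he0 n).ne']
      refine measurable_of_tendsto_metrizable
        (f := fun (n : ℕ) ω => slope (F ω) (t : ℂ) ((t + σ * e n : ℝ) : ℂ)) (fun n => ?_) ?_
      · simp only [slope_def_field]
        exact ((hm _ ⟨_, hσ _ ⟨(he0 n).le, he1 n⟩, rfl⟩).sub (hm _ ⟨t, ht', rfl⟩)).div_const _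
      · rw [tendsto_pi_nhds]
        intro ω
        have hd : HasDerivAt (F ω) (deriv (F ω) t) t :=
          ((hF ω).differentiableAt (hO.mem_nhds (hI ⟨t, ht', rfl⟩))).hasDerivAt
        exact hd.tendsto_slope.comp hseq
  refine measurable_of_tendsto_metrizable (f := fun (N : ℕ) ω => ∑ n ∈ Finset.range N,
    ((n.factorial : ℂ)⁻¹ • (w - x) ^ n • iteratedDeriv n (F ω) x)) (fun N => ?_) ?_
  · refine Finset.measurable_sum _ fun n _ => ?_
    simpa only [smul_eq_mul] using ((key n F hF hm x hx).const_mul _).const_mul _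
  · rw [tendsto_pi_nhds]
    intro ω
    exact (Complex.hasSum_taylorSeries_on_ball ((hF ω).mono hr) hw).tendsto_sum_nat

/-! ### Neighbourhoods of the parameter space in weighted `ℓ¹` -/

/-- The distance of a complex number to the interval `[-1,1]`. -/
def gap (w : ℂ) : ℝ := Metric.infDist w realInterval

theorem isCompact_realInterval : IsCompact realInterval :=
  isCompact_Icc.image Complex.continuous_ofReal

theorem zero_mem_realInterval : (0 : ℂ) ∈ realInterval := ⟨0, by simp, by simp⟩

theorem realInterval_nonempty : realInterval.Nonempty := ⟨0, zero_mem_realInterval⟩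

theorem convex_realInterval : Convex ℝ realInterval :=
  (convex_Icc (-1 : ℝ) 1).linear_image Complex.ofRealCLM.toLinearMap

theorem gap_nonneg (w : ℂ) : 0 ≤ gap w := Metric.infDist_nonneg

theorem gap_of_mem {w : ℂ} (h : w ∈ realInterval) : gap w = 0 :=
  Metric.infDist_zero_of_mem h

theorem gap_le_add (w w' : ℂ) : gap w ≤ gap w' + ‖w - w'‖ := by
  rw [← dist_eq_norm]; exact Metric.infDist_le_infDist_add_dist

theorem continuous_gap : Continuous gap := Metric.continuous_infDist_pt _

theorem exists_nearest (w : ℂ) : ∃ t : Icc (-1 : ℝ) 1, ‖w - (t : ℝ)‖ = gap w := by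
  obtain ⟨_, ⟨t, ht, rfl⟩, h⟩ := isCompact_realInterval.exists_infDist_eq_dist
    realInterval_nonempty w
  exact ⟨⟨t, ht⟩, by rw [gap, h, dist_eq_norm]⟩

/-- A point of `[-1,1]` nearest to `w`. -/
def nearest (w : ℂ) : Icc (-1 : ℝ) 1 := (exists_nearest w).choose

theorem norm_sub_nearest (w : ℂ) : ‖w - ((nearest w : ℝ) : ℂ)‖ = gap w :=
  (exists_nearest w).choose_spec

theorem nearest_mem (w : ℂ) : ((nearest w : ℝ) : ℂ) ∈ realInterval := ⟨_, (nearest w).2, rfl⟩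

theorem nearest_of_mem {w : ℂ} (h : w ∈ realInterval) : ((nearest w : ℝ) : ℂ) = w := by
  have := norm_sub_nearest w
  rw [gap_of_mem h, norm_eq_zero, sub_eq_zero] at this
  exact this.symm

theorem norm_le_one_of_mem_realInterval {w : ℂ} (h : w ∈ realInterval) : ‖w‖ ≤ 1 := by
  obtain ⟨t, ht, rfl⟩ := h
  simpa [abs_le] using ht

theorem norm_le_one_add_gap (w : ℂ) : ‖w‖ ≤ 1 + gap w := by
  have h1 := norm_le_one_of_mem_realInterval (nearest_mem w)
  have h2 := norm_sub_nearest w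
  linarith [norm_le_norm_add_norm_sub' w ((nearest w : ℝ) : ℂ)]

theorem ParamSpace.toComplex_mem (y : ParamSpace) (j : ℕ) : y.toComplex j ∈ realInterval :=
  ⟨y j, (y j).2, rfl⟩

/-- The sequences whose distance to the parameter space, in the norm `∑ b_j |z_j|`, is smaller than
`η`, and that vanish at the indices without weight. -/
def fullDomain (b : ℕ → ℝ) (η : ℝ) : Set (ℕ → ℂ) :=
  {z | (∀ j, b j = 0 → z j = 0) ∧ Summable (fun j => b j * gap (z j)) ∧
    ∑' j, b j * gap (z j) < η}

/-- The elements of `fullDomain b η` of which all but finitely many coordinates lie in `[-1,1]`. On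
this set a separately holomorphic extension is unique. -/
def finDomain (b : ℕ → ℝ) (η : ℝ) : Set (ℕ → ℂ) :=
  {z ∈ fullDomain b η | {j | z j ∉ realInterval}.Finite}

theorem fullDomain_mono {b : ℕ → ℝ} {η η' : ℝ} (h : η ≤ η') : fullDomain b η ⊆ fullDomain b η' :=
  fun _ hz => ⟨hz.1, hz.2.1, hz.2.2.trans_le h⟩

theorem finDomain_mono {b : ℕ → ℝ} {η η' : ℝ} (h : η ≤ η') : finDomain b η ⊆ finDomain b η' :=
  fun _ hz => ⟨fullDomain_mono h hz.1, hz.2⟩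

theorem hasSum_gap_update {b : ℕ → ℝ} {η : ℝ} {z : ℕ → ℂ} (hz : z ∈ fullDomain b η) (j : ℕ)
    (w : ℂ) : HasSum (fun i => b i * gap (Function.update z j w i))
      (∑' i, b i * gap (z i) + b j * (gap w - gap (z j))) := by
  have h := hz.2.1.hasSum.update j (b j * gap w)
  have e : Function.update (fun i => b i * gap (z i)) j (b j * gap w)
      = fun i => b i * gap (Function.update z j w i) := by
    funext i
    by_cases hi : i = j
    · subst hi; simp
    · simp [hi]
  rw [e] at h
  convert! h using 1
  ring

theorem update_mem_fullDomain_iff {b : ℕ → ℝ} {η η' : ℝ} {z : ℕ → ℂ} (hz : z ∈ fullDomain b η)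
    {j : ℕ} (hj : b j ≠ 0) (w : ℂ) : Function.update z j w ∈ fullDomain b η' ↔
      ∑' i, b i * gap (z i) + b j * (gap w - gap (z j)) < η' := by
  have h := hasSum_gap_update hz j w
  refine ⟨fun hw => h.tsum_eq ▸ hw.2.2, fun hw => ⟨fun i hi => ?_, h.summable, by rwa [h.tsum_eq]⟩⟩
  have hij : i ≠ j := fun hij => hj (hij ▸ hi)
  simp [hij, hz.1 i hi]

theorem update_mem_fullDomain {b : ℕ → ℝ} (hb : ∀ j, 0 ≤ b j) {η δ : ℝ} {z : ℕ → ℂ}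
    (hz : z ∈ fullDomain b η) {j : ℕ} (hj : b j ≠ 0) {w : ℂ} (hw : b j * ‖w - z j‖ ≤ δ) :
    Function.update z j w ∈ fullDomain b (η + δ) := by
  rw [update_mem_fullDomain_iff hz hj]
  have h1 := gap_le_add w (z j)
  have h2 : b j * (gap w - gap (z j)) ≤ b j * ‖w - z j‖ :=
    mul_le_mul_of_nonneg_left (by linarith) (hb j)
  linarith [hz.2.2]

theorem isOpen_update_mem_fullDomain {b : ℕ → ℝ} {η η' : ℝ} {z : ℕ → ℂ}
    (hz : z ∈ fullDomain b η) {j : ℕ} (hj : b j ≠ 0) :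
    IsOpen {w | Function.update z j w ∈ fullDomain b η'} := by
  simp_rw [update_mem_fullDomain_iff hz hj]
  exact isOpen_lt ((continuous_const.mul (continuous_gap.sub continuous_const)).const_add _)
    continuous_const

theorem finite_update {z : ℕ → ℂ} (hz : {j | z j ∉ realInterval}.Finite) (j : ℕ) (w : ℂ) :
    {i | Function.update z j w i ∉ realInterval}.Finite := by
  refine (hz.insert j).subset fun i hi => ?_
  by_cases hij : i = j
  · exact Or.inl hij
  · right; simpa [hij] using hi

theorem update_mem_finDomain_iff {b : ℕ → ℝ} {η η' : ℝ} {z : ℕ → ℂ} (hz : z ∈ finDomain b η)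
    {j : ℕ} {w : ℂ} :
    Function.update z j w ∈ finDomain b η' ↔ Function.update z j w ∈ fullDomain b η' :=
  ⟨fun h => h.1, fun h => ⟨h, finite_update hz.2 j w⟩⟩

/-- Two points of `finDomain b η` can be mixed coordinatewise within `finDomain b (2 * η)`. -/
theorem piecewise_mem_finDomain {b : ℕ → ℝ} (hb : ∀ j, 0 ≤ b j) {η : ℝ} {z z' : ℕ → ℂ}
    (hz : z ∈ finDomain b η) (hz' : z' ∈ finDomain b η) (S : Finset ℕ) :
    S.piecewise z' z ∈ finDomain b (2 * η) := by
  have hle : ∀ j, b j * gap (S.piecewise z' z j) ≤ b j * gap (z j) + b j * gap (z' j) := fun j => by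
    have h1 := mul_nonneg (hb j) (gap_nonneg (z j))
    have h2 := mul_nonneg (hb j) (gap_nonneg (z' j))
    by_cases hj : j ∈ S <;> simp [hj, h1, h2]
  have hs := hz.1.2.1.add hz'.1.2.1
  have hs' : Summable fun j => b j * gap (S.piecewise z' z j) :=
    hs.of_nonneg_of_le (fun j => mul_nonneg (hb j) (gap_nonneg _)) hle
  refine ⟨⟨fun j hj => ?_, hs', ?_⟩, ?_⟩
  · by_cases hjS : j ∈ S <;> simp [hjS, hz.1.1 j hj, hz'.1.1 j hj]
  · calc _ ≤ ∑' j, (b j * gap (z j) + b j * gap (z' j)) := hs'.tsum_le_tsum hle hs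
      _ < 2 * η := by
        rw [hz.1.2.1.tsum_add hz'.1.2.1]
        linarith [hz.1.2.2, hz'.1.2.2]
  · refine (hz.2.union hz'.2).subset fun j hj => ?_
    by_cases hjS : j ∈ S
    · right; simpa [hjS] using hj
    · left; simpa [hjS] using hj

/-- `H` is bounded by `B` and holomorphic in each variable on `finDomain b η`. -/
structure IsBoundedSepHolomorphic {X : Type*} [NormedAddCommGroup X] [NormedSpace ℂ X]
    (b : ℕ → ℝ) (η B : ℝ) (H : (ℕ → ℂ) → X) : Prop where
  bound : ∀ z ∈ finDomain b η, ‖H z‖ ≤ B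
  differentiableAt : ∀ z ∈ finDomain b η, ∀ j, b j ≠ 0 →
    DifferentiableAt ℂ (fun w => H (Function.update z j w)) (z j)

section Lipschitz

variable {X : Type*} [NormedAddCommGroup X] [NormedSpace ℂ X] {b : ℕ → ℝ} {η B : ℝ}
  {H : (ℕ → ℂ) → X}

theorem IsBoundedSepHolomorphic.differentiableOn_update (hH : IsBoundedSepHolomorphic b η B H)
    {z : ℕ → ℂ} {η' : ℝ} (hz : z ∈ finDomain b η') {j : ℕ} (hj : b j ≠ 0) :
    DifferentiableOn ℂ (fun w => H (Function.update z j w))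
      {w | Function.update z j w ∈ fullDomain b η} := by
  intro w hw
  have h := hH.differentiableAt _ ((update_mem_finDomain_iff hz).2 hw) j hj
  simp only [Function.update_idem, Function.update_self] at h
  exact h.differentiableWithinAt

theorem IsBoundedSepHolomorphic.norm_update_sub_le (hb : ∀ j, 0 ≤ b j) (hη : 0 < η)
    (hH : IsBoundedSepHolomorphic b (3 * η) B H) {z : ℕ → ℂ} (hz : z ∈ finDomain b (2 * η))
    {j : ℕ} {w : ℂ} (hw : Function.update z j w ∈ finDomain b (2 * η)) :
    ‖H (Function.update z j w) - H z‖ ≤ 2 * B / η * (b j * ‖w - z j‖) := by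
  rcases eq_or_ne (b j) 0 with hj | hj
  · have h1 := hw.1.1 j hj
    rw [Function.update_self] at h1
    rw [h1, ← hz.1.1 j hj, Function.update_eq_self]
    simp
  have hbj : 0 < b j := lt_of_le_of_ne (hb j) hj.symm
  have hB : 0 ≤ B := (norm_nonneg _).trans (hH.bound z (finDomain_mono (by linarith) hz))
  rcases lt_or_ge ‖w - z j‖ (η / b j) with hlt | hge
  · have hmem : ∀ t ∈ Metric.ball (z j) (η / b j), Function.update z j t ∈ fullDomain b (3 * η) := by
      intro t ht
      rw [mem_ball_iff_norm, lt_div_iff₀' hbj] at ht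
      have := update_mem_fullDomain hb hz.1 hj ht.le
      rwa [show 2 * η + η = 3 * η by ring] at this
    have h := norm_sub_le_of_bounded_ball
      ((hH.differentiableOn_update hz hj).mono hmem)
      (fun t ht => hH.bound _ ((update_mem_finDomain_iff hz).2 (hmem t ht)))
      (mem_ball_iff_norm.2 hlt)
    simp only [Function.update_eq_self] at h
    refine h.trans_eq ?_
    field_simp
  · rw [div_le_iff₀' hbj] at hge
    calc ‖H (Function.update z j w) - H z‖ ≤ B + B :=
          (norm_sub_le _ _).trans (add_le_add (hH.bound _ (finDomain_mono (by linarith) hw))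
            (hH.bound _ (finDomain_mono (by linarith) hz)))
      _ = 2 * B / η * η := by field_simp; ring
      _ ≤ _ := by gcongr

/-- A bounded separately holomorphic function is Lipschitz in the weighted `ℓ¹` norm along points
that differ in finitely many coordinates. -/
theorem IsBoundedSepHolomorphic.norm_sub_le (hb : ∀ j, 0 ≤ b j) (hη : 0 < η)
    (hH : IsBoundedSepHolomorphic b (3 * η) B H) {z z' : ℕ → ℂ} (hz : z ∈ finDomain b η)
    (hz' : z' ∈ finDomain b η) {S : Finset ℕ} (hS : ∀ j ∉ S, z' j = z j) :
    ‖H z' - H z‖ ≤ 2 * B / η * ∑ j ∈ S, b j * ‖z' j - z j‖ := by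
  have key : ∀ T : Finset ℕ,
      ‖H (T.piecewise z' z) - H z‖ ≤ 2 * B / η * ∑ j ∈ T, b j * ‖z' j - z j‖ := by
    intro T
    induction T using Finset.induction_on with
    | empty => simp
    | insert j T hj ih =>
      have h1 := piecewise_mem_finDomain hb hz hz' T
      have h2 := piecewise_mem_finDomain hb hz hz' (insert j T)
      rw [Finset.piecewise_insert] at h2 ⊢
      have h3 := hH.norm_update_sub_le hb hη h1 h2
      rw [Finset.piecewise_eq_of_notMem _ _ _ hj] at h3
      rw [Finset.sum_insert hj, mul_add]
      calc _ ≤ ‖H (Function.update (T.piecewise z' z) j (z' j)) - H (T.piecewise z' z)‖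
            + ‖H (T.piecewise z' z) - H z‖ := norm_sub_le_norm_sub_add_norm_sub _ _ _
        _ ≤ _ := add_le_add h3 ih
  have h := key S
  have e : S.piecewise z' z = z' := by
    funext j
    by_cases hj : j ∈ S <;> simp [hj, hS]
  rwa [e] at h

end Lipschitz

/-! ### Extension to sequences with infinitely many non-real coordinates -/

/-- The sequence `z` with the coordinates from `N` on moved to the nearest point of `[-1,1]`. -/
def realTail (z : ℕ → ℂ) (N : ℕ) : ℕ → ℂ := fun j => if j < N then z j else ((nearest (z j) : ℝ) : ℂ)

theorem gap_realTail_le (z : ℕ → ℂ) (N j : ℕ) : gap (realTail z N j) ≤ gap (z j) := by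
  unfold realTail
  split_ifs
  · exact le_rfl
  · rw [gap_of_mem (nearest_mem _)]; exact gap_nonneg _

theorem realTail_mem {b : ℕ → ℝ} (hb : ∀ j, 0 ≤ b j) {η : ℝ} {z : ℕ → ℂ} (hz : z ∈ fullDomain b η)
    (N : ℕ) : realTail z N ∈ finDomain b η := by
  have hle : ∀ j, b j * gap (realTail z N j) ≤ b j * gap (z j) := fun j =>
    mul_le_mul_of_nonneg_left (gap_realTail_le z N j) (hb j)
  have hs : Summable fun j => b j * gap (realTail z N j) :=
    hz.2.1.of_nonneg_of_le (fun j => mul_nonneg (hb j) (gap_nonneg _)) hle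
  refine ⟨⟨fun j hj => ?_, hs, (hs.tsum_le_tsum hle hz.2.1).trans_lt hz.2.2⟩, ?_⟩
  · have h0 := hz.1 j hj
    unfold realTail
    split_ifs
    · exact h0
    · rw [h0]; exact nearest_of_mem zero_mem_realInterval
  · refine (Set.finite_lt_nat N).subset fun j hj => ?_
    by_contra h
    have h' : ¬ j < N := h
    refine hj ?_
    simp only [realTail, h', if_false]
    exact nearest_mem _

theorem realTail_of_real {z : ℕ → ℂ} (hz : ∀ j, z j ∈ realInterval) (N : ℕ) : realTail z N = z := by
  funext j
  unfold realTail
  split_ifs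
  · rfl
  · exact nearest_of_mem (hz j)

theorem realTail_update {z : ℕ → ℂ} {j N : ℕ} (hj : j < N) (w : ℂ) :
    realTail (Function.update z j w) N = Function.update (realTail z N) j w := by
  funext i
  by_cases hi : i = j
  · subst hi; simp [realTail, hj]
  · simp [realTail, hi]

section Limit

variable {X : Type*} [NormedAddCommGroup X]

/-- The extension of `H` from `finDomain` to `fullDomain` by continuity. -/
def limitExtension (H : (ℕ → ℂ) → X) (z : ℕ → ℂ) : X := limUnder atTop fun N => H (realTail z N)

theorem limitExtension_of_real {H : (ℕ → ℂ) → X} {z : ℕ → ℂ} (hz : ∀ j, z j ∈ realInterval) :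
    limitExtension H z = H z := by
  unfold limitExtension
  simp_rw [realTail_of_real hz]
  exact tendsto_const_nhds.limUnder_eq

variable [NormedSpace ℂ X] {b : ℕ → ℝ} {η B : ℝ} {H : (ℕ → ℂ) → X}

theorem norm_realTail_sub_realTail_le (hb : ∀ j, 0 ≤ b j) (hη : 0 < η)
    (hH : IsBoundedSepHolomorphic b (3 * η) B H) {z : ℕ → ℂ} (hz : z ∈ fullDomain b η) {N M : ℕ}
    (hNM : N ≤ M) : ‖H (realTail z M) - H (realTail z N)‖ ≤
      2 * B / η * ∑' j, b (j + N) * gap (z (j + N)) := by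
  have hB : 0 ≤ B := (norm_nonneg _).trans
    (hH.bound _ (finDomain_mono (by linarith) (realTail_mem hb hz 0)))
  have h := hH.norm_sub_le hb hη (realTail_mem hb hz N) (realTail_mem hb hz M)
    (S := Finset.Ico N M) (fun j hj => by
      simp only [Finset.mem_Ico, not_and, not_lt] at hj
      unfold realTail
      by_cases h1 : j < N
      · simp [h1, h1.trans_le hNM]
      · have h2 : ¬ j < M := not_lt.2 (hj (not_lt.1 h1))
        simp [h1, h2])
  refine h.trans ?_
  have hnn : ∀ j, 0 ≤ b j * gap (z j) := fun j => mul_nonneg (hb j) (gap_nonneg _)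
  gcongr
  calc ∑ j ∈ Finset.Ico N M, b j * ‖realTail z M j - realTail z N j‖
      = ∑ j ∈ Finset.Ico N M, b j * gap (z j) := by
        refine Finset.sum_congr rfl fun j hj => ?_
        rw [Finset.mem_Ico] at hj
        simp [realTail, hj.2, not_lt.2 hj.1, norm_sub_nearest]
    _ = ∑ j ∈ Finset.range (M - N), b (j + N) * gap (z (j + N)) := by
        rw [Finset.sum_Ico_eq_sum_range]
        simp_rw [add_comm N]
    _ ≤ _ := ((summable_nat_add_iff N).2 hz.2.1).sum_le_tsum _ fun j _ => hnn _

variable [CompleteSpace X]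

theorem tendsto_limitExtension (hb : ∀ j, 0 ≤ b j) (hη : 0 < η)
    (hH : IsBoundedSepHolomorphic b (3 * η) B H) {z : ℕ → ℂ} (hz : z ∈ fullDomain b η) :
    Tendsto (fun N => H (realTail z N)) atTop (𝓝 (limitExtension H z)) := by
  refine tendsto_nhds_limUnder (cauchySeq_tendsto_of_complete (cauchySeq_of_le_tendsto_0'
    (fun N => 2 * B / η * ∑' j, b (j + N) * gap (z (j + N))) (fun N M hNM => ?_) ?_))
  · rw [dist_comm, dist_eq_norm]
    exact norm_realTail_sub_realTail_le hb hη hH hz hNM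
  · simpa using (tendsto_sum_nat_add fun j => b j * gap (z j)).const_mul (2 * B / η)

theorem norm_limitExtension_sub_le (hb : ∀ j, 0 ≤ b j) (hη : 0 < η)
    (hH : IsBoundedSepHolomorphic b (3 * η) B H) {z : ℕ → ℂ} (hz : z ∈ fullDomain b η) (N : ℕ) :
    ‖limitExtension H z - H (realTail z N)‖ ≤ 2 * B / η * ∑' j, b (j + N) * gap (z (j + N)) := by
  refine le_of_tendsto ((tendsto_limitExtension hb hη hH hz).sub_const _).norm ?_
  filter_upwards [eventually_ge_atTop N] with M hM
  exact norm_realTail_sub_realTail_le hb hη hH hz hM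

theorem differentiableAt_limitExtension (hb : ∀ j, 0 ≤ b j) (hη : 0 < η)
    (hH : IsBoundedSepHolomorphic b (3 * η) B H) {z : ℕ → ℂ} (hz : z ∈ fullDomain b η) {j : ℕ}
    (hj : b j ≠ 0) :
    DifferentiableAt ℂ (fun w => limitExtension H (Function.update z j w)) (z j) := by
  set O : Set ℂ := {w | Function.update z j w ∈ fullDomain b η}
  have hO : IsOpen O := isOpen_update_mem_fullDomain hz hj
  have hzO : z j ∈ O := by simpa [O] using hz
  have hsum : Tendsto (fun N => 2 * B / η * ∑' i, b (i + N) * gap (z (i + N))) atTop (𝓝 0) := by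
    simpa using (tendsto_sum_nat_add fun j => b j * gap (z j)).const_mul (2 * B / η)
  have hunif : TendstoUniformlyOn (fun N w => H (realTail (Function.update z j w) N))
      (fun w => limitExtension H (Function.update z j w)) atTop O := by
    rw [Metric.tendstoUniformlyOn_iff]
    intro δ hδ
    filter_upwards [hsum.eventually (gt_mem_nhds hδ), eventually_gt_atTop j] with N hN hjN w hw
    rw [dist_eq_norm]
    refine (norm_limitExtension_sub_le hb hη hH hw N).trans_lt (lt_of_eq_of_lt ?_ hN)
    congr 2
    funext i
    rw [Function.update_of_ne (by omega)]
  refine (hunif.tendstoLocallyUniformlyOn.differentiableOn ?_ hO).differentiableAt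
    (hO.mem_nhds hzO)
  filter_upwards [eventually_gt_atTop j] with N hN
  simp_rw [realTail_update hN]
  refine (hH.differentiableOn_update (realTail_mem hb hz N) hj).mono fun w hw => ?_
  have h := (realTail_mem hb hw N).1
  rw [realTail_update hN] at h
  exact fullDomain_mono (by linarith) h

end Limit

/-! ### Solutions of holomorphic families of invertible equations -/

theorem bernsteinEllipse_subset_stadium (s : ℝ) : bernsteinEllipse s ⊆ stadium s := by
  rintro _ ⟨z, h1, h2, rfl⟩
  have hz0 : 0 < ‖z‖ := by linarith
  set r := ‖z‖ with hr
  -- the point `z / ‖z‖` projects to a point of `[-1,1]`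
  set x : ℝ := z.re / r
  set y : ℝ := z.im / r
  have hsq : z.re ^ 2 + z.im ^ 2 = r ^ 2 := by
    rw [hr, ← Complex.normSq_eq_norm_sq, Complex.normSq_apply]; ring
  have hx : |x| ≤ 1 := by
    rw [abs_div, abs_of_pos hz0, div_le_one hz0]; exact Complex.abs_re_le_norm z
  have hxI : ((x : ℝ) : ℂ) ∈ realInterval := ⟨x, abs_le.1 hx, rfl⟩
  have hxy : x ^ 2 + y ^ 2 = 1 := by
    simp only [x, y, div_pow]; rw [← add_div, hsq, div_self (by positivity)]
  have hre : ((z + z⁻¹) / 2 - x).re = ((r + 1 / r) / 2 - 1) * x := by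
    simp [Complex.inv_re, Complex.normSq_eq_norm_sq, ← hr, x]; field_simp
  have him : ((z + z⁻¹) / 2 - x).im = ((r - 1 / r) / 2) * y := by
    simp [Complex.inv_im, Complex.normSq_eq_norm_sq, ← hr, y]; field_simp; ring
  have hnorm : ‖(z + z⁻¹) / 2 - x‖ ≤ r - 1 := by
    refine le_of_sq_le_sq ?_ (by linarith)
    rw [← Complex.normSq_eq_norm_sq, Complex.normSq_apply, hre, him]
    have h3 : 0 ≤ (r + 1 / r) / 2 - 1 ∧ (r + 1 / r) / 2 - 1 ≤ r - 1 := by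
      constructor
      · have : (r + 1 / r) / 2 - 1 = (r - 1) ^ 2 / (2 * r) := by field_simp; ring
        rw [this]; positivity
      · have : 1 / r ≤ 1 := by rw [div_le_one hz0]; exact h1
        linarith
    have h4 : 0 ≤ (r - 1 / r) / 2 ∧ (r - 1 / r) / 2 ≤ r - 1 := by
      have h5 : (r - 1 / r) / 2 = (r - 1) * ((r + 1) / (2 * r)) := by field_simp; ring
      have h6 : (r + 1) / (2 * r) ≤ 1 := by rw [div_le_one (by positivity)]; linarith
      have h7 : 0 ≤ (r + 1) / (2 * r) := by positivity
      rw [h5]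
      constructor
      · exact mul_nonneg (by linarith) h7
      · nlinarith
    have h8 : ((r + 1 / r) / 2 - 1) ^ 2 ≤ (r - 1) ^ 2 := pow_le_pow_left₀ h3.1 h3.2 2
    have h9 : ((r - 1 / r) / 2) ^ 2 ≤ (r - 1) ^ 2 := pow_le_pow_left₀ h4.1 h4.2 2
    calc _ = ((r + 1 / r) / 2 - 1) ^ 2 * x ^ 2 + ((r - 1 / r) / 2) ^ 2 * y ^ 2 := by ring
      _ ≤ (r - 1) ^ 2 * x ^ 2 + (r - 1) ^ 2 * y ^ 2 := by gcongr
      _ = (r - 1) ^ 2 := by rw [← mul_add, hxy, mul_one]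
  have h := Metric.infDist_le_dist_of_mem (x := (z + z⁻¹) / 2) hxI
  rw [dist_eq_norm] at h
  change Metric.infDist _ _ ≤ _
  linarith

theorem polyEllipse_subset_polyStadium (ρ : ℕ → ℝ) : polyEllipse ρ ⊆ polyStadium ρ :=
  fun _ hz j => bernsteinEllipse_subset_stadium _ (hz j)

/-- The sequence `z` with the coordinates of weight zero replaced by zero. -/
def restrictSupport (b : ℕ → ℝ) (z : ℕ → ℂ) : ℕ → ℂ := fun j => if b j = 0 then 0 else z j

theorem restrictSupport_mem {b : ℕ → ℝ} {ε η : ℝ} (hb : ∀ j, 0 ≤ b j) {ρ : ℕ → ℝ}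
    (hρ : IsAdmissible b ε ρ) (hε : ε < η) {z : ℕ → ℂ} (hz : z ∈ polyStadium ρ) :
    restrictSupport b z ∈ fullDomain b η ∧
      ∑' j, b j * gap (restrictSupport b z j) ≤ ε := by
  have hle : ∀ j, b j * gap (restrictSupport b z j) ≤ (ρ j - 1) * b j := fun j => by
    unfold restrictSupport
    split_ifs with h
    · simp [h]
    · rw [mul_comm]; exact mul_le_mul_of_nonneg_right (hz j) (hb j)
  have hs : Summable fun j => b j * gap (restrictSupport b z j) :=
    hρ.2.1.of_nonneg_of_le (fun j => mul_nonneg (hb j) (gap_nonneg _)) hle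
  have h := (hs.tsum_le_tsum hle hρ.2.1).trans hρ.2.2
  exact ⟨⟨fun j hj => by simp [restrictSupport, hj], hs, h.trans_lt hε⟩, h⟩

theorem restrictSupport_real_mem (b : ℕ → ℝ) (y : ParamSpace) (j : ℕ) :
    restrictSupport b y.toComplex j ∈ realInterval := by
  unfold restrictSupport
  split_ifs
  · exact zero_mem_realInterval
  · exact y.toComplex_mem j

theorem IsAdmissible.mono {b : ℕ → ℝ} {ε ε' : ℝ} (h : ε ≤ ε') {ρ : ℕ → ℝ}
    (hρ : IsAdmissible b ε ρ) : IsAdmissible b ε' ρ := ⟨hρ.1, hρ.2.1, hρ.2.2.trans h⟩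

theorem continuous_weightedDist {b : ℕ → ℝ} (hb : ∀ j, 0 ≤ b j) (hbs : Summable b)
    (y : ParamSpace) :
    Continuous fun y' : ParamSpace => ∑' j, b j * |(y j : ℝ) - y' j| := by
  refine continuous_tsum (u := fun j => b j * 2) (fun j => by fun_prop) (hbs.mul_right 2)
    fun j y' => ?_
  rw [Real.norm_of_nonneg (mul_nonneg (hb j) (abs_nonneg _))]
  refine mul_le_mul_of_nonneg_left ?_ (hb j)
  rw [abs_le]
  have h1 := (y j).2
  have h2 := (y' j).2
  constructor <;> linarith [h1.1, h1.2, h2.1, h2.2]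

variable {E : Type*} [NormedAddCommGroup E] [NormedSpace ℂ E] [CompleteSpace E]

/-- Neumann series: an operator close to an invertible one is invertible, with a bound. -/
theorem isInvertible_of_close {T S : E →L[ℂ] E} (hS : S.IsInvertible) {M : ℝ} (hM : 0 < M)
    (hSM : ‖S.inverse‖ ≤ M) (hTS : ‖T - S‖ ≤ 1 / (2 * M)) :
    T.IsInvertible ∧ ‖T.inverse‖ ≤ 2 * M := by
  have hD : ‖S.inverse ∘L (T - S)‖ ≤ 1 / 2 := by
    calc ‖S.inverse ∘L (T - S)‖ ≤ ‖S.inverse‖ * ‖T - S‖ := ContinuousLinearMap.opNorm_comp_le _ _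
      _ ≤ M * (1 / (2 * M)) := by gcongr
      _ = 1 / 2 := by field_simp
  have hT : T = S ∘L (1 - (-(S.inverse ∘L (T - S)))) := by
    ext x
    simp [hS.self_apply_inverse]
  have hu : IsUnit (1 - (-(S.inverse ∘L (T - S)))) :=
    isUnit_one_sub_of_norm_lt_one (by rw [norm_neg]; linarith)
  have hinv : T.IsInvertible := by
    rw [hT]
    refine hS.comp ?_
    obtain ⟨u, hu⟩ := hu
    exact ⟨ContinuousLinearEquiv.ofUnit u, by rw [← hu]; rfl⟩
  refine ⟨hinv, ?_⟩
  have h1 : T.inverse = S.inverse - (S.inverse ∘L (T - S)) ∘L T.inverse := by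
    ext x
    have h2 := hS.inverse_apply_self (T.inverse x)
    simp [hinv.self_apply_inverse, hS.inverse_apply_self]
  have h2 : ‖T.inverse‖ ≤ M + 1 / 2 * ‖T.inverse‖ := by
    calc ‖T.inverse‖ = ‖S.inverse - (S.inverse ∘L (T - S)) ∘L T.inverse‖ := congrArg _ h1
      _ ≤ ‖S.inverse‖ + ‖(S.inverse ∘L (T - S)) ∘L T.inverse‖ := norm_sub_le _ _
      _ ≤ M + 1 / 2 * ‖T.inverse‖ := by
        gcongr
        exact (ContinuousLinearMap.opNorm_comp_le _ _).trans (by gcongr)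
  linarith

/-- If the operators `A y` extend to a bounded separately holomorphic family near the parameter
space, depend on `y` in a Lipschitz way and are invertible, then the solutions of `A y u = f y`
inherit the parametric holomorphy of the right-hand sides. -/
theorem isBPEHolomorphic_inverse_apply {b : ℕ → ℝ} {p η B L : ℝ} (hb : ∀ j, 0 ≤ b j)
    (hbs : Summable b) (hη : 0 < η) {H : (ℕ → ℂ) → E →L[ℂ] E}
    (hH : IsBoundedSepHolomorphic b (3 * η) B H) {A : ParamSpace → E →L[ℂ] E}
    (hA : ∀ y, A y = H (restrictSupport b y.toComplex))
    (hL : ∀ y y' : ParamSpace, ‖A y - A y'‖ ≤ L * ∑' j, b j * |(y j : ℝ) - y' j|)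
    (hinv : ∀ y, (A y).IsInvertible) {f : ParamSpace → E}
    (hf : ∃ ε > 0, IsBPEHolomorphic b p ε f) (hfc : Continuous f) :
    ∃ ε > 0, IsBPEHolomorphic b p ε (fun y => (A y).inverse (f y)) ∧
      Continuous fun y => (A y).inverse (f y) := by
  obtain ⟨εf, hεf, hfb, ⟨C₀, hC₀⟩, Cf, hCf⟩ := hf
  have hAc : Continuous A := by
    rw [continuous_iff_continuousAt]
    intro y
    rw [ContinuousAt, tendsto_iff_norm_sub_tendsto_zero]
    have h1 := ((continuous_weightedDist hb hbs y).const_mul L).tendsto y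
    simp only [sub_self, abs_zero, mul_zero, tsum_zero] at h1
    refine squeeze_zero (fun _ => norm_nonneg _) (fun y' => ?_) h1
    rw [norm_sub_rev]
    exact hL y y'
  have hAinvc : Continuous fun y => (A y).inverse := by
    rw [continuous_iff_continuousAt]
    intro y
    exact (((hinv y).contDiffAt_map_inverse (n := 0)).continuousAt).comp hAc.continuousAt
  obtain ⟨M₀, hM₀⟩ : ∃ M₀, ∀ y, ‖(A y).inverse‖ ≤ M₀ := by
    obtain ⟨C, hC⟩ := isCompact_univ.exists_bound_of_continuousOn hAinvc.continuousOn
    exact ⟨C, fun y => hC y (mem_univ _)⟩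
  set M : ℝ := max M₀ 1
  have hM : 0 < M := lt_of_lt_of_le one_pos (le_max_right _ _)
  have hM' : ∀ y, ‖(A y).inverse‖ ≤ M := fun y => (hM₀ y).trans (le_max_left _ _)
  set K : ℝ := |2 * B / η| + 1
  have hK : 0 < K := by positivity
  set ε : ℝ := min εf (min (η / 2) (1 / (2 * M * K)))
  have hε : 0 < ε := by positivity
  refine ⟨ε, hε, ⟨hfb, ⟨M * C₀, fun y => ?_⟩, 2 * M * Cf, fun ρ hρ => ?_⟩, hAinvc.clm_apply hfc⟩
  · exact ((A y).inverse.le_opNorm _).trans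
      (mul_le_mul (hM' y) (hC₀ y) (norm_nonneg _) hM.le)
  have hεη : ε < η := by
    have : ε ≤ η / 2 := (min_le_right _ _).trans (min_le_left _ _)
    linarith
  obtain ⟨vf, ⟨hvf1, hvf2⟩, hvf3⟩ := hCf ρ (hρ.mono (min_le_left _ _))
  -- the extended operator is close to the operator at the nearest real parameter
  have hclose : ∀ z ∈ polyStadium ρ,
      (limitExtension H (restrictSupport b z)).IsInvertible ∧
      ‖(limitExtension H (restrictSupport b z)).inverse‖ ≤ 2 * M := by
    intro z hz
    obtain ⟨h1, h2⟩ := restrictSupport_mem hb hρ hεη hz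
    set x := restrictSupport b z
    let y : ParamSpace := fun j => nearest (x j)
    have hy : A y = H (realTail x 0) := by
      rw [hA]
      congr 1
      funext j
      have h0 : realTail x 0 j = ((nearest (x j) : ℝ) : ℂ) := by simp [realTail]
      rw [h0]
      by_cases hj : b j = 0
      · rw [h1.1 j hj, nearest_of_mem zero_mem_realInterval]; simp [restrictSupport, hj]
      · simp only [restrictSupport, hj, if_false]; rfl
    refine isInvertible_of_close (hinv y) hM (hM' y) ?_
    rw [hy]
    have h3 := norm_limitExtension_sub_le hb hη hH h1 0
    simp only [add_zero] at h3
    have h4 : 0 ≤ ∑' j, b j * gap (x j) := tsum_nonneg fun j => mul_nonneg (hb j) (gap_nonneg _)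
    calc _ ≤ 2 * B / η * ∑' j, b j * gap (x j) := h3
      _ ≤ K * ε := by
        refine mul_le_mul ?_ h2 h4 hK.le
        exact (le_abs_self _).trans (by simp [K])
      _ ≤ K * (1 / (2 * M * K)) := by
        gcongr
        exact (min_le_right _ _).trans (min_le_right _ _)
      _ = 1 / (2 * M) := by field_simp
  refine ⟨fun z => (limitExtension H (restrictSupport b z)).inverse (vf z),
    ⟨fun y => ?_, fun z hz j => ?_⟩, fun z hz => ?_⟩
  · change (limitExtension H (restrictSupport b y.toComplex)).inverse (vf y.toComplex) = _
    rw [limitExtension_of_real (restrictSupport_real_mem b y), ← hA, hvf1]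
  · intro w hw
    have hz' : Function.update z j w ∈ polyStadium ρ := fun i => by
      by_cases hi : i = j
      · subst hi; simpa using hw
      · simpa [hi] using hz i
    have h1 : DifferentiableAt ℂ
        (fun t => limitExtension H (restrictSupport b (Function.update z j t))) w := by
      by_cases hj : b j = 0
      · have : (fun t => limitExtension H (restrictSupport b (Function.update z j t)))
            = fun _ => limitExtension H (restrictSupport b z) := by
          funext t
          congr 1
          funext i
          unfold restrictSupport
          by_cases hi : i = j
          · subst hi; simp [hj]
          · simp [hi]
        rw [this]
        exact differentiableAt_const _
      · have h2 := differentiableAt_limitExtension hb hη hH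
          (restrictSupport_mem hb hρ hεη hz').1 hj
        have e : ∀ t, Function.update (restrictSupport b (Function.update z j w)) j t
            = restrictSupport b (Function.update z j t) := by
          intro t
          funext i
          unfold restrictSupport
          by_cases hi : i = j
          · subst hi; simp [hj]
          · simp [hi]
        simp_rw [e] at h2
        have e2 : restrictSupport b (Function.update z j w) j = w := by
          simp [restrictSupport, hj]
        rwa [e2] at h2
    have h3 : DifferentiableAt ℂ
        (fun t => (limitExtension H (restrictSupport b (Function.update z j t))).inverse) w :=
      DifferentiableAt.comp (g := ContinuousLinearMap.inverse) w
        (((hclose _ hz').1.contDiffAt_map_inverse (n := 1)).differentiableAt one_ne_zero) h1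
    exact h3.differentiableWithinAt.clm_apply (hvf2 z hz j w hw)
  · refine (ContinuousLinearMap.le_opNorm _ _).trans ?_
    exact mul_le_mul (hclose z (polyEllipse_subset_polyStadium ρ hz)).2 (hvf3 z hz)
      (norm_nonneg _) (by positivity)

/-! ### Uniqueness of holomorphic extensions -/

theorem exists_toComplex_eq {z : ℕ → ℂ} (hz : ∀ j, z j ∈ realInterval) :
    ∃ y : ParamSpace, y.toComplex = z :=
  ⟨fun j => nearest (z j), funext fun j => nearest_of_mem (hz j)⟩

theorem setOf_gap_lt_eq (s : ℝ) : {w | gap w < s} = Metric.thickening s realInterval := by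
  ext w
  rw [Metric.mem_thickening_iff_infDist_lt realInterval_nonempty]
  rfl

/-- Two holomorphic extensions of the same function agree where all but finitely many coordinates
are real. -/
theorem IsHolomorphicExtension.eq_of_finite {u : ParamSpace → ℂ} {v₁ v₂ : (ℕ → ℂ) → ℂ}
    {ρ₁ ρ₂ : ℕ → ℝ} (h₁ : IsHolomorphicExtension ρ₁ u v₁) (h₂ : IsHolomorphicExtension ρ₂ u v₂)
    {z : ℕ → ℂ} (hz : {j | z j ∉ realInterval}.Finite) (hz₁ : ∀ j, gap (z j) < ρ₁ j - 1)
    (hz₂ : ∀ j, gap (z j) < ρ₂ j - 1) : v₁ z = v₂ z := by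
  have key : ∀ (S : Finset ℕ) (z : ℕ → ℂ), (∀ j ∉ S, z j ∈ realInterval) →
      (∀ j, gap (z j) < ρ₁ j - 1) → (∀ j, gap (z j) < ρ₂ j - 1) → v₁ z = v₂ z := by
    intro S
    induction S using Finset.induction_on with
    | empty =>
      intro z hz _ _
      obtain ⟨y, rfl⟩ := exists_toComplex_eq fun j => hz j (Finset.notMem_empty j)
      rw [h₁.1, h₂.1]
    | insert j S hj ih =>
      intro z hz hz₁ hz₂
      set s : ℝ := min (ρ₁ j - 1) (ρ₂ j - 1) with hs
      set O : Set ℂ := {w | gap w < s} with hO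
      have hOopen : IsOpen O := isOpen_lt continuous_gap continuous_const
      have hOconn : IsPreconnected O := by
        rw [hO, setOf_gap_lt_eq]
        exact (convex_realInterval.thickening s).isPreconnected
      have hs0 : 0 < s := lt_min ((gap_nonneg _).trans_lt (hz₁ j)) ((gap_nonneg _).trans_lt (hz₂ j))
      have hd₁ : DifferentiableOn ℂ (fun w => v₁ (Function.update z j w)) O :=
        (h₁.2 z (fun i => (hz₁ i).le) j).mono fun w hw =>
          show gap w ≤ ρ₁ j - 1 from (lt_of_lt_of_le hw (min_le_left _ _)).le
      have hd₂ : DifferentiableOn ℂ (fun w => v₂ (Function.update z j w)) O :=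
        (h₂.2 z (fun i => (hz₂ i).le) j).mono fun w hw =>
          show gap w ≤ ρ₂ j - 1 from (lt_of_lt_of_le hw (min_le_right _ _)).le
      have hreal : ∀ w ∈ realInterval,
          v₁ (Function.update z j w) = v₂ (Function.update z j w) := by
        intro w hw
        refine ih _ (fun i hi => ?_) (fun i => ?_) fun i => ?_
        · by_cases hij : i = j
          · subst hij; simpa using hw
          · simpa [hij] using hz i (by simp [hij, hi])
        · by_cases hij : i = j
          · subst hij; simpa [gap_of_mem hw] using (gap_nonneg _).trans_lt (hz₁ i)
          · simpa [hij] using hz₁ i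
        · by_cases hij : i = j
          · subst hij; simpa [gap_of_mem hw] using (gap_nonneg _).trans_lt (hz₂ i)
          · simpa [hij] using hz₂ i
      have hfreq : ∃ᶠ w in 𝓝[≠] (0 : ℂ),
          v₁ (Function.update z j w) = v₂ (Function.update z j w) := by
        have hlim : Tendsto (fun n : ℕ => ((1 / ((n : ℝ) + 1) : ℝ) : ℂ)) atTop (𝓝[≠] 0) := by
          rw [tendsto_nhdsWithin_iff]
          refine ⟨?_, Eventually.of_forall fun n => ?_⟩
          · exact (Complex.continuous_ofReal.tendsto 0).comp tendsto_one_div_add_atTop_nhds_zero_nat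
          · simp only [mem_compl_iff, mem_singleton_iff, Complex.ofReal_eq_zero]
            positivity
        refine hlim.frequently (Frequently.of_forall fun n => hreal _ ⟨_, ⟨?_, ?_⟩, rfl⟩)
        · have : (0 : ℝ) ≤ 1 / ((n : ℝ) + 1) := by positivity
          linarith
        · rw [div_le_one (by positivity)]; simp
      have heq := (hd₁.analyticOnNhd hOopen).eqOn_of_preconnected_of_frequently_eq
        (hd₂.analyticOnNhd hOopen) hOconn
        (show (0 : ℂ) ∈ O by simpa [hO, gap_of_mem zero_mem_realInterval] using hs0) hfreq
      have := heq (show z j ∈ O from lt_min (hz₁ j) (hz₂ j))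
      simpa using this
  exact key hz.toFinset z (fun j hj => by simpa using hj) hz₁ hz₂

theorem exists_isAdmissible {b : ℕ → ℝ} (hb : ∀ j, 0 ≤ b j) {ε : ℝ} {g : ℕ → ℝ}
    (hg : ∀ j, 0 ≤ g j) (hs : Summable fun j => b j * g j) (hlt : ∑' j, b j * g j < ε) :
    ∃ ρ, IsAdmissible b ε ρ ∧ ∀ j, g j < ρ j - 1 := by
  set θ : ℝ := ε - ∑' j, b j * g j with hθ
  have hθ0 : 0 < θ := by linarith
  let e : ℕ → ℝ := fun j => θ / 2 / 2 ^ j / (b j + 1)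
  have he0 : ∀ j, 0 < e j := fun j => by have := hb j; positivity
  have hle : ∀ j, e j * b j ≤ θ / 2 / 2 ^ j := fun j => by
    have h1 := hb j
    have h2 : b j / (b j + 1) ≤ 1 := by rw [div_le_one (by linarith)]; linarith
    calc e j * b j = θ / 2 / 2 ^ j * (b j / (b j + 1)) := by simp only [e]; ring
      _ ≤ θ / 2 / 2 ^ j * 1 := by gcongr
      _ = _ := mul_one _
  have hsum := hasSum_geometric_two' θ
  have hes : Summable fun j => e j * b j :=
    hsum.summable.of_nonneg_of_le (fun j => mul_nonneg (he0 j).le (hb j)) hle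
  have hfun : (fun j => (1 + g j + e j - 1) * b j) = fun j => b j * g j + e j * b j := by
    funext j; ring
  refine ⟨fun j => 1 + g j + e j, ⟨fun j => by linarith [hg j, he0 j], ?_, ?_⟩,
    fun j => by linarith [he0 j]⟩
  · rw [hfun]; exact hs.add hes
  · rw [hfun, hs.tsum_add hes]
    have := (hes.tsum_le_tsum hle hsum.summable).trans_eq hsum.tsum_eq
    linarith

/-! ### Independence of parameters without weight -/

theorem exists_joukowski (w : ℂ) : ∃ z : ℂ, 1 ≤ ‖z‖ ∧ w = (z + z⁻¹) / 2 := by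
  obtain ⟨d, hd⟩ := IsAlgClosed.exists_pow_nat_eq (w ^ 2 - 1) (n := 2) (by norm_num)
  have hprod : (w + d) * (w - d) = 1 := by linear_combination -hd
  have hnorm : ‖w + d‖ * ‖w - d‖ = 1 := by rw [← norm_mul, hprod, norm_one]
  rcases le_or_gt 1 ‖w + d‖ with h | h
  · refine ⟨w + d, h, ?_⟩
    rw [inv_eq_of_mul_eq_one_right hprod]; ring
  · refine ⟨w - d, ?_, ?_⟩
    · by_contra! h'
      nlinarith [norm_nonneg (w + d), norm_nonneg (w - d)]
    · rw [inv_eq_of_mul_eq_one_left hprod]; ring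

theorem mem_bernsteinEllipse_of_norm_le {s : ℝ} {w : ℂ} (hw : ‖w‖ ≤ (s - 1) / 2) :
    w ∈ bernsteinEllipse s := by
  obtain ⟨z, hz, rfl⟩ := exists_joukowski w
  refine ⟨z, hz, ?_, rfl⟩
  have hz0 : 0 < ‖z‖ := by linarith
  have h1 : ‖z‖ - ‖z‖⁻¹ ≤ ‖z + z⁻¹‖ := by
    have := norm_sub_le_norm_add z z⁻¹
    rwa [norm_inv] at this
  have h2 : ‖z‖⁻¹ ≤ 1 := inv_le_one_of_one_le₀ hz
  rw [norm_div, Complex.norm_ofNat] at hw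
  linarith

theorem realInterval_subset_bernsteinEllipse {s : ℝ} (hs : 1 ≤ s) :
    realInterval ⊆ bernsteinEllipse s := by
  rintro _ ⟨t, ht, rfl⟩
  have h1 : 0 ≤ 1 - t ^ 2 := by nlinarith [ht.1, ht.2]
  have hsq : Complex.normSq ⟨t, √(1 - t ^ 2)⟩ = 1 := by
    rw [Complex.normSq_mk, Real.mul_self_sqrt h1]; ring
  have hn : ‖(⟨t, √(1 - t ^ 2)⟩ : ℂ)‖ = 1 := by
    rw [Complex.normSq_eq_norm_sq] at hsq
    nlinarith [norm_nonneg (⟨t, √(1 - t ^ 2)⟩ : ℂ)]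
  refine ⟨⟨t, √(1 - t ^ 2)⟩, hn.ge, hn.le.trans hs, ?_⟩
  rw [Complex.inv_def, hsq]
  apply Complex.ext <;> simp

/-- Liouville's theorem: a parametrically holomorphic function does not depend on a parameter
without weight. -/
theorem IsBPEHolomorphic.update_eq {b : ℕ → ℝ} {p ε : ℝ} (hε : 0 < ε) {u : ParamSpace → ℂ}
    (hu : IsBPEHolomorphic b p ε u) {j : ℕ} (hj : b j = 0) (y : ParamSpace) (t : Icc (-1 : ℝ) 1) :
    u (Function.update y j t) = u (Function.update y j ⟨0, by simp⟩) := by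
  obtain ⟨⟨hb, -⟩, -, C, hC⟩ := hu
  have htoC : ∀ s : Icc (-1 : ℝ) 1, (ParamSpace.toComplex (Function.update y j s))
      = Function.update y.toComplex j ((s : ℝ) : ℂ) := by
    intro s
    funext i
    unfold ParamSpace.toComplex
    by_cases hi : i = j
    · subst hi; simp
    · simp [hi]
  have hbound : ∀ R : ℝ, 2 < R → ‖u (Function.update y j t) - u (Function.update y j ⟨0, by simp⟩)‖
      ≤ 4 * C / R := by
    intro R hR
    obtain ⟨ρ, hρ, hρg⟩ := exists_isAdmissible hb (ε := ε) (g := fun i => if i = j then R else 0)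
      (fun i => by split_ifs <;> linarith) (by
        convert! summable_zero using 2 with i
        split_ifs with hi
        · simp [hi, hj]
        · simp) (by
        have : (fun i => b i * if i = j then R else 0) = fun _ => 0 := by
          funext i
          split_ifs with hi
          · simp [hi, hj]
          · simp
        rw [this]; simpa using hε)
    obtain ⟨v, ⟨hv1, hv2⟩, hv3⟩ := hC ρ hρ
    have hρj : R < ρ j - 1 := by simpa using hρg j
    have hymem : y.toComplex ∈ polyStadium ρ := fun i => by
      change gap _ ≤ _
      rw [gap_of_mem (y.toComplex_mem i)]
      linarith [hρ.1 i]
    have hd : DifferentiableOn ℂ (fun w => v (Function.update y.toComplex j w))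
        (Metric.ball 0 (R / 2)) := by
      refine (hv2 _ hymem j).mono fun w hw => ?_
      rw [mem_ball_zero_iff] at hw
      have := gap_le_add w 0
      rw [gap_of_mem zero_mem_realInterval, sub_zero] at this
      change gap w ≤ _
      linarith
    have hbd : ∀ w ∈ Metric.ball (0 : ℂ) (R / 2), ‖v (Function.update y.toComplex j w)‖ ≤ C := by
      intro w hw
      rw [mem_ball_zero_iff] at hw
      refine hv3 _ fun i => ?_
      by_cases hi : i = j
      · subst hi
        simpa using mem_bernsteinEllipse_of_norm_le (by linarith)
      · simpa [hi] using realInterval_subset_bernsteinEllipse (hρ.1 i).le (y.toComplex_mem i)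
    have ht1 : ‖((t : ℝ) : ℂ)‖ ≤ 1 := norm_le_one_of_mem_realInterval ⟨t, t.2, rfl⟩
    have h := norm_sub_le_of_bounded_ball hd hbd (z := ((t : ℝ) : ℂ))
      (by rw [mem_ball_zero_iff]; linarith)
    have hC0 : 0 ≤ C := (norm_nonneg _).trans (hbd 0 (Metric.mem_ball_self (by linarith)))
    rw [← htoC t, hv1] at h
    have h0 := htoC ⟨0, by simp⟩
    simp only [Complex.ofReal_zero] at h0
    rw [← h0, hv1, sub_zero] at h
    refine h.trans ?_
    calc 2 * C / (R / 2) * ‖((t : ℝ) : ℂ)‖ ≤ 2 * C / (R / 2) * 1 := by gcongr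
      _ = 4 * C / R := by field_simp; ring
  have hlim : Tendsto (fun R : ℝ => 4 * C / R) atTop (𝓝 0) := tendsto_const_nhds.div_atTop tendsto_id
  have h0 := ge_of_tendsto hlim ((eventually_gt_atTop 2).mono hbound)
  exact sub_eq_zero.1 (norm_le_zero_iff.1 h0)

/-- The real parameter `y` with the coordinates of weight zero replaced by zero. -/
def restrictReal (b : ℕ → ℝ) (y : ParamSpace) : ParamSpace :=
  fun j => if b j = 0 then ⟨0, by simp⟩ else y j

theorem toComplex_restrictReal (b : ℕ → ℝ) (y : ParamSpace) :
    (restrictReal b y).toComplex = restrictSupport b y.toComplex := by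
  funext j
  unfold ParamSpace.toComplex restrictReal restrictSupport
  split_ifs <;> simp

theorem IsBPEHolomorphic.apply_restrictReal {b : ℕ → ℝ} {p ε : ℝ} (hε : 0 < ε)
    {u : ParamSpace → ℂ} (hu : IsBPEHolomorphic b p ε u) (huc : Continuous u) (y : ParamSpace) :
    u (restrictReal b y) = u y := by
  let Y : ℕ → ParamSpace := fun N j => if j < N then restrictReal b y j else y j
  have hY : ∀ N, u (Y N) = u y := by
    intro N
    induction N with
    | zero => congr 1
    | succ N ih =>
      by_cases hN : b N = 0
      · have h1 : Y (N + 1) = Function.update (Y N) N ⟨0, by simp⟩ := by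
          funext i
          simp only [Y, Function.update_apply]
          by_cases hi : i = N
          · subst hi; simp [restrictReal, hN]
          · have : i < N + 1 ↔ i < N := by omega
            simp [hi, this]
        rw [h1, ← hu.update_eq hε hN (Y N) (Y N N), Function.update_eq_self, ih]
      · have h1 : Y (N + 1) = Y N := by
          funext i
          simp only [Y]
          by_cases hi : i = N
          · subst hi; simp [restrictReal, hN]
          · have : i < N + 1 ↔ i < N := by omega
            simp [this]
        rw [h1, ih]
  have hlim : Tendsto Y atTop (𝓝 (restrictReal b y)) := by
    rw [tendsto_pi_nhds]
    intro j
    refine tendsto_const_nhds.congr' ?_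
    filter_upwards [eventually_gt_atTop j] with N hN
    simp [Y, hN]
  have h1 := (huc.tendsto _).comp hlim
  have h2 : u ∘ Y = fun _ => u y := funext hY
  rw [h2] at h1
  exact tendsto_nhds_unique h1 tendsto_const_nhds |>.symm ▸ rfl

/-! ### The extended kernel -/

/-- The data of `IsHolomorphicSingularKernel` without the dependence on an admissible sequence: one
extension `K` of the kernel to `finDomain b η`, with a uniform bound on its singularity. -/
structure IsExtendedKernel {Γ : Set R3} {ι : Type*} (G : PatchDecomposition Γ ι)
    (φ₀ : R3 → R3) (φ : ℕ → R3 → R3) (b : ℕ → ℝ) (a : ParamSpace → R3 → C3 → ℂ)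
    (K : ι → R2 → (ℕ → ℂ) → C3 → ℂ) (η C ν : ℝ) : Prop where
  eq_real : ∀ τ, ∀ u ∈ G.dom τ, ∀ ζ ∈ kernelDomain, ∀ y : ParamSpace,
    y.toComplex ∈ finDomain b η → K τ u y.toComplex ζ = a y (rReal φ₀ φ y (G.chart τ u)) ζ
  differentiableAt_param : ∀ τ, ∀ u ∈ G.dom τ, ∀ ζ ∈ kernelDomain, ∀ z ∈ finDomain b η, ∀ j,
    b j ≠ 0 → DifferentiableAt ℂ (fun w => K τ u (Function.update z j w) ζ) (z j)
  differentiableOn : ∀ τ, ∀ u ∈ G.dom τ, ∀ z ∈ finDomain b η, DifferentiableOn ℂ (K τ u z) kernelDomain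
  bound : ∀ τ, ∀ u ∈ G.dom τ, ∀ z ∈ finDomain b η, ∀ x ∈ Γ, x ≠ G.chart τ u →
    rComplex φ₀ φ z x - rComplex φ₀ φ z (G.chart τ u) ∈ kernelDomain →
    ‖K τ u z (rComplex φ₀ φ z x - rComplex φ₀ φ z (G.chart τ u))‖ ≤
      C / ‖rComplex φ₀ φ z x - rComplex φ₀ φ z (G.chart τ u)‖ ^ ν

theorem ne_zero_of_mem_kernelDomain {ζ : C3} (h : ζ ∈ kernelDomain) : ζ ≠ 0 := by
  rintro rfl
  simp [kernelDomain] at h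

theorem exists_isAdmissible_of_mem {b : ℕ → ℝ} (hb : ∀ j, 0 ≤ b j) {ε : ℝ} {z : ℕ → ℂ}
    (hz : z ∈ fullDomain b ε) : ∃ ρ, IsAdmissible b ε ρ ∧ ∀ j, gap (z j) < ρ j - 1 :=
  exists_isAdmissible hb (fun _ => gap_nonneg _) hz.2.1 hz.2.2

/-- The extensions of the kernel for the various admissible sequences glue together. Their bounds
are uniform on a small neighbourhood: otherwise, points where they fail for larger and larger
constants would lie in one common admissible set. -/
theorem exists_isExtendedKernel {Γ : Set R3} {ι : Type*} {G : PatchDecomposition Γ ι}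
    {φ₀ : R3 → R3} {φ : ℕ → R3 → R3} {p ε : ℝ} {a : ParamSpace → R3 → C3 → ℂ}
    (hb : ∀ j, 0 ≤ lipNorm Γ (φ j)) (hε : 0 < ε) (ha : IsHolomorphicSingularKernel G φ₀ φ p ε a)
    {R : ℝ} (hR : ∀ z ∈ finDomain (fun j => lipNorm Γ (φ j)) ε, ∀ x ∈ Γ, ∀ x' ∈ Γ,
      ‖rComplex φ₀ φ z x - rComplex φ₀ φ z x'‖ ≤ R) (hchart : ∀ τ, ∀ u ∈ G.dom τ, G.chart τ u ∈ Γ) :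
    ∃ K, ∃ η > 0, ∃ C > 0, ∃ ν : ℝ, 0 ≤ ν ∧ ν < 2 ∧
      IsExtendedKernel G φ₀ φ (fun j => lipNorm Γ (φ j)) a K η C ν := by
  set b : ℕ → ℝ := fun j => lipNorm Γ (φ j) with hbdef
  choose K hK1 hK2 hK3 using ha.extension
  classical
  let Kc : ι → R2 → (ℕ → ℂ) → C3 → ℂ := fun τ u z ζ =>
    if h : ∃ ρ, IsAdmissible b ε ρ ∧ ∀ j, gap (z j) < ρ j - 1 then
      K h.choose h.choose_spec.1 τ u z ζ else 0
  have hKc : ∀ ρ (hρ : IsAdmissible b ε ρ) (z : ℕ → ℂ), {j | z j ∉ realInterval}.Finite →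
      (∀ j, gap (z j) < ρ j - 1) → ∀ τ, ∀ u ∈ G.dom τ, ∀ ζ ∈ kernelDomain,
      Kc τ u z ζ = K ρ hρ τ u z ζ := by
    intro ρ hρ z hz hzρ τ u hu ζ hζ
    have h : ∃ ρ, IsAdmissible b ε ρ ∧ ∀ j, gap (z j) < ρ j - 1 := ⟨ρ, hρ, hzρ⟩
    simp only [Kc, dif_pos h]
    exact (hK1 _ h.choose_spec.1 τ u hu ζ hζ).eq_of_finite (hK1 ρ hρ τ u hu ζ hζ) hz
      h.choose_spec.2 hzρ
  -- everything but the bound holds on all of `finDomain b ε`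
  have hreal : ∀ τ, ∀ u ∈ G.dom τ, ∀ ζ ∈ kernelDomain, ∀ y : ParamSpace,
      y.toComplex ∈ finDomain b ε → Kc τ u y.toComplex ζ = a y (rReal φ₀ φ y (G.chart τ u)) ζ := by
    intro τ u hu ζ hζ y hy
    obtain ⟨ρ, hρ, hρz⟩ := exists_isAdmissible_of_mem hb hy.1
    rw [hKc ρ hρ _ hy.2 hρz τ u hu ζ hζ]
    exact (hK1 ρ hρ τ u hu ζ hζ).1 y
  have hparam : ∀ τ, ∀ u ∈ G.dom τ, ∀ ζ ∈ kernelDomain, ∀ z ∈ finDomain b ε, ∀ j,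
      b j ≠ 0 → DifferentiableAt ℂ (fun w => Kc τ u (Function.update z j w) ζ) (z j) := by
    intro τ u hu ζ hζ z hz j _
    obtain ⟨ρ, hρ, hρz⟩ := exists_isAdmissible_of_mem hb hz.1
    have hnhds : {w | gap w < ρ j - 1} ∈ 𝓝 (z j) :=
      (isOpen_lt continuous_gap continuous_const).mem_nhds (hρz j)
    have h1 : DifferentiableAt ℂ (fun w => K ρ hρ τ u (Function.update z j w) ζ) (z j) :=
      ((hK1 ρ hρ τ u hu ζ hζ).2 z (fun i => (hρz i).le) j).differentiableAt
        (mem_of_superset hnhds fun w hw => show gap w ≤ ρ j - 1 from le_of_lt hw)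
    refine h1.congr_of_eventuallyEq ?_
    filter_upwards [hnhds] with w hw
    refine hKc ρ hρ _ (finite_update hz.2 j w) (fun i => ?_) τ u hu ζ hζ
    by_cases hi : i = j
    · subst hi; simpa using hw
    · simpa [hi] using hρz i
  have hvar : ∀ τ, ∀ u ∈ G.dom τ, ∀ z ∈ finDomain b ε,
      DifferentiableOn ℂ (Kc τ u z) kernelDomain := by
    intro τ u hu z hz
    obtain ⟨ρ, hρ, hρz⟩ := exists_isAdmissible_of_mem hb hz.1
    exact (hK2 ρ hρ τ u hu z fun i => (hρz i).le).congr fun ζ hζ =>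
      hKc ρ hρ z hz.2 hρz τ u hu ζ hζ
  by_contra! hcon
  have hbad : ∀ k : ℕ, ∃ z ∈ finDomain b (ε / 2 / 2 / 2 ^ k), ∃ τ, ∃ u ∈ G.dom τ, ∃ x ∈ Γ,
      rComplex φ₀ φ z x - rComplex φ₀ φ z (G.chart τ u) ∈ kernelDomain ∧ x ≠ G.chart τ u ∧
      ((k : ℝ) + 1) / ‖rComplex φ₀ φ z x - rComplex φ₀ φ z (G.chart τ u)‖ ^ (2 - 1 / ((k : ℝ) + 1))
        < ‖Kc τ u z (rComplex φ₀ φ z x - rComplex φ₀ φ z (G.chart τ u))‖ := by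
    intro k
    have hk : (0 : ℝ) < (k : ℝ) + 1 := by positivity
    have hk1 : 1 / ((k : ℝ) + 1) ≤ 1 := by rw [div_le_one hk]; simp
    have hk2 : 0 < 1 / ((k : ℝ) + 1) := by positivity
    by_contra! hno
    have hmono : finDomain b (ε / 2 / 2 / 2 ^ k) ⊆ finDomain b ε := by
      refine finDomain_mono ?_
      have : ε / 2 / 2 / 2 ^ k ≤ ε / 2 / 2 := div_le_self (by positivity) (one_le_pow₀ (by norm_num))
      linarith
    exact hcon Kc (ε / 2 / 2 / 2 ^ k) (by positivity) (k + 1) hk (2 - 1 / ((k : ℝ) + 1))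
      (by linarith) (by linarith)
      { eq_real := fun τ u hu ζ hζ y hy => hreal τ u hu ζ hζ y (hmono hy)
        differentiableAt_param := fun τ u hu ζ hζ z hz => hparam τ u hu ζ hζ z (hmono hz)
        differentiableOn := fun τ u hu z hz => hvar τ u hu z (hmono hz)
        bound := fun τ u hu z hz x hx hxu hζ => hno z hz τ u hu x hx hζ hxu }
  choose z hz τ u hu x hx hζ hxu hlt using hbad
  have hgeom := hasSum_geometric_two' (ε / 2)
  have hterm : ∀ j k, b j * gap (z k j) ≤ ε / 2 / 2 / 2 ^ k := fun j k =>
    ((hz k).1.2.1.le_tsum j fun i _ => mul_nonneg (hb i) (gap_nonneg _)).trans (hz k).1.2.2.le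
  have hsummable : ∀ j, Summable fun k => b j * gap (z k j) := fun j =>
    hgeom.summable.of_nonneg_of_le (fun k => mul_nonneg (hb j) (gap_nonneg _)) (hterm j)
  have hgsum : ∀ j, Summable fun k => gap (z k j) := by
    intro j
    by_cases hj : b j = 0
    · simp_rw [(hz _).1.1 j hj, gap_of_mem zero_mem_realInterval]
      exact summable_zero
    · exact (summable_mul_left_iff hj).1 (hsummable j)
  let g : ℕ → ℝ := fun j => ∑' k, gap (z k j)
  have hg0 : ∀ j, 0 ≤ g j := fun j => tsum_nonneg fun k => gap_nonneg _
  have hpartial : ∀ F : Finset ℕ, ∑ j ∈ F, b j * g j ≤ ε / 2 := by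
    intro F
    have h1 : ∑ j ∈ F, b j * g j = ∑' k, ∑ j ∈ F, b j * gap (z k j) := by
      rw [Summable.tsum_finsetSum fun j _ => hsummable j]
      exact Finset.sum_congr rfl fun j _ => tsum_mul_left.symm
    rw [h1, ← hgeom.tsum_eq]
    refine (summable_sum fun j _ => hsummable j).tsum_le_tsum (fun k => ?_) hgeom.summable
    exact ((hz k).1.2.1.sum_le_tsum F fun i _ => mul_nonneg (hb i) (gap_nonneg _)).trans
      (hz k).1.2.2.le
  have hbg0 : ∀ j, 0 ≤ b j * g j := fun j => mul_nonneg (hb j) (hg0 j)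
  have hbgs : Summable fun j => b j * g j := summable_of_sum_le hbg0 hpartial
  obtain ⟨ρ, hρ, hgρ⟩ := exists_isAdmissible hb hg0 hbgs
    ((hbgs.tsum_le_of_sum_le hpartial).trans_lt (half_lt_self hε))
  have hgap : ∀ k j, gap (z k j) < ρ j - 1 := fun k j =>
    ((hgsum j).le_tsum k fun i _ => gap_nonneg _).trans_lt (hgρ j)
  obtain ⟨C, hC, ν, hν0, hν2, hCν⟩ := hK3 ρ hρ
  set Q : ℝ := max R 1
  have hQ1 : 1 ≤ Q := le_max_right _ _
  have hev1 : ∀ᶠ k : ℕ in atTop, 1 / ((k : ℝ) + 1) < 2 - ν :=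
    tendsto_one_div_add_atTop_nhds_zero_nat.eventually (gt_mem_nhds (by linarith))
  obtain ⟨k₀, hk₀⟩ := exists_nat_ge (C * Q ^ (2 : ℝ))
  obtain ⟨k, hk1, hk2⟩ := (hev1.and (eventually_ge_atTop k₀)).exists
  have hkk : C * Q ^ (2 : ℝ) ≤ (k : ℝ) + 1 := by
    have : (k₀ : ℝ) ≤ k := by exact_mod_cast hk2
    linarith
  set ζ := rComplex φ₀ φ (z k) (x k) - rComplex φ₀ φ (z k) (G.chart (τ k) (u k)) with hζdef
  have hζ0 : 0 < ‖ζ‖ := norm_pos_iff.2 (ne_zero_of_mem_kernelDomain (hζ k))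
  have hmono : finDomain b (ε / 2 / 2 / 2 ^ k) ⊆ finDomain b ε := by
    refine finDomain_mono ?_
    have : ε / 2 / 2 / 2 ^ k ≤ ε / 2 / 2 := div_le_self (by positivity) (one_le_pow₀ (by norm_num))
    linarith
  have hζQ : ‖ζ‖ ≤ Q := (hR _ (hmono (hz k)) _ (hx k) _ (hchart _ _ (hu k))).trans (le_max_left _ _)
  have h1 := hCν (τ k) (u k) (hu k) (z k) (fun j => (hgap k j).le) (x k) (hx k) (hxu k) (hζ k)
  rw [← hKc ρ hρ (z k) (hz k).2 (hgap k) (τ k) (u k) (hu k) _ (hζ k)] at h1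
  have h2 := (hlt k).trans_le h1
  rw [← hζdef] at h2
  refine absurd h2 (not_lt.2 ?_)
  set νk : ℝ := 2 - 1 / ((k : ℝ) + 1) with hνk
  have hνk2 : νk - ν ≤ 2 := by
    have : 0 < 1 / ((k : ℝ) + 1) := by positivity
    linarith
  rw [div_le_div_iff₀ (by positivity) (by positivity)]
  calc C * ‖ζ‖ ^ νk = C * ‖ζ‖ ^ (νk - ν) * ‖ζ‖ ^ ν := by
        rw [mul_assoc, ← Real.rpow_add hζ0, sub_add_cancel]
    _ ≤ C * Q ^ (2 : ℝ) * ‖ζ‖ ^ ν := by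
        gcongr
        calc ‖ζ‖ ^ (νk - ν) ≤ Q ^ (νk - ν) :=
              Real.rpow_le_rpow hζ0.le hζQ (by linarith)
          _ ≤ Q ^ (2 : ℝ) := Real.rpow_le_rpow_of_exponent_le hQ1 hνk2
    _ ≤ ((k : ℝ) + 1) * ‖ζ‖ ^ ν := by gcongr

/-! ### Affine series in the parameter -/

@[simp] theorem complexify_apply (x : R3) (i : Fin 3) : complexify x i = ((x i : ℝ) : ℂ) := rfl

@[simp] theorem norm_complexify (x : R3) : ‖complexify x‖ = ‖x‖ := by
  simp [EuclideanSpace.norm_eq]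

theorem complexify_sub (x x' : R3) : complexify (x - x') = complexify x - complexify x' := by
  ext i; simp

/-- `complexify` as a real linear map. -/
def complexifyL : R3 →L[ℝ] C3 :=
  LinearMap.toContinuousLinearMap
    { toFun := complexify
      map_add' := fun x x' => by ext i; simp
      map_smul' := fun t x => by ext i; simp }

@[simp] theorem complexifyL_apply (x : R3) : complexifyL x = complexify x := rfl

theorem continuous_complexify : Continuous complexify := complexifyL.continuous

/-- The series `v₀ + ∑_j z_j v_j`. Both `r_z(x)` and the derivatives of `r_z ∘ χ` have this form. -/
def affineSeries (v₀ : R3) (v : ℕ → R3) (z : ℕ → ℂ) : C3 :=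
  complexify v₀ + ∑' j, z j • complexify (v j)

section AffineSeries

variable {b : ℕ → ℝ} {η s : ℝ} {v₀ : R3} {v : ℕ → R3} {z z' : ℕ → ℂ}

theorem summable_mul_norm (hb : ∀ j, 0 ≤ b j) (hbs : Summable b) (hz : z ∈ fullDomain b η) :
    Summable fun j => b j * ‖z j‖ := by
  refine (hbs.add hz.2.1).of_nonneg_of_le (fun j => mul_nonneg (hb j) (norm_nonneg _)) fun j => ?_
  nlinarith [hb j, norm_le_one_add_gap (z j)]

theorem tsum_mul_norm_le (hb : ∀ j, 0 ≤ b j) (hbs : Summable b) (hz : z ∈ fullDomain b η) :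
    ∑' j, b j * ‖z j‖ ≤ ∑' j, b j + η := by
  have h := (summable_mul_norm hb hbs hz).tsum_le_tsum (g := fun j => b j + b j * gap (z j))
    (fun j => by nlinarith [hb j, norm_le_one_add_gap (z j)]) (hbs.add hz.2.1)
  rw [hbs.tsum_add hz.2.1] at h
  linarith [hz.2.2]

theorem norm_smul_complexify_le (hv : ∀ j, ‖v j‖ ≤ b j * s) (j : ℕ) :
    ‖z j • complexify (v j)‖ ≤ b j * ‖z j‖ * s := by
  rw [norm_smul, norm_complexify]
  nlinarith [hv j, norm_nonneg (z j)]

theorem summable_affineSeries (hz : Summable fun j => b j * ‖z j‖) (hv : ∀ j, ‖v j‖ ≤ b j * s) :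
    Summable fun j => z j • complexify (v j) :=
  (hz.mul_right s).of_norm_bounded (norm_smul_complexify_le hv)

theorem norm_affineSeries_le (hz : Summable fun j => b j * ‖z j‖) (hv : ∀ j, ‖v j‖ ≤ b j * s) :
    ‖affineSeries v₀ v z‖ ≤ ‖v₀‖ + (∑' j, b j * ‖z j‖) * s := by
  refine (norm_add_le _ _).trans ?_
  rw [norm_complexify, ← tsum_mul_right]
  gcongr
  exact tsum_of_norm_bounded (hz.mul_right s).hasSum (norm_smul_complexify_le hv)

theorem summable_mul_norm_sub (hb : ∀ j, 0 ≤ b j) (hz : Summable fun j => b j * ‖z j‖)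
    (hz' : Summable fun j => b j * ‖z' j‖) : Summable fun j => b j * ‖z j - z' j‖ :=
  (hz.add hz').of_nonneg_of_le (fun j => mul_nonneg (hb j) (norm_nonneg _)) fun j => by
    nlinarith [hb j, norm_sub_le (z j) (z' j)]

theorem affineSeries_sub_affineSeries (hz : Summable fun j => b j * ‖z j‖)
    (hz' : Summable fun j => b j * ‖z' j‖) (hv : ∀ j, ‖v j‖ ≤ b j * s) :
    affineSeries v₀ v z - affineSeries v₀ v z' = ∑' j, (z j - z' j) • complexify (v j) := by
  unfold affineSeries
  rw [add_sub_add_left_eq_sub,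
    ← (summable_affineSeries hz hv).tsum_sub (summable_affineSeries hz' hv)]
  simp_rw [sub_smul]

theorem norm_affineSeries_sub_le (hb : ∀ j, 0 ≤ b j) (hz : Summable fun j => b j * ‖z j‖)
    (hz' : Summable fun j => b j * ‖z' j‖) (hv : ∀ j, ‖v j‖ ≤ b j * s) :
    ‖affineSeries v₀ v z - affineSeries v₀ v z'‖ ≤ (∑' j, b j * ‖z j - z' j‖) * s := by
  rw [affineSeries_sub_affineSeries hz hz' hv, ← tsum_mul_right]
  exact tsum_of_norm_bounded ((summable_mul_norm_sub hb hz hz').mul_right s).hasSum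
    (norm_smul_complexify_le (z := fun j => z j - z' j) hv)

theorem affineSeries_sub (hz : Summable fun j => b j * ‖z j‖) {s' : ℝ} {w₀ : R3} {w : ℕ → R3}
    (hv : ∀ j, ‖v j‖ ≤ b j * s) (hw : ∀ j, ‖w j‖ ≤ b j * s') :
    affineSeries v₀ v z - affineSeries w₀ w z
      = affineSeries (v₀ - w₀) (fun j => v j - w j) z := by
  unfold affineSeries
  simp_rw [complexify_sub, smul_sub]
  rw [(summable_affineSeries hz hv).tsum_sub (summable_affineSeries hz hw)]
  abel

theorem affineSeries_update (hz : Summable fun j => b j * ‖z j‖) (hv : ∀ j, ‖v j‖ ≤ b j * s)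
    (j : ℕ) (w : ℂ) : affineSeries v₀ v (Function.update z j w)
      = affineSeries v₀ v z + (w - z j) • complexify (v j) := by
  have h := (summable_affineSeries hz hv).hasSum.update j (w • complexify (v j))
  have e : Function.update (fun i => z i • complexify (v i)) j (w • complexify (v j))
      = fun i => Function.update z j w i • complexify (v i) := by
    funext i
    by_cases hi : i = j
    · subst hi; simp
    · simp [hi]
  rw [e] at h
  unfold affineSeries
  rw [h.tsum_eq, sub_smul]
  abel

theorem affineSeries_toComplex (y : ParamSpace) :
    affineSeries v₀ v y.toComplex = complexify (v₀ + ∑' j, (y j : ℝ) • v j) := by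
  by_cases hs : Summable fun j => (y j : ℝ) • v j
  · rw [← complexifyL_apply, map_add, complexifyL.map_tsum hs]
    unfold affineSeries
    congr 1
    refine tsum_congr fun j => ?_
    ext i
    simp [ParamSpace.toComplex]
  · have hs' : ¬ Summable fun j => y.toComplex j • complexify (v j) := by
      intro h
      refine hs ?_
      let reL : C3 →L[ℝ] R3 := LinearMap.toContinuousLinearMap
        { toFun := fun ζ => WithLp.toLp 2 fun i => (ζ i).re
          map_add' := fun x x' => by ext i; simp
          map_smul' := fun t x => by ext i; simp }
      have h2 := h.mapL reL
      refine h2.congr fun j => ?_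
      ext i
      simp [reL, ParamSpace.toComplex]
    unfold affineSeries
    rw [tsum_eq_zero_of_not_summable hs, tsum_eq_zero_of_not_summable hs']
    simp

theorem continuous_affineSeries_toComplex (hbs : Summable b) (hv : ∀ j, ‖v j‖ ≤ b j * s) :
    Continuous fun y : ParamSpace => affineSeries v₀ v y.toComplex := by
  refine continuous_const.add (continuous_tsum (u := fun j => b j * s) (fun j => ?_)
    (hbs.mul_right s) fun j y => ?_)
  · unfold ParamSpace.toComplex; fun_prop
  · have h1 := norm_le_one_of_mem_realInterval (y.toComplex_mem j)
    rw [norm_smul, norm_complexify]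
    nlinarith [hv j, norm_nonneg (v j)]

theorem rComplex_eq (φ₀ : R3 → R3) (φ : ℕ → R3 → R3) (z : ℕ → ℂ) (x : R3) :
    rComplex φ₀ φ z x = affineSeries (φ₀ x) (fun j => φ j x) z := rfl

theorem rComplex_toComplex (φ₀ : R3 → R3) (φ : ℕ → R3 → R3) (y : ParamSpace) (x : R3) :
    rComplex φ₀ φ y.toComplex x = complexify (rReal φ₀ φ y x) := affineSeries_toComplex y

theorem measurable_affineSeries {Ω : Type*} [MeasurableSpace Ω] {f₀ : Ω → R3} {f : ℕ → Ω → R3}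
    (hf₀ : Measurable f₀) (hf : ∀ j, Measurable (f j)) (hz : Summable fun j => b j * ‖z j‖)
    {S : Ω → ℝ} (hfs : ∀ j ω, ‖f j ω‖ ≤ b j * S ω) :
    Measurable fun ω => affineSeries (f₀ ω) (fun j => f j ω) z := by
  have hm : ∀ j, Measurable fun ω => z j • complexify (f j ω) := fun j =>
    (continuous_complexify.measurable.comp (hf j)).const_smul (z j)
  refine (continuous_complexify.measurable.comp hf₀).add ?_
  refine measurable_of_tendsto_metrizable
    (f := fun (N : ℕ) ω => ∑ j ∈ Finset.range N, z j • complexify (f j ω))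
    (fun N => Finset.measurable_sum _ fun j _ => hm j) ?_
  rw [tendsto_pi_nhds]
  intro ω
  exact (summable_affineSeries hz fun j => hfs j ω).hasSum.tendsto_sum_nat

end AffineSeries

/-! ### Bilinear geometry of `ℂ³` -/

/-- The bilinear product `∑ ζ_i ω_i`. -/
def dotC (ζ ω : C3) : ℂ := ∑ i, ζ i * ω i

theorem norm_dotC_le (ζ ω : C3) : ‖dotC ζ ω‖ ≤ ‖ζ‖ * ‖ω‖ := by
  have h : dotC ζ ω = inner ℂ (WithLp.toLp 2 fun i => star (ζ i) : C3) ω := by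
    simp [dotC, PiLp.inner_apply, mul_comm]
  rw [h]
  refine (norm_inner_le_norm _ _).trans (le_of_eq ?_)
  congr 1
  simp [EuclideanSpace.norm_eq]

theorem dotC_complexify (x x' : R3) : dotC (complexify x) (complexify x') = (inner ℝ x x' : ℝ) := by
  simp [dotC, PiLp.inner_apply, mul_comm]

/-- A complex vector close to a nonzero real vector lies in `kernelDomain`. -/
theorem mem_kernelDomain_of_close {x : R3} {ζ : C3} (hx : x ≠ 0)
    (h : ‖ζ - complexify x‖ ≤ ‖x‖ / 4) : ζ ∈ kernelDomain ∧ ‖x‖ / 2 ≤ ‖ζ‖ := by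
  have hx0 : 0 < ‖x‖ := norm_pos_iff.2 hx
  set δ := ζ - complexify x with hδ
  have hζ : ζ = complexify x + δ := by rw [hδ]; abel
  have hexp : (∑ i, ζ i * ζ i) = dotC (complexify x) (complexify x) + (2 * dotC (complexify x) δ
      + dotC δ δ) := by
    rw [hζ]; simp [dotC, Fin.sum_univ_three]; ring
  constructor
  · show 0 < (∑ i, ζ i * ζ i).re
    rw [hexp, dotC_complexify, Complex.add_re, Complex.ofReal_re, real_inner_self_eq_norm_sq]
    have h1 : ‖2 * dotC (complexify x) δ + dotC δ δ‖ ≤ 2 * (‖x‖ * ‖δ‖) + ‖δ‖ * ‖δ‖ := by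
      refine (norm_add_le _ _).trans ?_
      rw [norm_mul]
      have := norm_dotC_le (complexify x) δ
      rw [norm_complexify] at this
      have := norm_dotC_le δ δ
      simp only [Complex.norm_ofNat]
      linarith
    have h2 := (abs_le.1 ((Complex.abs_re_le_norm _).trans h1)).1
    nlinarith [norm_nonneg δ]
  · have := norm_sub_norm_le (complexify x) ζ
    rw [norm_complexify, norm_sub_rev] at this
    linarith

/-- The Gram determinant of two vectors of `ℂ³`, with respect to the bilinear product. -/
def gramC (e f : C3) : ℂ := dotC e e * dotC f f - dotC e f ^ 2

theorem continuous_gramC : Continuous fun q : C3 × C3 => gramC q.1 q.2 := by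
  unfold gramC dotC; fun_prop

/-- The Gram determinant of two real vectors is bounded below if the map
`(s, t) ↦ s e + t f` is. -/
theorem le_gramC_re {e f : R3} {c : ℝ} (hc : 0 < c)
    (h : ∀ s t : ℝ, c ^ 2 * (s ^ 2 + t ^ 2) ≤ ‖s • e + t • f‖ ^ 2) :
    c ^ 4 ≤ (gramC (complexify e) (complexify f)).re := by
  have he : c ^ 2 ≤ ‖e‖ ^ 2 := by simpa using h 1 0
  have hexp : ∀ s t : ℝ, ‖s • e + t • f‖ ^ 2
      = s ^ 2 * ‖e‖ ^ 2 + 2 * (s * t) * inner ℝ e f + t ^ 2 * ‖f‖ ^ 2 := by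
    intro s t
    rw [norm_add_sq_real, norm_smul, norm_smul, mul_pow, mul_pow, real_inner_smul_left,
      real_inner_smul_right, Real.norm_eq_abs, Real.norm_eq_abs, sq_abs, sq_abs]
    ring
  have hre : (gramC (complexify e) (complexify f)).re
      = ‖e‖ ^ 2 * ‖f‖ ^ 2 - (inner ℝ e f) ^ 2 := by
    simp only [gramC, dotC_complexify, real_inner_self_eq_norm_sq]
    norm_cast
  rw [hre]
  have h2 := h (-(inner ℝ e f)) (‖e‖ ^ 2)
  rw [hexp] at h2
  have hE : 0 < ‖e‖ ^ 2 := lt_of_lt_of_le (by positivity) he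
  have h3 : c ^ 2 * ‖e‖ ^ 2 ≤ ‖e‖ ^ 2 * ‖f‖ ^ 2 - (inner ℝ e f) ^ 2 := by
    refine le_of_mul_le_mul_left ?_ hE
    nlinarith [sq_nonneg (inner ℝ e f), sq_nonneg c, mul_nonneg (sq_nonneg c) (sq_nonneg (inner ℝ e f))]
  nlinarith [sq_nonneg c]

/-! ### Uniform bi-Lipschitz bounds -/

theorem lipNorm_nonneg (Γ : Set R3) (φ : R3 → R3) : 0 ≤ lipNorm Γ φ :=
  add_nonneg (Real.iSup_nonneg fun _ => norm_nonneg _)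
    (Real.iSup_nonneg fun _ => div_nonneg (norm_nonneg _) (norm_nonneg _))

section LipNorm

variable {Γ : Set R3} {φ : R3 → R3} {K : ℝ≥0} (hΓ : Bornology.IsBounded Γ)
  (hφ : LipschitzOnWith K φ Γ)

include hΓ hφ

theorem norm_le_lipNorm {x : R3} (hx : x ∈ Γ) : ‖φ x‖ ≤ lipNorm Γ φ := by
  have hbdd : BddAbove (range fun x : Γ => ‖φ x‖) := by
    obtain ⟨D, hD⟩ := Metric.isBounded_iff.1 hΓ
    refine ⟨‖φ x‖ + K * D, ?_⟩
    rintro _ ⟨x', rfl⟩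
    have h1 := hφ.dist_le_mul x'.1 x'.2 x hx
    have h2 := hD x'.2 hx
    rw [dist_eq_norm (φ x') (φ x)] at h1
    have h3 := norm_le_norm_add_norm_sub' (φ x') (φ x)
    have : (K : ℝ) * dist (x' : R3) x ≤ K * D := by gcongr
    show ‖φ x'‖ ≤ _
    linarith
  have h := le_ciSup hbdd ⟨x, hx⟩
  have h' : 0 ≤ ⨆ q : Γ × Γ, ‖φ q.1 - φ q.2‖ / ‖(q.1 : R3) - q.2‖ :=
    Real.iSup_nonneg fun _ => div_nonneg (norm_nonneg _) (norm_nonneg _)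
  unfold lipNorm
  linarith

omit hΓ in
theorem norm_sub_le_lipNorm {x x' : R3} (hx : x ∈ Γ) (hx' : x' ∈ Γ) :
    ‖φ x - φ x'‖ ≤ lipNorm Γ φ * ‖x - x'‖ := by
  rcases eq_or_ne x x' with rfl | hne
  · simp
  have hpos : 0 < ‖x - x'‖ := norm_pos_iff.2 (sub_ne_zero.2 hne)
  have hbdd : BddAbove (range fun q : Γ × Γ => ‖φ q.1 - φ q.2‖ / ‖(q.1 : R3) - q.2‖) := by
    refine ⟨K, ?_⟩
    rintro _ ⟨q, rfl⟩
    refine div_le_of_le_mul₀ (norm_nonneg _) K.2 ?_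
    have := hφ.dist_le_mul q.1.1 q.1.2 q.2.1 q.2.2
    rwa [dist_eq_norm, dist_eq_norm] at this
  have h := le_ciSup hbdd (⟨x, hx⟩, ⟨x', hx'⟩)
  have h' : 0 ≤ ⨆ x : Γ, ‖φ x‖ := Real.iSup_nonneg fun _ => norm_nonneg _
  have h2 : ‖φ x - φ x'‖ / ‖x - x'‖ ≤ lipNorm Γ φ := by
    unfold lipNorm
    refine h.trans ?_
    linarith
  exact (div_le_iff₀ hpos).1 h2

end LipNorm

/-- The quantitative content of `IsAdmissibleFamily`: `b` bounds the Lipschitz norms of the `φ_j`,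
and the lower Lipschitz constants of all `r_y` are at least `c`. -/
structure IsControlledFamily (Γ : Set R3) (φ₀ : R3 → R3) (φ : ℕ → R3 → R3) (b : ℕ → ℝ)
    (c : ℝ) : Prop where
  nonneg : ∀ j, 0 ≤ b j
  summable : Summable b
  norm_le : ∀ j, ∀ x ∈ Γ, ‖φ j x‖ ≤ b j
  norm_sub_le : ∀ j, ∀ x ∈ Γ, ∀ x' ∈ Γ, ‖φ j x - φ j x'‖ ≤ b j * ‖x - x'‖
  lipschitz_zero : ∃ K : ℝ≥0, LipschitzOnWith K φ₀ Γ
  pos : 0 < c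
  le_norm_sub : ∀ y, ∀ x ∈ Γ, ∀ x' ∈ Γ, c * ‖x - x'‖ ≤ ‖rReal φ₀ φ y x - rReal φ₀ φ y x'‖

theorem summable_of_summable_rpow {b : ℕ → ℝ} (hb : ∀ j, 0 ≤ b j) {p : ℝ} (hp₀ : 0 < p)
    (hp₁ : p < 1) (h : Summable fun j => b j ^ p) : Summable b := by
  have hev : ∀ᶠ j in cofinite, b j ≤ b j ^ p := by
    filter_upwards [h.tendsto_cofinite_zero.eventually (gt_mem_nhds one_pos)] with j hj
    have h1 : b j ≤ 1 := by
      by_contra! hcon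
      exact absurd hj (not_lt.2 (Real.one_le_rpow hcon.le hp₀.le))
    rcases (hb j).eq_or_lt with h0 | h0
    · rw [← h0]; exact Real.rpow_nonneg le_rfl _
    · simpa using Real.rpow_le_rpow_of_exponent_ge h0 h1 hp₁.le
  refine summable_of_isBigO h (Asymptotics.IsBigO.of_bound 1 ?_)
  filter_upwards [hev] with j hj
  rwa [one_mul, Real.norm_of_nonneg (hb j), Real.norm_of_nonneg (Real.rpow_nonneg (hb j) _)]

section Controlled

variable {Γ : Set R3} {φ₀ : R3 → R3} {φ : ℕ → R3 → R3} {b : ℕ → ℝ} {c η : ℝ}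

theorem summable_toComplex (hb : ∀ j, 0 ≤ b j) (hbs : Summable b) (y : ParamSpace) :
    Summable fun j => b j * ‖y.toComplex j‖ :=
  hbs.of_nonneg_of_le (fun j => mul_nonneg (hb j) (norm_nonneg _)) fun j => by
    nlinarith [hb j, norm_le_one_of_mem_realInterval (y.toComplex_mem j)]

theorem rComplex_sub_eq {z : ℕ → ℂ} (hbs : Summable fun j => b j * ‖z j‖)
    (hn : ∀ j, ∀ x ∈ Γ, ‖φ j x‖ ≤ b j) {x x' : R3} (hx : x ∈ Γ) (hx' : x' ∈ Γ) :
    rComplex φ₀ φ z x - rComplex φ₀ φ z x'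
      = affineSeries (φ₀ x - φ₀ x') (fun j => φ j x - φ j x') z :=
  affineSeries_sub (s := 1) (s' := 1) hbs (fun j => by simpa using hn j x hx)
    fun j => by simpa using hn j x' hx'

/-- The lower Lipschitz constants of the maps `r_y` are bounded away from zero, because the
parameter space is compact. -/
theorem IsAdmissibleFamily.exists_isControlledFamily {p : ℝ} (hΓ : Bornology.IsBounded Γ)
    (hp₀ : 0 < p) (hp₁ : p < 1) (hφ : IsAdmissibleFamily Γ φ₀ φ p) :
    ∃ c, IsControlledFamily Γ φ₀ φ (fun j => lipNorm Γ (φ j)) c := by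
  set b : ℕ → ℝ := fun j => lipNorm Γ (φ j) with hbdef
  have hb : ∀ j, 0 ≤ b j := fun j => lipNorm_nonneg _ _
  have hbs : Summable b := summable_of_summable_rpow hb hp₀ hp₁ hφ.summable
  have hn : ∀ j, ∀ x ∈ Γ, ‖φ j x‖ ≤ b j := fun j x hx => by
    obtain ⟨K, hK⟩ := hφ.lipschitz j
    exact norm_le_lipNorm hΓ hK hx
  have hl : ∀ j, ∀ x ∈ Γ, ∀ x' ∈ Γ, ‖φ j x - φ j x'‖ ≤ b j * ‖x - x'‖ := fun j x hx x' hx' => by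
    obtain ⟨K, hK⟩ := hφ.lipschitz j
    exact norm_sub_le_lipNorm hK hx hx'
  have key : ∃ c > 0, ∀ y ∈ (univ : Set ParamSpace), ∀ x ∈ Γ, ∀ x' ∈ Γ,
      c * ‖x - x'‖ ≤ ‖rReal φ₀ φ y x - rReal φ₀ φ y x'‖ := by
    refine isCompact_univ.induction_on (p := fun s => ∃ c > 0, ∀ y ∈ s, ∀ x ∈ Γ, ∀ x' ∈ Γ,
      c * ‖x - x'‖ ≤ ‖rReal φ₀ φ y x - rReal φ₀ φ y x'‖) ⟨1, one_pos, by simp⟩ ?_ ?_ ?_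
    · rintro s t hst ⟨c, hc, h⟩
      exact ⟨c, hc, fun y hy => h y (hst hy)⟩
    · rintro s t ⟨c, hc, h⟩ ⟨c', hc', h'⟩
      refine ⟨min c c', lt_min hc hc', fun y hy x hx x' hx' => ?_⟩
      rcases hy with hy | hy
      · exact le_trans (by gcongr; exact min_le_left _ _) (h y hy x hx x' hx')
      · exact le_trans (by gcongr; exact min_le_right _ _) (h' y hy x hx x' hx')
    · intro y _
      obtain ⟨K, hK⟩ := (hφ.biLipschitz y).2
      set c : ℝ := 1 / (K + 1) with hc
      have hK0 : (0 : ℝ) ≤ K := K.2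
      have hc0 : 0 < c := by positivity
      have hy : ∀ x ∈ Γ, ∀ x' ∈ Γ, c * ‖x - x'‖ ≤ ‖rReal φ₀ φ y x - rReal φ₀ φ y x'‖ := by
        intro x hx x' hx'
        have h := hK.le_mul_dist ⟨x, hx⟩ ⟨x', hx'⟩
        simp only [domRestrict_apply, Subtype.dist_eq, dist_eq_norm] at h
        rw [hc, one_div, inv_mul_le_iff₀ (by positivity)]
        nlinarith [norm_nonneg (rReal φ₀ φ y x - rReal φ₀ φ y x')]
      refine ⟨{y' | ∑' j, b j * |(y j : ℝ) - y' j| < c / 2}, ?_, c / 2, by positivity, ?_⟩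
      · refine mem_nhdsWithin_of_mem_nhds
          ((isOpen_lt (continuous_weightedDist hb hbs y) continuous_const).mem_nhds ?_)
        simpa using hc0
      · intro y' hy' x hx x' hx'
        have hv : ∀ j, ‖φ j x - φ j x'‖ ≤ b j * ‖x - x'‖ := fun j => hl j x hx x' hx'
        have hdiff := norm_affineSeries_sub_le (v₀ := φ₀ x - φ₀ x') hb
          (summable_toComplex hb hbs y) (summable_toComplex hb hbs y') hv
        rw [← rComplex_sub_eq (summable_toComplex hb hbs y) hn hx hx',
          ← rComplex_sub_eq (summable_toComplex hb hbs y') hn hx hx'] at hdiff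
        simp only [rComplex_toComplex, ← complexify_sub, norm_complexify] at hdiff
        have hsum : ∑' j, b j * ‖y.toComplex j - y'.toComplex j‖
            = ∑' j, b j * |(y j : ℝ) - y' j| := by
          refine tsum_congr fun j => ?_
          rw [ParamSpace.toComplex, ParamSpace.toComplex, ← Complex.ofReal_sub, Complex.norm_real,
            Real.norm_eq_abs]
        rw [hsum] at hdiff
        have h1 := hy x hx x' hx'
        have h2 := norm_le_norm_add_norm_sub' (rReal φ₀ φ y x - rReal φ₀ φ y x')
          (rReal φ₀ φ y' x - rReal φ₀ φ y' x')
        have h3 : (∑' j, b j * |(y j : ℝ) - y' j|) * ‖x - x'‖ ≤ c / 2 * ‖x - x'‖ := by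
          gcongr; exact le_of_lt hy'
        linarith
  obtain ⟨c, hc, h⟩ := key
  exact ⟨c, hb, hbs, hn, hl, hφ.lipschitz_zero, hc, fun y => h y (mem_univ y)⟩

variable (h : IsControlledFamily Γ φ₀ φ b c) {x x' : R3} {z z' : ℕ → ℂ}
include h

theorem IsControlledFamily.summable_norm (hz : z ∈ fullDomain b η) :
    Summable fun j => b j * ‖z j‖ := summable_mul_norm h.nonneg h.summable hz

theorem IsControlledFamily.rComplex_sub (hz : z ∈ fullDomain b η) (hx : x ∈ Γ) (hx' : x' ∈ Γ) :
    rComplex φ₀ φ z x - rComplex φ₀ φ z x'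
      = affineSeries (φ₀ x - φ₀ x') (fun j => φ j x - φ j x') z :=
  rComplex_sub_eq (h.summable_norm hz) h.norm_le hx hx'

theorem IsControlledFamily.exists_norm_rComplex_sub_le (η : ℝ) : ∃ M > 0, ∀ z ∈ fullDomain b η,
    ∀ x ∈ Γ, ∀ x' ∈ Γ, ‖rComplex φ₀ φ z x - rComplex φ₀ φ z x'‖ ≤ M * ‖x - x'‖ := by
  obtain ⟨K, hK⟩ := h.lipschitz_zero
  refine ⟨K + |∑' j, b j + η| + 1, by positivity, fun z hz x hx x' hx' => ?_⟩
  rw [h.rComplex_sub hz hx hx']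
  refine (norm_affineSeries_le (h.summable_norm hz) fun j => h.norm_sub_le j x hx x' hx').trans ?_
  have h1 := hK.dist_le_mul x hx x' hx'
  rw [dist_eq_norm, dist_eq_norm] at h1
  have h2 : ∑' j, b j * ‖z j‖ ≤ |∑' j, b j + η| :=
    (tsum_mul_norm_le h.nonneg h.summable hz).trans (le_abs_self _)
  nlinarith [norm_nonneg (x - x')]

/-- Replacing every coordinate by the nearest real one changes the chords of the surface by a factor
close to one. -/
theorem IsControlledFamily.norm_affineSeries_nearest_le (hz : z ∈ fullDomain b η) {s : ℝ}
    (hs : 0 ≤ s) {v₀ : R3} {v : ℕ → R3} (hv : ∀ j, ‖v j‖ ≤ b j * s) :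
    ‖affineSeries v₀ v z - affineSeries v₀ v (ParamSpace.toComplex fun j => nearest (z j))‖
      ≤ η * s := by
  refine (norm_affineSeries_sub_le h.nonneg (h.summable_norm hz)
    (summable_toComplex h.nonneg h.summable _) hv).trans ?_
  refine mul_le_mul_of_nonneg_right ?_ hs
  have : ∀ j, b j * ‖z j - ParamSpace.toComplex (fun j => nearest (z j)) j‖ = b j * gap (z j) :=
    fun j => by rw [ParamSpace.toComplex, norm_sub_nearest]
  simp_rw [this]
  exact hz.2.2.le

theorem IsControlledFamily.mem_kernelDomain (hη : 4 * η ≤ c) (hz : z ∈ fullDomain b η)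
    (hx : x ∈ Γ) (hx' : x' ∈ Γ) (hne : x ≠ x') :
    rComplex φ₀ φ z x - rComplex φ₀ φ z x' ∈ kernelDomain ∧
      c / 2 * ‖x - x'‖ ≤ ‖rComplex φ₀ φ z x - rComplex φ₀ φ z x'‖ := by
  set y : ParamSpace := fun j => nearest (z j)
  have hpos : 0 < ‖x - x'‖ := norm_pos_iff.2 (sub_ne_zero.2 hne)
  have h1 := h.le_norm_sub y x hx x' hx'
  have h2 := h.norm_affineSeries_nearest_le (v₀ := φ₀ x - φ₀ x') hz (norm_nonneg (x - x'))
    fun j => h.norm_sub_le j x hx x' hx'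
  rw [← h.rComplex_sub hz hx hx', ← rComplex_sub_eq (summable_toComplex h.nonneg h.summable _)
    h.norm_le hx hx', rComplex_toComplex, rComplex_toComplex, ← complexify_sub] at h2
  have h3 : rReal φ₀ φ y x - rReal φ₀ φ y x' ≠ 0 := by
    have := mul_pos h.pos hpos
    exact norm_pos_iff.1 (by linarith)
  obtain ⟨h4, h5⟩ := mem_kernelDomain_of_close h3 (h2.trans (by nlinarith))
  exact ⟨h4, by linarith⟩

theorem IsControlledFamily.rComplex_update_sub (hz : z ∈ fullDomain b η) (hx : x ∈ Γ)
    (hx' : x' ∈ Γ) (j : ℕ) (w : ℂ) : rComplex φ₀ φ (Function.update z j w) x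
        - rComplex φ₀ φ (Function.update z j w) x'
      = (rComplex φ₀ φ z x - rComplex φ₀ φ z x') + (w - z j) • complexify (φ j x - φ j x') := by
  rw [rComplex_eq, rComplex_eq, rComplex_eq, rComplex_eq,
    affineSeries_update (s := 1) (h.summable_norm hz) (fun j => by simpa using h.norm_le j x hx),
    affineSeries_update (s := 1) (h.summable_norm hz) (fun j => by simpa using h.norm_le j x' hx'),
    complexify_sub, smul_sub]
  abel

theorem IsControlledFamily.rReal_restrictReal (hx : x ∈ Γ) (y : ParamSpace) :
    rReal φ₀ φ (restrictReal b y) x = rReal φ₀ φ y x := by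
  unfold rReal
  congr 1
  refine tsum_congr fun j => ?_
  unfold restrictReal
  split_ifs with hj
  · have : φ j x = 0 := norm_le_zero_iff.1 ((h.norm_le j x hx).trans hj.le)
    simp [this]
  · rfl

theorem IsControlledFamily.continuousOn (j : ℕ) : ContinuousOn (φ j) Γ := by
  refine LipschitzOnWith.continuousOn (K := (b j).toNNReal) (LipschitzOnWith.of_dist_le_mul ?_)
  intro x hx x' hx'
  rw [dist_eq_norm, dist_eq_norm, Real.coe_toNNReal _ (h.nonneg j)]
  exact h.norm_sub_le j x hx x' hx'

theorem IsControlledFamily.exists_lipschitzOnWith_rReal :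
    ∃ K : ℝ≥0, ∀ y, LipschitzOnWith K (rReal φ₀ φ y) Γ := by
  obtain ⟨M, hM, hM'⟩ := h.exists_norm_rComplex_sub_le 1
  refine ⟨M.toNNReal, fun y => LipschitzOnWith.of_dist_le_mul fun x hx x' hx' => ?_⟩
  rw [dist_eq_norm, dist_eq_norm, Real.coe_toNNReal _ hM.le, ← h.rReal_restrictReal hx,
    ← h.rReal_restrictReal hx', ← norm_complexify, complexify_sub, ← rComplex_toComplex,
    ← rComplex_toComplex]
  refine hM' _ ⟨fun j hj => ?_, ?_, ?_⟩ x hx x' hx'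
  · simp [ParamSpace.toComplex, restrictReal, hj]
  · simp_rw [gap_of_mem (ParamSpace.toComplex_mem _ _), mul_zero]; exact summable_zero
  · simp [gap_of_mem (ParamSpace.toComplex_mem _ _)]

end Controlled

/-! ### Charts and Jacobians -/

section Derivatives

variable {E F : Type*} [NormedAddCommGroup E] [NormedSpace ℝ E] [NormedAddCommGroup F]
  [NormedSpace ℝ F]

/-- A series of functions with summable Lipschitz constants is differentiable at every common point
of differentiability of its terms. -/
theorem hasFDerivAt_tsum_of_lipschitz [CompleteSpace F] {f : ℕ → E → F} {f' : ℕ → E →L[ℝ] F}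
    {u : E} {s : Set E} (hs : s ∈ 𝓝 u) {K : ℕ → ℝ} (hK : Summable K)
    (hlip : ∀ j, ∀ v ∈ s, ‖f j v - f j u‖ ≤ K j * ‖v - u‖) (hK0 : ∀ j, 0 ≤ K j)
    (hsum : ∀ v ∈ s, Summable fun j => f j v) (hf : ∀ j, HasFDerivAt (f j) (f' j) u) :
    HasFDerivAt (fun v => ∑' j, f j v) (∑' j, f' j) u := by
  have hf' : ∀ j, ‖f' j‖ ≤ K j := fun j =>
    (hf j).le_of_lip' (hK0 j) (mem_of_superset hs fun v hv => hlip j v hv)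
  have hf's : Summable f' := hK.of_norm_bounded hf'
  rw [hasFDerivAt_iff_isLittleO, Asymptotics.isLittleO_iff]
  intro ε hε
  obtain ⟨N, hN⟩ := ((tendsto_sum_nat_add K).eventually (gt_mem_nhds (show 0 < ε / 3 by
    positivity))).exists
  have hfin : HasFDerivAt (fun v => ∑ j ∈ Finset.range N, f j v) (∑ j ∈ Finset.range N, f' j) u :=
    HasFDerivAt.fun_sum fun j _ => hf j
  rw [hasFDerivAt_iff_isLittleO, Asymptotics.isLittleO_iff] at hfin
  filter_upwards [hfin (show 0 < ε / 3 by positivity), hs] with v hv hvs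
  have hKN : Summable fun j => K (j + N) := (summable_nat_add_iff N).2 hK
  have htail : ∀ v ∈ s, Summable fun j => f (j + N) v := fun v hv =>
    (summable_nat_add_iff (f := fun j => f j v) N).2 (hsum v hv)
  have htail' : Summable fun j => f' (j + N) := (summable_nat_add_iff N).2 hf's
  rw [← (hsum v hvs).sum_add_tsum_nat_add N, ← (hsum u (mem_of_mem_nhds hs)).sum_add_tsum_nat_add N,
    ← hf's.sum_add_tsum_nat_add N]
  have h1 : ‖(∑' j, f (j + N) v) - ∑' j, f (j + N) u‖ ≤ (∑' j, K (j + N)) * ‖v - u‖ := by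
    rw [← (htail v hvs).tsum_sub (htail u (mem_of_mem_nhds hs)), ← tsum_mul_right]
    exact tsum_of_norm_bounded (hKN.mul_right _).hasSum fun j => hlip _ v hvs
  have h2 : ‖(∑' j, f' (j + N)) (v - u)‖ ≤ (∑' j, K (j + N)) * ‖v - u‖ :=
    (ContinuousLinearMap.le_opNorm _ _).trans (mul_le_mul_of_nonneg_right
      (tsum_of_norm_bounded hKN.hasSum fun j => hf' _) (norm_nonneg _))
  have h3 : (∑' j, K (j + N)) * ‖v - u‖ ≤ ε / 3 * ‖v - u‖ := by gcongr
  rw [_root_.add_apply]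
  calc _ = ‖(∑ j ∈ Finset.range N, f j v - ∑ j ∈ Finset.range N, f j u
            - (∑ j ∈ Finset.range N, f' j) (v - u))
          + ((∑' j, f (j + N) v) - ∑' j, f (j + N) u) - (∑' j, f' (j + N)) (v - u)‖ := by
        congr 1; abel
    _ ≤ ε / 3 * ‖v - u‖ + ε / 3 * ‖v - u‖ + ε / 3 * ‖v - u‖ := by
        refine (norm_sub_le _ _).trans (add_le_add ((norm_add_le _ _).trans ?_) (h2.trans h3))
        exact add_le_add hv (h1.trans h3)
    _ = ε * ‖v - u‖ := by ring

theorem HasFDerivAt.le_norm_of_le_norm_sub {f : E → F} {f' : E →L[ℝ] F} {u : E}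
    (hf : HasFDerivAt f f' u) {κ : ℝ} (h : ∀ᶠ v in 𝓝 u, κ * ‖v - u‖ ≤ ‖f v - f u‖) (v : E) :
    κ * ‖v‖ ≤ ‖f' v‖ := by
  have hc : Tendsto (fun n : ℕ => ‖((n : ℝ) + 1)‖) atTop atTop :=
    tendsto_norm_atTop_atTop.comp (tendsto_atTop_add_const_right _ _ tendsto_natCast_atTop_atTop)
  have hlim := (hf.lim v hc).norm
  refine ge_of_tendsto hlim ?_
  have hto : Tendsto (fun n : ℕ => u + ((n : ℝ) + 1)⁻¹ • v) atTop (𝓝 u) := by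
    have h0 : Tendsto (fun n : ℕ => ((n : ℝ) + 1)⁻¹) atTop (𝓝 0) := by
      simpa [one_div] using tendsto_one_div_add_atTop_nhds_zero_nat (𝕜 := ℝ)
    simpa using (h0.smul_const v).const_add u
  filter_upwards [hto.eventually h] with n hn
  have hn0 : (0 : ℝ) < (n : ℝ) + 1 := by positivity
  rw [norm_smul, Real.norm_of_nonneg hn0.le]
  rw [add_sub_cancel_left, norm_smul, norm_inv, Real.norm_of_nonneg hn0.le] at hn
  calc κ * ‖v‖ = ((n : ℝ) + 1) * (κ * (((n : ℝ) + 1)⁻¹ * ‖v‖)) := by field_simp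
    _ ≤ _ := by gcongr

end Derivatives

/-- A planar chart `χ` of the surface `Γ`, with explicit bi-Lipschitz constants. -/
structure IsChart (Γ : Set R3) (D : Set R2) (χ : R2 → R3) (κ K : ℝ) : Prop where
  isOpen : IsOpen D
  mem : ∀ u ∈ D, χ u ∈ Γ
  pos : 0 < κ
  nonneg : 0 ≤ K
  le_norm_sub : ∀ u ∈ D, ∀ u' ∈ D, κ * ‖u - u'‖ ≤ ‖χ u - χ u'‖
  norm_sub_le : ∀ u ∈ D, ∀ u' ∈ D, ‖χ u - χ u'‖ ≤ K * ‖u - u'‖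

theorem PatchDecomposition.chart_mem {Γ : Set R3} {ι : Type*} (G : PatchDecomposition Γ ι) (τ : ι)
    {u : R2} (hu : u ∈ G.dom τ) : G.chart τ u ∈ Γ := by
  have h : G.chart τ u ∈ ⋃ τ, closure (G.chart τ '' G.dom τ) :=
    mem_iUnion.2 ⟨τ, subset_closure (mem_image_of_mem _ hu)⟩
  rwa [← G.cover] at h

theorem PatchDecomposition.isClosed {Γ : Set R3} {ι : Type*} [Finite ι]
    (G : PatchDecomposition Γ ι) : IsClosed Γ := by
  rw [G.cover]
  exact isClosed_iUnion_of_finite fun _ => isClosed_closure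

theorem PatchDecomposition.exists_isChart {Γ : Set R3} {ι : Type*} [Finite ι]
    (G : PatchDecomposition Γ ι) :
    ∃ κ K : ℝ, ∀ τ, IsChart Γ (G.dom τ) (G.chart τ) κ K := by
  cases nonempty_fintype ι
  choose K hK using fun τ => (G.biLipschitz τ).1
  choose K' hK' using fun τ => (G.biLipschitz τ).2
  refine ⟨1 / (∑ τ, (K' τ : ℝ) + 1), ∑ τ, (K τ : ℝ), fun τ => ⟨G.isOpen_dom τ,
    fun u hu => G.chart_mem τ hu, by positivity, by positivity, fun u hu u' hu' => ?_,
    fun u hu u' hu' => ?_⟩⟩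
  · have h := (hK' τ).le_mul_dist ⟨u, hu⟩ ⟨u', hu'⟩
    simp only [domRestrict_apply, Subtype.dist_eq, dist_eq_norm] at h
    have h2 : (K' τ : ℝ) ≤ ∑ τ, (K' τ : ℝ) :=
      Finset.single_le_sum (f := fun τ => (K' τ : ℝ)) (fun τ _ => (K' τ).2) (Finset.mem_univ τ)
    rw [one_div, inv_mul_le_iff₀ (by positivity)]
    nlinarith [norm_nonneg (G.chart τ u - G.chart τ u')]
  · have h := (hK τ).dist_le_mul u hu u' hu'
    rw [dist_eq_norm, dist_eq_norm] at h
    have h2 : (K τ : ℝ) ≤ ∑ τ, (K τ : ℝ) :=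
      Finset.single_le_sum (f := fun τ => (K τ : ℝ)) (fun τ _ => (K τ).2) (Finset.mem_univ τ)
    nlinarith [norm_nonneg (u - u')]

theorem gramDet_eq (χ : R2 → R3) (u : R2) :
    gramDet χ u = (gramC (complexify (fderiv ℝ χ u (EuclideanSpace.single 0 1)))
      (complexify (fderiv ℝ χ u (EuclideanSpace.single 1 1)))).re := by
  simp only [gramC, dotC_complexify, gramDet, Matrix.det_fin_two, Matrix.gram_apply]
  norm_cast
  rw [real_inner_comm (fderiv ℝ χ u (EuclideanSpace.single 0 1))
    (fderiv ℝ χ u (EuclideanSpace.single 1 1)), sq]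

theorem gramC_complexify_im (e f : R3) : (gramC (complexify e) (complexify f)).im = 0 := by
  simp only [gramC, dotC_complexify]
  norm_cast

theorem le_gramDet {χ : R2 → R3} {u : R2} {κ : ℝ} (hκ : 0 < κ) (hχ : DifferentiableAt ℝ χ u)
    (h : ∀ᶠ v in 𝓝 u, κ * ‖v - u‖ ≤ ‖χ v - χ u‖) : κ ^ 4 ≤ gramDet χ u := by
  rw [gramDet_eq]
  refine le_gramC_re hκ fun s t => ?_
  have h1 := HasFDerivAt.le_norm_of_le_norm_sub hχ.hasFDerivAt h
    (s • EuclideanSpace.single 0 1 + t • EuclideanSpace.single 1 1)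
  rw [map_add, map_smul, map_smul] at h1
  have h2 : ‖(s • EuclideanSpace.single 0 1 + t • EuclideanSpace.single 1 1 : R2)‖ ^ 2
      = s ^ 2 + t ^ 2 := by
    rw [EuclideanSpace.norm_sq_eq]
    simp
  rw [← h2, ← mul_pow]
  exact pow_le_pow_left₀ (by positivity) h1 2

/-- `gramC` is uniformly continuous on bounded sets. -/
theorem exists_norm_gramC_sub_le (M : ℝ) {γ : ℝ} (hγ : 0 < γ) : ∃ δ > 0, ∀ e f e' f' : C3,
    ‖e‖ ≤ M → ‖f‖ ≤ M → ‖e' - e‖ ≤ δ → ‖f' - f‖ ≤ δ → ‖gramC e' f' - gramC e f‖ ≤ γ := by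
  have hc : IsCompact (Metric.closedBall (0 : C3 × C3) (M + 1)) := isCompact_closedBall _ _
  have hu := hc.uniformContinuousOn_of_continuous continuous_gramC.continuousOn
  obtain ⟨δ, hδ, h⟩ := Metric.uniformContinuousOn_iff.1 hu γ hγ
  refine ⟨min (δ / 2) 1, by positivity, fun e f e' f' he hf he' hf' => ?_⟩
  have hle : ∀ {x x' : C3}, ‖x‖ ≤ M → ‖x' - x‖ ≤ min (δ / 2) 1 → ‖x'‖ ≤ M + 1 := fun hx hx' => by
    have := norm_le_norm_add_norm_sub' _ _ |>.trans (add_le_add hx (hx'.trans (min_le_right _ _)))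
    exact this
  have hd : ∀ {x x' : C3}, ‖x' - x‖ ≤ min (δ / 2) 1 → ‖x' - x‖ < δ := fun hx =>
    (hx.trans (min_le_left _ _)).trans_lt (by linarith)
  have h1 := h (e', f') (by simp [Prod.norm_def, hle he he', hle hf hf']) (e, f)
    (by simp only [mem_closedBall_zero_iff, Prod.norm_def, sup_le_iff]; constructor <;> linarith)
    (by simpa [dist_eq_norm, Prod.norm_def] using ⟨hd he', hd hf'⟩)
  rw [dist_eq_norm] at h1
  exact h1.le

section Jacobian

variable {Γ : Set R3} {φ₀ : R3 → R3} {φ : ℕ → R3 → R3} {b : ℕ → ℝ} {c η : ℝ}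
  {D : Set R2} {χ : R2 → R3} {κ K : ℝ}

/-- The points of a chart domain where all `φ_j ∘ χ` are differentiable. -/
def goodSet (φ₀ : R3 → R3) (φ : ℕ → R3 → R3) (D : Set R2) (χ : R2 → R3) : Set R2 :=
  D ∩ ({u | DifferentiableAt ℝ (φ₀ ∘ χ) u} ∩ ⋂ j, {u | DifferentiableAt ℝ (φ j ∘ χ) u})

theorem measurableSet_goodSet (hD : IsOpen D) : MeasurableSet (goodSet φ₀ φ D χ) :=
  hD.measurableSet.inter ((measurableSet_of_differentiableAt ℝ _).inter
    (MeasurableSet.iInter fun _ => measurableSet_of_differentiableAt ℝ _))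

theorem IsChart.lipschitzOnWith_comp (hχ : IsChart Γ D χ κ K) {f : R3 → R3} {L : ℝ≥0}
    (hf : LipschitzOnWith L f Γ) : LipschitzOnWith (L * K.toNNReal) (f ∘ χ) D := by
  refine hf.comp (LipschitzOnWith.of_dist_le_mul fun u hu u' hu' => ?_) hχ.mem
  rw [dist_eq_norm, dist_eq_norm, Real.coe_toNNReal _ hχ.nonneg]
  exact hχ.norm_sub_le u hu u' hu'

theorem ae_differentiableAt_of_lipschitzOnWith (hD : IsOpen D) {f : R2 → R3} {L : ℝ≥0}
    (hf : LipschitzOnWith L f D) : ∀ᵐ u ∂volume.restrict D, DifferentiableAt ℝ f u := by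
  rw [ae_restrict_iff' hD.measurableSet]
  filter_upwards [hf.ae_differentiableWithinAt_of_mem] with u hu huD
  exact (hu huD).differentiableAt (hD.mem_nhds huD)

theorem IsControlledFamily.lipschitzOnWith (h : IsControlledFamily Γ φ₀ φ b c) (j : ℕ) :
    LipschitzOnWith (b j).toNNReal (φ j) Γ := by
  refine LipschitzOnWith.of_dist_le_mul fun x hx x' hx' => ?_
  rw [dist_eq_norm, dist_eq_norm, Real.coe_toNNReal _ (h.nonneg j)]
  exact h.norm_sub_le j x hx x' hx'

/-- By Rademacher's theorem, almost every point of a chart domain is good. -/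
theorem ae_mem_goodSet (h : IsControlledFamily Γ φ₀ φ b c) (hχ : IsChart Γ D χ κ K) :
    ∀ᵐ u ∂volume.restrict D, u ∈ goodSet φ₀ φ D χ := by
  obtain ⟨L, hL⟩ := h.lipschitz_zero
  have h0 := ae_differentiableAt_of_lipschitzOnWith hχ.isOpen (hχ.lipschitzOnWith_comp hL)
  have h1 := ae_all_iff.2 fun j => ae_differentiableAt_of_lipschitzOnWith hχ.isOpen
    (hχ.lipschitzOnWith_comp (h.lipschitzOnWith j))
  filter_upwards [h0, h1, ae_restrict_mem hχ.isOpen.measurableSet] with u hu0 hu1 huD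
  exact ⟨huD, hu0, mem_iInter.2 hu1⟩

/-- The partial derivative of `r_z ∘ χ` in the `i`-th coordinate direction. -/
def partialDeriv (φ₀ : R3 → R3) (φ : ℕ → R3 → R3) (χ : R2 → R3) (i : Fin 2) (z : ℕ → ℂ)
    (u : R2) : C3 :=
  affineSeries (fderiv ℝ (φ₀ ∘ χ) u (EuclideanSpace.single i 1))
    (fun j => fderiv ℝ (φ j ∘ χ) u (EuclideanSpace.single i 1)) z

open Classical in
/-- The surface element of `r_z ∘ χ`, a holomorphic square root of the bilinear Gram determinant. It
is set to zero on the null set where some `φ_j ∘ χ` is not differentiable. -/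
def jacobian (φ₀ : R3 → R3) (φ : ℕ → R3 → R3) (D : Set R2) (χ : R2 → R3) (z : ℕ → ℂ) (u : R2) : ℂ :=
  if u ∈ goodSet φ₀ φ D χ then
    gramC (partialDeriv φ₀ φ χ 0 z u) (partialDeriv φ₀ φ χ 1 z u) ^ (1 / 2 : ℂ) else 0

theorem norm_fderiv_apply_single_le (h : IsControlledFamily Γ φ₀ φ b c) (hχ : IsChart Γ D χ κ K)
    {u : R2} (hu : u ∈ goodSet φ₀ φ D χ) (j : ℕ) (i : Fin 2) :
    ‖fderiv ℝ (φ j ∘ χ) u (EuclideanSpace.single i 1)‖ ≤ b j * K := by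
  have h1 := norm_fderiv_le_of_lipschitzOn ℝ (hχ.isOpen.mem_nhds hu.1)
    (hχ.lipschitzOnWith_comp (h.lipschitzOnWith j))
  rw [NNReal.coe_mul, Real.coe_toNNReal _ (h.nonneg j), Real.coe_toNNReal _ hχ.nonneg] at h1
  refine (ContinuousLinearMap.le_opNorm _ _).trans ?_
  simpa using h1

theorem hasFDerivAt_rReal_comp (h : IsControlledFamily Γ φ₀ φ b c) (hχ : IsChart Γ D χ κ K)
    {u : R2} (hu : u ∈ goodSet φ₀ φ D χ) (y : ParamSpace) :
    HasFDerivAt (rReal φ₀ φ y ∘ χ)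
      (fderiv ℝ (φ₀ ∘ χ) u + ∑' j, (y j : ℝ) • fderiv ℝ (φ j ∘ χ) u) u ∧
    Summable fun j => (y j : ℝ) • fderiv ℝ (φ j ∘ χ) u := by
  have hy : ∀ j, |(y j : ℝ)| ≤ 1 := fun j => abs_le.2 (y j).2
  have hdiff : ∀ j, DifferentiableAt ℝ (φ j ∘ χ) u := mem_iInter.1 hu.2.2
  have hK : Summable fun j => b j * K := h.summable.mul_right K
  have hK0 : ∀ j, 0 ≤ b j * K := fun j => mul_nonneg (h.nonneg j) hχ.nonneg
  have hlip : ∀ j, ∀ v ∈ D, ‖(y j : ℝ) • (φ j ∘ χ) v - (y j : ℝ) • (φ j ∘ χ) u‖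
      ≤ b j * K * ‖v - u‖ := by
    intro j v hv
    rw [← smul_sub, norm_smul, Real.norm_eq_abs]
    have h1 := h.norm_sub_le j _ (hχ.mem v hv) _ (hχ.mem u hu.1)
    have h2 := hχ.norm_sub_le v hv u hu.1
    have h3 : b j * ‖χ v - χ u‖ ≤ b j * (K * ‖v - u‖) :=
      mul_le_mul_of_nonneg_left h2 (h.nonneg j)
    calc _ ≤ 1 * ‖φ j (χ v) - φ j (χ u)‖ := by gcongr; exacts [hy j, le_rfl]
      _ ≤ _ := by linarith
  have hD := hχ.isOpen.mem_nhds hu.1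
  have hderiv : ∀ j, HasFDerivAt (fun v => (y j : ℝ) • (φ j ∘ χ) v)
      ((y j : ℝ) • fderiv ℝ (φ j ∘ χ) u) u := fun j => (hdiff j).hasFDerivAt.fun_const_smul _
  refine ⟨?_, hK.of_norm_bounded fun j => (hderiv j).le_of_lip' (hK0 j)
    (mem_of_superset hD fun v hv => hlip j v hv)⟩
  refine hu.2.1.hasFDerivAt.add (hasFDerivAt_tsum_of_lipschitz hD hK hlip hK0 (fun v hv => ?_)
    hderiv)
  refine h.summable.of_norm_bounded fun j => ?_
  rw [norm_smul, Real.norm_eq_abs]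
  calc _ ≤ 1 * ‖φ j (χ v)‖ := by gcongr; exact hy j
    _ ≤ b j := by rw [one_mul]; exact h.norm_le j _ (hχ.mem v hv)

theorem partialDeriv_toComplex (h : IsControlledFamily Γ φ₀ φ b c) (hχ : IsChart Γ D χ κ K)
    {u : R2} (hu : u ∈ goodSet φ₀ φ D χ) (i : Fin 2) (y : ParamSpace) :
    partialDeriv φ₀ φ χ i y.toComplex u
      = complexify (fderiv ℝ (rReal φ₀ φ y ∘ χ) u (EuclideanSpace.single i 1)) := by
  obtain ⟨h1, h2⟩ := hasFDerivAt_rReal_comp h hχ hu y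
  unfold partialDeriv
  rw [affineSeries_toComplex, h1.fderiv]
  congr 1
  rw [_root_.add_apply]
  congr 1
  exact ((ContinuousLinearMap.apply ℝ R3 (EuclideanSpace.single i (1 : ℝ) : R2)).map_tsum h2).symm

theorem le_gramDet_rReal_comp (h : IsControlledFamily Γ φ₀ φ b c) (hχ : IsChart Γ D χ κ K)
    {u : R2} (hu : u ∈ goodSet φ₀ φ D χ) (y : ParamSpace) :
    (c * κ) ^ 4 ≤ gramDet (rReal φ₀ φ y ∘ χ) u := by
  refine le_gramDet (mul_pos h.pos hχ.pos) (hasFDerivAt_rReal_comp h hχ hu y).1.differentiableAt ?_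
  filter_upwards [hχ.isOpen.mem_nhds hu.1] with v hv
  have h1 := h.le_norm_sub y _ (hχ.mem v hv) _ (hχ.mem u hu.1)
  have h2 := hχ.le_norm_sub v hv u hu.1
  have h3 := mul_le_mul_of_nonneg_left h2 h.pos.le
  calc c * κ * ‖v - u‖ = c * (κ * ‖v - u‖) := by ring
    _ ≤ _ := h3.trans h1

theorem jacobian_toComplex (h : IsControlledFamily Γ φ₀ φ b c) (hχ : IsChart Γ D χ κ K)
    {u : R2} (hu : u ∈ goodSet φ₀ φ D χ) (y : ParamSpace) :
    jacobian φ₀ φ D χ y.toComplex u = (√(gramDet (rReal φ₀ φ y ∘ χ) u) : ℝ) := by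
  have h0 : 0 ≤ gramDet (rReal φ₀ φ y ∘ χ) u :=
    le_trans (by positivity) (le_gramDet_rReal_comp h hχ hu y)
  rw [jacobian, if_pos hu, partialDeriv_toComplex h hχ hu, partialDeriv_toComplex h hχ hu]
  have : gramC (complexify (fderiv ℝ (rReal φ₀ φ y ∘ χ) u (EuclideanSpace.single 0 1)))
      (complexify (fderiv ℝ (rReal φ₀ φ y ∘ χ) u (EuclideanSpace.single 1 1)))
        = ((gramDet (rReal φ₀ φ y ∘ χ) u : ℝ) : ℂ) :=
    Complex.ext (by rw [gramDet_eq, Complex.ofReal_re])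
      (by rw [gramC_complexify_im, Complex.ofReal_im])
  rw [this, Real.sqrt_eq_rpow, Complex.ofReal_cpow h0]
  norm_num

theorem measurable_jacobian (h : IsControlledFamily Γ φ₀ φ b c) (hχ : IsChart Γ D χ κ K)
    {z : ℕ → ℂ} (hz : z ∈ fullDomain b η) : Measurable (jacobian φ₀ φ D χ z) := by
  have hgood := measurableSet_goodSet (φ₀ := φ₀) (φ := φ) (χ := χ) hχ.isOpen
  have hpart : ∀ i, Measurable fun u : goodSet φ₀ φ D χ => partialDeriv φ₀ φ χ i z u := fun i =>
    measurable_affineSeries (b := b) (S := fun _ => K)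
      ((measurable_fderiv_apply_const ℝ _ _).comp measurable_subtype_coe)
      (fun j => (measurable_fderiv_apply_const ℝ _ _).comp measurable_subtype_coe)
      (h.summable_norm hz) fun j u => norm_fderiv_apply_single_le h hχ u.2 j i
  refine measurable_of_restrict_of_restrict_compl hgood ?_ ?_
  · have h1 : (goodSet φ₀ φ D χ).domRestrict (jacobian φ₀ φ D χ z) = fun u : goodSet φ₀ φ D χ =>
        gramC (partialDeriv φ₀ φ χ 0 z u) (partialDeriv φ₀ φ χ 1 z u) ^ (1 / 2 : ℂ) := by
      funext u; simp [jacobian]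
    rw [h1]
    exact (continuous_gramC.measurable.comp ((hpart 0).prodMk (hpart 1))).pow_const _
  · have h1 : (goodSet φ₀ φ D χ)ᶜ.domRestrict (jacobian φ₀ φ D χ z) = fun u => 0 := by
      funext u
      have := u.2
      simp only [mem_compl_iff] at this
      simp [jacobian, this]
    rw [h1]; exact measurable_const

theorem exists_norm_partialDeriv_le (h : IsControlledFamily Γ φ₀ φ b c)
    (hχ : IsChart Γ D χ κ K) (η : ℝ) : ∃ M, ∀ z ∈ fullDomain b η, ∀ u ∈ goodSet φ₀ φ D χ, ∀ i,
      ‖partialDeriv φ₀ φ χ i z u‖ ≤ M := by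
  obtain ⟨L, hL⟩ := h.lipschitz_zero
  refine ⟨L * K + (∑' j, b j + η) * K, fun z hz u hu i => ?_⟩
  refine (norm_affineSeries_le (h.summable_norm hz)
    fun j => norm_fderiv_apply_single_le h hχ hu j i).trans (add_le_add ?_ ?_)
  · have h1 := norm_fderiv_le_of_lipschitzOn ℝ (hχ.isOpen.mem_nhds hu.1)
      (hχ.lipschitzOnWith_comp hL)
    rw [NNReal.coe_mul, Real.coe_toNNReal _ hχ.nonneg] at h1
    refine (ContinuousLinearMap.le_opNorm _ _).trans ?_
    simpa using h1
  · exact mul_le_mul_of_nonneg_right (tsum_mul_norm_le h.nonneg h.summable hz) hχ.nonneg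

/-- Close to the real parameters the bilinear Gram determinant stays in the right half-plane. -/
theorem exists_gramC_partialDeriv_re_pos (h : IsControlledFamily Γ φ₀ φ b c)
    (hχ : IsChart Γ D χ κ K) : ∃ η > 0, ∃ M, ∀ z ∈ fullDomain b η, ∀ u ∈ goodSet φ₀ φ D χ,
      0 < (gramC (partialDeriv φ₀ φ χ 0 z u) (partialDeriv φ₀ φ χ 1 z u)).re ∧
      ‖gramC (partialDeriv φ₀ φ χ 0 z u) (partialDeriv φ₀ φ χ 1 z u)‖ ≤ M := by
  have hck := mul_pos h.pos hχ.pos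
  obtain ⟨M, hM⟩ := exists_norm_partialDeriv_le h hχ 1
  obtain ⟨δ, hδ, hδ'⟩ := exists_norm_gramC_sub_le M (γ := (c * κ) ^ 4 / 2) (by positivity)
  have hK := hχ.nonneg
  refine ⟨min 1 (δ / (K + 1)), by positivity, M * M * (M * M) + (M * M) ^ 2, fun z hz u hu => ?_⟩
  have hz1 : z ∈ fullDomain b 1 := fullDomain_mono (min_le_left _ _) hz
  constructor
  · set y : ParamSpace := fun j => nearest (z j)
    have hclose : ∀ i, ‖partialDeriv φ₀ φ χ i y.toComplex u - partialDeriv φ₀ φ χ i z u‖ ≤ δ := by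
      intro i
      rw [norm_sub_rev]
      refine (h.norm_affineSeries_nearest_le hz hK
        fun j => norm_fderiv_apply_single_le h hχ hu j i).trans ?_
      calc min 1 (δ / (K + 1)) * K ≤ δ / (K + 1) * (K + 1) := by
            gcongr
            · exact min_le_right _ _
            · linarith
        _ = δ := by field_simp
    have h1 := hδ' _ _ _ _ (hM z hz1 u hu 0) (hM z hz1 u hu 1) (hclose 0) (hclose 1)
    have h2 := le_gramDet_rReal_comp h hχ hu y
    rw [gramDet_eq, ← partialDeriv_toComplex h hχ hu, ← partialDeriv_toComplex h hχ hu] at h2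
    have h3 := (Complex.abs_re_le_norm _).trans h1
    rw [Complex.sub_re, abs_le] at h3
    have : 0 < (c * κ) ^ 4 := by positivity
    linarith [h3.2]
  · have hM0 : 0 ≤ M := (norm_nonneg _).trans (hM z hz1 u hu 0)
    have hdot : ∀ i i', ‖dotC (partialDeriv φ₀ φ χ i z u) (partialDeriv φ₀ φ χ i' z u)‖ ≤ M * M :=
      fun i i' => (norm_dotC_le _ _).trans
        (mul_le_mul (hM z hz1 u hu i) (hM z hz1 u hu i') (norm_nonneg _) hM0)
    unfold gramC
    refine (norm_sub_le _ _).trans (add_le_add ?_ ?_)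
    · rw [norm_mul]
      exact mul_le_mul (hdot 0 0) (hdot 1 1) (norm_nonneg _) (by positivity)
    · rw [norm_pow]
      exact pow_le_pow_left₀ (norm_nonneg _) (hdot 0 1) 2

theorem norm_cpow_half (w : ℂ) : ‖w ^ (1 / 2 : ℂ)‖ = ‖w‖ ^ (1 / 2 : ℝ) := by
  have : (1 / 2 : ℂ) = ((1 / 2 : ℝ) : ℂ) := by norm_num
  rw [this]
  rcases eq_or_ne w 0 with rfl | hw
  · rw [Complex.zero_cpow (by norm_num), norm_zero, Real.zero_rpow (by norm_num)]
  · rw [Complex.norm_cpow_of_ne_zero hw]; simp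

/-- The surface element is bounded and holomorphic in the parameter. -/
theorem exists_isBoundedSepHolomorphic_jacobian (h : IsControlledFamily Γ φ₀ φ b c)
    (hχ : IsChart Γ D χ κ K) : ∃ η > 0, ∃ B, ∀ u,
      IsBoundedSepHolomorphic b η B (fun z => jacobian φ₀ φ D χ z u) := by
  obtain ⟨η, hη, M, hM⟩ := exists_gramC_partialDeriv_re_pos h hχ
  refine ⟨η, hη, |M| ^ (1 / 2 : ℝ), fun u => ?_⟩
  by_cases hu : u ∈ goodSet φ₀ φ D χ
  · simp only [jacobian, if_pos hu]
    refine ⟨fun z hz => ?_, fun z hz j _ => ?_⟩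
    · rw [norm_cpow_half]
      exact Real.rpow_le_rpow (norm_nonneg _) ((hM z hz.1 u hu).2.trans (le_abs_self _))
        (by norm_num)
    · have hupd : ∀ i w, partialDeriv φ₀ φ χ i (Function.update z j w) u
          = partialDeriv φ₀ φ χ i z u + (w - z j) •
            complexify (fderiv ℝ (φ j ∘ χ) u (EuclideanSpace.single i 1)) := fun i w =>
        affineSeries_update (h.summable_norm hz.1)
          (fun j => norm_fderiv_apply_single_le h hχ hu j i) j w
      simp only [hupd]
      refine DifferentiableAt.cpow_const ?_ ?_
      · simp only [gramC, dotC, Fin.sum_univ_three, PiLp.add_apply, PiLp.smul_apply, smul_eq_mul]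
        fun_prop
      · rw [sub_self, zero_smul, zero_smul, add_zero, add_zero]
        exact Or.inl (hM z hz.1 u hu).1
  · simp only [jacobian, if_neg hu]
    exact ⟨fun z _ => by simpa using Real.rpow_nonneg (abs_nonneg M) _,
      fun z _ j _ => differentiableAt_const _⟩

theorem continuous_jacobian_toComplex (h : IsControlledFamily Γ φ₀ φ b c)
    (hχ : IsChart Γ D χ κ K) (u : R2) :
    Continuous fun y : ParamSpace => jacobian φ₀ φ D χ y.toComplex u := by
  by_cases hu : u ∈ goodSet φ₀ φ D χ
  · simp only [jacobian, if_pos hu]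
    have hpart : ∀ i, Continuous fun y : ParamSpace => partialDeriv φ₀ φ χ i y.toComplex u :=
      fun i => continuous_affineSeries_toComplex h.summable
        fun j => norm_fderiv_apply_single_le h hχ hu j i
    refine (continuous_gramC.comp ((hpart 0).prodMk (hpart 1))).cpow continuous_const fun y => ?_
    have h2 := le_gramDet_rReal_comp h hχ hu y
    rw [gramDet_eq, ← partialDeriv_toComplex h hχ hu, ← partialDeriv_toComplex h hχ hu] at h2
    have := mul_pos h.pos hχ.pos
    exact Or.inl (lt_of_lt_of_le (by positivity) h2)
  · simp only [jacobian, if_neg hu]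
    exact continuous_const

end Jacobian

/-! ### Integral operators between `L²` spaces -/

section KernelOperators

variable {X Y : Type*} [MeasurableSpace X] [MeasurableSpace Y] {μ : Measure X} {m : Measure Y}

/-- The assumptions of the Schur test. -/
structure IsSchurWeight (μ : Measure X) (m : Measure Y) (W : X → Y → ℝ≥0) (A : ℝ≥0) : Prop where
  measurable : Measurable (Function.uncurry W)
  lintegral_right : ∀ᵐ x ∂μ, ∫⁻ y, W x y ∂m ≤ A
  lintegral_left : ∀ᵐ y ∂m, ∫⁻ x, W x y ∂μ ≤ A

/-- `T` is the integral operator with kernel `k`. -/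
def IsKernelOp (k : X → Y → ℂ) (T : Lp ℂ 2 m →L[ℂ] Lp ℂ 2 μ) : Prop :=
  ∀ f : Lp ℂ 2 m, T f =ᵐ[μ] fun x => ∫ y, k x y * f y ∂m

variable {W : X → Y → ℝ≥0} {A : ℝ≥0}

theorem sq_lintegral_mul_le {w f : Y → ℝ≥0∞} (hw : Measurable w) (hf : Measurable f) :
    (∫⁻ y, w y * f y ∂m) ^ 2 ≤ (∫⁻ y, w y ∂m) * ∫⁻ y, w y * f y ^ 2 ∂m := by
  have h := ENNReal.lintegral_mul_le_Lp_mul_Lq m Real.HolderConjugate.two_two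
    (hw.pow_const (1 / 2 : ℝ)).aemeasurable ((hw.pow_const (1 / 2 : ℝ)).mul hf).aemeasurable
  have hsq : ∀ t : ℝ≥0∞, (t ^ (1 / 2 : ℝ)) ^ 2 = t := fun t => by
    rw [← ENNReal.rpow_natCast, ← ENNReal.rpow_mul]; norm_num
  have e1 : ∀ y, (fun y => w y ^ (1 / 2 : ℝ)) y * ((fun y => w y ^ (1 / 2 : ℝ)) * f) y
      = w y * f y := fun y => by
    simp only [Pi.mul_apply]; rw [← mul_assoc, ← sq, hsq]
  simp only [Pi.mul_apply] at h e1
  simp only [ENNReal.rpow_two, mul_pow, hsq] at h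
  simp_rw [e1] at h
  calc (∫⁻ y, w y * f y ∂m) ^ 2 ≤ ((∫⁻ y, w y ∂m) ^ (1 / 2 : ℝ)
        * (∫⁻ y, w y * f y ^ 2 ∂m) ^ (1 / 2 : ℝ)) ^ 2 := by gcongr
    _ = _ := by rw [mul_pow, hsq, hsq]

variable [SFinite μ] [SFinite m]

theorem IsSchurWeight.lintegral_sq_le (hW : IsSchurWeight μ m W A) {f : Y → ℝ≥0∞}
    (hf : Measurable f) : ∫⁻ x, (∫⁻ y, W x y * f y ∂m) ^ 2 ∂μ ≤ A ^ 2 * ∫⁻ y, f y ^ 2 ∂m := by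
  have hWm : Measurable fun q : X × Y => (W q.1 q.2 : ℝ≥0∞) := hW.measurable.coe_nnreal_ennreal
  calc ∫⁻ x, (∫⁻ y, W x y * f y ∂m) ^ 2 ∂μ ≤ ∫⁻ x, A * ∫⁻ y, W x y * f y ^ 2 ∂m ∂μ := by
        refine lintegral_mono_ae ?_
        filter_upwards [hW.lintegral_right] with x hx
        have hWx : Measurable fun y => (W x y : ℝ≥0∞) := hWm.comp measurable_prodMk_left
        exact (sq_lintegral_mul_le hWx hf).trans (mul_le_mul_left hx _)
    _ = A * ∫⁻ x, ∫⁻ y, W x y * f y ^ 2 ∂m ∂μ := by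
        rw [lintegral_const_mul]
        exact (hWm.mul ((hf.comp measurable_snd).pow_const 2)).lintegral_prod_right
    _ = A * ∫⁻ y, ∫⁻ x, W x y * f y ^ 2 ∂μ ∂m := by
        rw [lintegral_lintegral_swap]
        exact (hWm.mul ((hf.comp measurable_snd).pow_const 2)).aemeasurable
    _ ≤ A * ∫⁻ y, A * f y ^ 2 ∂m := by
        gcongr A * ?_
        refine lintegral_mono_ae ?_
        filter_upwards [hW.lintegral_left] with y hy
        have hWy : Measurable fun x => (W x y : ℝ≥0∞) := hWm.comp measurable_prodMk_right
        rw [lintegral_mul_const _ hWy]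
        gcongr
    _ = _ := by rw [lintegral_const_mul _ (hf.pow_const 2), ← mul_assoc, ← sq]

theorem eLpNorm_two_sq {Z : Type*} [MeasurableSpace Z] (ρ : Measure Z) (f : Z → ℂ) :
    eLpNorm f 2 ρ ^ 2 = ∫⁻ x, ‖f x‖ₑ ^ 2 ∂ρ := by
  have h := eLpNorm_nnreal_pow_eq_lintegral (f := f) (μ := ρ) (p := (2 : ℝ≥0)) two_ne_zero
  simpa using h

variable {k k' : X → Y → ℂ} {C C' : ℝ}

omit [MeasurableSpace X] [SFinite m] in
theorem lintegral_kernel_mul_le (hC : 0 ≤ C)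
    (hkW : ∀ x y, ‖k x y‖ ≤ C * W x y) (f : Y → ℂ) (x : X) :
    ∫⁻ y, ‖k x y * f y‖ₑ ∂m ≤ ENNReal.ofReal C * ∫⁻ y, W x y * ‖f y‖ₑ ∂m := by
  rw [← lintegral_const_mul' _ _ ENNReal.ofReal_ne_top]
  refine lintegral_mono fun y => ?_
  rw [enorm_mul, ← mul_assoc]
  gcongr
  rw [← ofReal_norm, ← ENNReal.ofReal_coe_nnreal, ← ENNReal.ofReal_mul hC]
  exact ENNReal.ofReal_le_ofReal (hkW x y)

theorem IsSchurWeight.ae_integrable (hW : IsSchurWeight μ m W A)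
    (hk : Measurable (Function.uncurry k)) (hC : 0 ≤ C) (hkW : ∀ x y, ‖k x y‖ ≤ C * W x y)
    (f : Lp ℂ 2 m) : ∀ᵐ x ∂μ, Integrable (fun y => k x y * f y) m := by
  have hWm : Measurable fun q : X × Y => (W q.1 q.2 : ℝ≥0∞) := hW.measurable.coe_nnreal_ennreal
  have hf : Measurable fun y => ‖f y‖ₑ := (Lp.stronglyMeasurable f).enorm
  have hfin : ∫⁻ x, (∫⁻ y, W x y * ‖f y‖ₑ ∂m) ^ 2 ∂μ ≠ ∞ := by
    refine ((hW.lintegral_sq_le hf).trans_lt ?_).ne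
    rw [← eLpNorm_two_sq]
    exact ENNReal.mul_lt_top (by simp) (ENNReal.pow_lt_top (Lp.memLp f).2)
  have hmeas : Measurable fun x => (∫⁻ y, W x y * ‖f y‖ₑ ∂m) ^ 2 :=
    ((hWm.mul (hf.comp measurable_snd)).lintegral_prod_right).pow_const 2
  filter_upwards [ae_lt_top hmeas hfin] with x hx
  refine ⟨((hk.comp measurable_prodMk_left).mul
    (Lp.stronglyMeasurable f).measurable).aestronglyMeasurable, ?_⟩
  refine (lintegral_kernel_mul_le hC hkW f x).trans_lt
    (ENNReal.mul_lt_top ENNReal.ofReal_lt_top ?_)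
  by_contra hcon
  rw [not_lt_top_iff.1 hcon] at hx
  simp at hx

theorem IsSchurWeight.eLpNorm_le (hW : IsSchurWeight μ m W A) (hC : 0 ≤ C)
    (hkW : ∀ x y, ‖k x y‖ ≤ C * W x y) (f : Lp ℂ 2 m) :
    eLpNorm (fun x => ∫ y, k x y * f y ∂m) 2 μ ≤ ENNReal.ofReal (C * A) * eLpNorm f 2 m := by
  have hf : Measurable fun y => ‖f y‖ₑ := (Lp.stronglyMeasurable f).enorm
  rw [← ENNReal.pow_le_pow_left_iff two_ne_zero, mul_pow, eLpNorm_two_sq, eLpNorm_two_sq]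
  calc ∫⁻ x, ‖∫ y, k x y * f y ∂m‖ₑ ^ 2 ∂μ
      ≤ ∫⁻ x, ENNReal.ofReal C ^ 2 * (∫⁻ y, W x y * ‖f y‖ₑ ∂m) ^ 2 ∂μ := by
        refine lintegral_mono fun x => ?_
        rw [← mul_pow]
        gcongr
        exact (enorm_integral_le_lintegral_enorm _).trans (lintegral_kernel_mul_le hC hkW f x)
    _ = ENNReal.ofReal C ^ 2 * ∫⁻ x, (∫⁻ y, W x y * ‖f y‖ₑ ∂m) ^ 2 ∂μ :=
        lintegral_const_mul' _ _ (ENNReal.pow_ne_top ENNReal.ofReal_ne_top)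
    _ ≤ ENNReal.ofReal C ^ 2 * (A ^ 2 * ∫⁻ y, ‖f y‖ₑ ^ 2 ∂m) := by
        gcongr; exact hW.lintegral_sq_le hf
    _ = _ := by
        rw [ENNReal.ofReal_mul hC, ENNReal.ofReal_coe_nnreal, mul_pow, mul_assoc]

/-- The Schur test. -/
theorem IsKernelOp.norm_le (hW : IsSchurWeight μ m W A) (hC : 0 ≤ C)
    (hkW : ∀ x y, ‖k x y‖ ≤ C * W x y) {T : Lp ℂ 2 m →L[ℂ] Lp ℂ 2 μ} (hT : IsKernelOp k T) :
    ‖T‖ ≤ C * A := by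
  have hCA : 0 ≤ C * A := mul_nonneg hC A.2
  refine T.opNorm_le_bound hCA fun f => ?_
  rw [Lp.norm_def, Lp.norm_def, ← ENNReal.toReal_ofReal hCA, ← ENNReal.toReal_mul]
  refine ENNReal.toReal_mono (ENNReal.mul_ne_top ENNReal.ofReal_ne_top (Lp.memLp f).2.ne) ?_
  rw [eLpNorm_congr_ae (hT f)]
  exact hW.eLpNorm_le hC hkW f

theorem IsSchurWeight.exists_isKernelOp (hW : IsSchurWeight μ m W A)
    (hk : Measurable (Function.uncurry k)) (hC : 0 ≤ C) (hkW : ∀ x y, ‖k x y‖ ≤ C * W x y) :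
    ∃ T : Lp ℂ 2 m →L[ℂ] Lp ℂ 2 μ, IsKernelOp k T := by
  have hmem : ∀ f : Lp ℂ 2 m, MemLp (fun x => ∫ y, k x y * f y ∂m) 2 μ := fun f => by
    refine ⟨?_, (hW.eLpNorm_le hC hkW f).trans_lt
      (ENNReal.mul_lt_top ENNReal.ofReal_lt_top (Lp.memLp f).2)⟩
    exact (hk.mul ((Lp.stronglyMeasurable f).measurable.comp measurable_snd)).stronglyMeasurable
      |>.integral_prod_right.aestronglyMeasurable
  let T : Lp ℂ 2 m →ₗ[ℂ] Lp ℂ 2 μ :=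
    { toFun := fun f => (hmem f).toLp
      map_add' := fun f g => by
        ext1
        refine (MemLp.coeFn_toLp _).trans ?_
        refine EventuallyEq.trans ?_ (Lp.coeFn_add _ _).symm
        filter_upwards [(hmem f).coeFn_toLp, (hmem g).coeFn_toLp, hW.ae_integrable hk hC hkW f,
          hW.ae_integrable hk hC hkW g] with x hf hg hfi hgi
        rw [Pi.add_apply, hf, hg, ← integral_add hfi hgi]
        refine integral_congr_ae ?_
        filter_upwards [Lp.coeFn_add f g] with y hy
        rw [hy, Pi.add_apply, mul_add]
      map_smul' := fun t f => by
        ext1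
        refine (MemLp.coeFn_toLp _).trans ?_
        refine EventuallyEq.trans ?_ (Lp.coeFn_smul _ _).symm
        filter_upwards [(hmem f).coeFn_toLp] with x hf
        rw [RingHom.id_apply, Pi.smul_apply, hf, smul_eq_mul, ← integral_const_mul]
        refine integral_congr_ae ?_
        filter_upwards [Lp.coeFn_smul t f] with y hy
        rw [hy, Pi.smul_apply, smul_eq_mul]; ring }
  have hCA : 0 ≤ C * A := mul_nonneg hC A.2
  refine ⟨T.mkContinuous (C * A) fun f => ?_, fun f => (hmem f).coeFn_toLp⟩
  rw [Lp.norm_def, Lp.norm_def, ← ENNReal.toReal_ofReal hCA, ← ENNReal.toReal_mul]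
  refine ENNReal.toReal_mono (ENNReal.mul_ne_top ENNReal.ofReal_ne_top (Lp.memLp f).2.ne) ?_
  exact (eLpNorm_congr_ae (hmem f).coeFn_toLp).le.trans (hW.eLpNorm_le hC hkW f)

theorem IsKernelOp.sub (hW : IsSchurWeight μ m W A) (hk : Measurable (Function.uncurry k))
    (hk' : Measurable (Function.uncurry k')) (hC : 0 ≤ C) (hkW : ∀ x y, ‖k x y‖ ≤ C * W x y)
    (hC' : 0 ≤ C') (hkW' : ∀ x y, ‖k' x y‖ ≤ C' * W x y) {T T' : Lp ℂ 2 m →L[ℂ] Lp ℂ 2 μ}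
    (hT : IsKernelOp k T) (hT' : IsKernelOp k' T') :
    IsKernelOp (fun x y => k x y - k' x y) (T - T') := by
  intro f
  rw [_root_.sub_apply]
  refine (Lp.coeFn_sub _ _).trans ?_
  filter_upwards [hT f, hT' f, hW.ae_integrable hk hC hkW f,
    hW.ae_integrable hk' hC' hkW' f] with x h1 h2 h3 h4
  rw [Pi.sub_apply, h1, h2, ← integral_sub h3 h4]
  simp_rw [sub_mul]

omit [SFinite μ] [SFinite m] in
theorem IsKernelOp.smul {T : Lp ℂ 2 m →L[ℂ] Lp ℂ 2 μ} (hT : IsKernelOp k T) (t : ℂ) :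
    IsKernelOp (fun x y => t * k x y) (t • T) := by
  intro f
  rw [_root_.smul_apply]
  refine (Lp.coeFn_smul _ _).trans ?_
  filter_upwards [hT f] with x h1
  rw [Pi.smul_apply, h1, smul_eq_mul, ← integral_const_mul]
  simp_rw [mul_assoc]

/-- If the kernels depend holomorphically on a parameter, under one dominating weight, so do the
operators, in operator norm. -/
theorem differentiableAt_of_isKernelOp (hW : IsSchurWeight μ m W A) {k : ℂ → X → Y → ℂ}
    {T : ℂ → Lp ℂ 2 m →L[ℂ] Lp ℂ 2 μ} {a : ℂ} {r : ℝ} (hr : 0 < r) (hC : 0 ≤ C)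
    (hk : ∀ w ∈ Metric.ball a r, Measurable (Function.uncurry (k w)))
    (hkW : ∀ w ∈ Metric.ball a r, ∀ x y, ‖k w x y‖ ≤ C * W x y)
    (hhol : ∀ x y, DifferentiableOn ℂ (fun w => k w x y) (Metric.ball a r))
    (hT : ∀ w ∈ Metric.ball a r, IsKernelOp (k w) (T w)) : DifferentiableAt ℂ T a := by
  have ha : a ∈ Metric.ball a r := Metric.mem_ball_self hr
  set k' : X → Y → ℂ := fun x y => deriv (fun w => k w x y) a with hk'
  have hk'm : Measurable (Function.uncurry k') := by
    -- the derivative is a limit of difference quotients along a sequence in the ball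
    let t : ℕ → ℂ := fun n => ((r / 2 / ((n : ℝ) + 1) : ℝ) : ℂ)
    have ht0 : ∀ n, t n ≠ 0 := fun n => by
      simp only [t, ne_eq, Complex.ofReal_eq_zero]; positivity
    have htr : ∀ n, a + t n ∈ Metric.ball a r := fun n => by
      rw [Metric.mem_ball, dist_eq_norm, add_sub_cancel_left, Complex.norm_real,
        Real.norm_of_nonneg (by positivity)]
      calc r / 2 / ((n : ℝ) + 1) ≤ r / 2 := div_le_self (by positivity) (by simp)
        _ < r := by linarith
    have htt : Tendsto t atTop (𝓝[≠] 0) := by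
      refine tendsto_nhdsWithin_iff.2 ⟨?_, Eventually.of_forall ht0⟩
      have h1 : Tendsto (fun n : ℕ => r / 2 / ((n : ℝ) + 1)) atTop (𝓝 0) :=
        tendsto_const_nhds.div_atTop
          (tendsto_atTop_add_const_right _ _ tendsto_natCast_atTop_atTop)
      exact (Complex.continuous_ofReal.tendsto' 0 0 Complex.ofReal_zero).comp h1
    refine measurable_of_tendsto_metrizable
      (f := fun n (q : X × Y) => (t n)⁻¹ * (k (a + t n) q.1 q.2 - k a q.1 q.2))
      (fun n => ((hk _ (htr n)).sub (hk a ha)).const_mul _) ?_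
    rw [tendsto_pi_nhds]
    rintro ⟨x, y⟩
    have h1 := ((hhol x y).differentiableAt (Metric.ball_mem_nhds a hr)).hasDerivAt
    have h2 := (hasDerivAt_iff_tendsto_slope_zero.1 h1).comp htt
    simpa [Function.comp_def] using h2
  have hk'W : ∀ x y, ‖k' x y‖ ≤ 2 * C / r * W x y := fun x y => by
    have := norm_deriv_le_of_bounded_ball hr (hhol x y) fun w hw => hkW w hw x y
    calc _ ≤ 2 * (C * W x y) / r := this
      _ = _ := by ring
  obtain ⟨T', hT'⟩ := hW.exists_isKernelOp hk'm (by positivity) hk'W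
  refine (hasDerivAt_of_quadratic_bound (C := 4 * C / r ^ 2 * A) (f' := T') ?_).differentiableAt
  filter_upwards [Metric.ball_mem_nhds a hr] with w hw
  have hsub : Measurable (Function.uncurry fun x y => k w x y - k a x y) :=
    (hk w hw).sub (hk a ha)
  have hsubW : ∀ x y, ‖k w x y - k a x y‖ ≤ (C + C) * W x y := fun x y =>
    (norm_sub_le _ _).trans (by rw [add_mul]; exact add_le_add (hkW w hw x y) (hkW a ha x y))
  have hder : ∀ x y, ‖(w - a) * k' x y‖ ≤ ‖w - a‖ * (2 * C / r) * W x y := fun x y => by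
    rw [norm_mul, mul_assoc]
    exact mul_le_mul_of_nonneg_left (hk'W x y) (norm_nonneg _)
  have hop : IsKernelOp (fun x y => k w x y - k a x y - (w - a) * k' x y)
      (T w - T a - (w - a) • T') :=
    ((hT w hw).sub hW (hk w hw) (hk a ha) hC (hkW w hw) hC (hkW a ha) (hT a ha)).sub hW hsub
      (hk'm.const_mul _) (by positivity) hsubW (by positivity) hder (hT'.smul _)
  refine (hop.norm_le hW (C := 4 * C / r ^ 2 * ‖w - a‖ ^ 2) (by positivity) fun x y => ?_).trans
    (le_of_eq (by ring))
  have := norm_sub_sub_smul_deriv_le (hhol x y) (fun w hw => hkW w hw x y) hw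
  rw [smul_eq_mul] at this
  calc _ ≤ 4 * (C * W x y) / r ^ 2 * ‖w - a‖ ^ 2 := this
    _ = _ := by ring

end KernelOperators

/-! ### Weakly singular weights on charts -/

section Weight

variable {Γ : Set R3} {D : Set R2} {χ : R2 → R3} {κ K ν : ℝ}

/-- The chart, extended by zero to a measurable map on the plane. -/
def chartExt (D : Set R2) (χ : R2 → R3) : R2 → R3 := D.indicator χ

theorem chartExt_of_mem {u : R2} (hu : u ∈ D) : chartExt D χ u = χ u := indicator_of_mem hu χ

/-- The weight `|x - χ(u)|^{-ν}`. -/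
def singularWeight (D : Set R2) (χ : R2 → R3) (ν : ℝ) (x : R3) (u : R2) : ℝ≥0 :=
  ‖x - chartExt D χ u‖₊ ^ (-ν)

theorem IsChart.continuousOn (hχ : IsChart Γ D χ κ K) : ContinuousOn χ D := by
  refine LipschitzOnWith.continuousOn (K := K.toNNReal)
    (LipschitzOnWith.of_dist_le_mul fun u hu u' hu' => ?_)
  rw [dist_eq_norm, dist_eq_norm, Real.coe_toNNReal _ hχ.nonneg]
  exact hχ.norm_sub_le u hu u' hu'

theorem IsChart.measurable_chartExt (hχ : IsChart Γ D χ κ K) : Measurable (chartExt D χ) := by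
  classical
  have := hχ.continuousOn.measurable_piecewise (g := (0 : R2 → R3)) continuousOn_const
    hχ.isOpen.measurableSet
  rwa [piecewise_eq_indicator] at this

theorem IsChart.measurable_singularWeight (hχ : IsChart Γ D χ κ K) :
    Measurable (Function.uncurry (singularWeight D χ ν)) :=
  (measurable_fst.sub (hχ.measurable_chartExt.comp measurable_snd)).nnnorm.pow_const _

theorem IsChart.isBounded_dom (hχ : IsChart Γ D χ κ K) (hΓ : Bornology.IsBounded Γ) :
    Bornology.IsBounded D := by
  obtain ⟨d, hd⟩ := Metric.isBounded_iff.1 hΓ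
  refine Metric.isBounded_iff.2 ⟨d / κ, fun u hu u' hu' => ?_⟩
  rw [le_div_iff₀ hχ.pos, dist_eq_norm, mul_comm]
  refine (hχ.le_norm_sub u hu u' hu').trans ?_
  rw [← dist_eq_norm]
  exact hd (hχ.mem u hu) (hχ.mem u' hu')

/-- From the viewpoint of any point `x` of space, a chart is as far away as the plane is from
some point `u₀`. -/
theorem IsChart.exists_le_norm_sub (hχ : IsChart Γ D χ κ K) (hΓ : Bornology.IsBounded Γ)
    (hne : D.Nonempty) (x : R3) : ∃ u₀ ∈ closure D, ∀ u ∈ D, κ / 2 * ‖u - u₀‖ ≤ ‖x - χ u‖ := by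
  have hex : ∀ n : ℕ, ∃ u ∈ D, dist x (χ u) < Metric.infDist x (χ '' D) + 1 / ((n : ℝ) + 1) := by
    intro n
    have hlt : Metric.infDist x (χ '' D) < Metric.infDist x (χ '' D) + 1 / ((n : ℝ) + 1) :=
      lt_add_of_pos_right _ (by positivity)
    obtain ⟨_, ⟨u, hu, rfl⟩, h⟩ := (Metric.infDist_lt_iff (hne.image χ)).1 hlt
    exact ⟨u, hu, h⟩
  choose v hv hvx using hex
  obtain ⟨u₀, hu₀, g, hg, hlim⟩ := tendsto_subseq_of_bounded (hχ.isBounded_dom hΓ) hv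
  refine ⟨u₀, hu₀, fun u hu => ?_⟩
  have hle : ∀ n, κ * ‖u - v (g n)‖ ≤ 2 * ‖x - χ u‖ + 1 / ((g n : ℝ) + 1) := by
    intro n
    have h1 := hχ.le_norm_sub u hu _ (hv (g n))
    have h2 := hvx (g n)
    have h3 := Metric.infDist_le_dist_of_mem (x := x) (mem_image_of_mem χ hu)
    have h4 := dist_triangle_left (χ u) (χ (v (g n))) x
    rw [dist_eq_norm (χ u)] at h4
    rw [← dist_eq_norm x]
    linarith
  have hl : Tendsto (fun n => κ * ‖u - v (g n)‖) atTop (𝓝 (κ * ‖u - u₀‖)) :=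
    ((hlim.const_sub u).norm).const_mul κ
  have hr : Tendsto (fun n => 2 * ‖x - χ u‖ + 1 / ((g n : ℝ) + 1)) atTop
      (𝓝 (2 * ‖x - χ u‖ + 0)) :=
    ((tendsto_one_div_add_atTop_nhds_zero_nat (𝕜 := ℝ)).comp hg.tendsto_atTop).const_add _
  have := le_of_tendsto_of_tendsto' hl hr hle
  linarith

/-- A singularity of order less than two is integrable over a surface, uniformly in its position. -/
theorem IsChart.exists_lintegral_singularWeight_le (hχ : IsChart Γ D χ κ K)
    (hΓ : Bornology.IsBounded Γ) (hν : 0 ≤ ν) (hν2 : ν < 2) :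
    ∃ A : ℝ≥0, ∀ x, ∫⁻ u in D, singularWeight D χ ν x u ≤ A := by
  rcases D.eq_empty_or_nonempty with rfl | hne
  · exact ⟨0, by simp⟩
  obtain ⟨R, hR⟩ := (hχ.isBounded_dom hΓ).subset_ball 0
  have hκ := hχ.pos
  -- the planar model integral
  have hint : IntegrableOn (fun u : R2 => (κ / 2) ^ (-ν) * ‖u‖ ^ (-ν)) (Metric.ball 0 (R + R)) := by
    refine integrableOn_ball_of_norm_le_rpow (C := (κ / 2) ^ (-ν)) (α := ν) (by simp)
      (by simpa using hν2) (ae_of_all _ fun u => ?_)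
      (measurable_norm.pow_const _ |>.const_mul _).aestronglyMeasurable
    rw [Real.norm_of_nonneg (by positivity)]
  refine ⟨(∫⁻ u in Metric.ball (0 : R2) (R + R),
    ENNReal.ofReal ((κ / 2) ^ (-ν) * ‖u‖ ^ (-ν))).toNNReal, fun x => ?_⟩
  rw [ENNReal.coe_toNNReal (by
    rw [← ofReal_integral_eq_lintegral_ofReal hint (ae_of_all _ fun u => by positivity)]
    exact ENNReal.ofReal_ne_top)]
  obtain ⟨u₀, hu₀, h⟩ := hχ.exists_le_norm_sub hΓ hne x
  have hu₀R : ‖u₀‖ ≤ R := by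
    have := closure_minimal (hR.trans Metric.ball_subset_closedBall) Metric.isClosed_closedBall hu₀
    simpa using this
  have hpt : ∀ u ∈ D, u ≠ u₀ → (singularWeight D χ ν x u : ℝ≥0∞)
      ≤ ENNReal.ofReal ((κ / 2) ^ (-ν) * ‖u - u₀‖ ^ (-ν)) := by
    intro u hu hne
    have hpos : 0 < ‖u - u₀‖ := norm_pos_iff.2 (sub_ne_zero.2 hne)
    rw [← ENNReal.ofReal_coe_nnreal]
    refine ENNReal.ofReal_le_ofReal ?_
    rw [singularWeight, NNReal.coe_rpow, coe_nnnorm, chartExt_of_mem hu,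
      ← Real.mul_rpow (by positivity) (by positivity)]
    exact Real.rpow_le_rpow_of_nonpos (by positivity) (h u hu) (by linarith)
  calc ∫⁻ u in D, singularWeight D χ ν x u
      ≤ ∫⁻ u in D, ENNReal.ofReal ((κ / 2) ^ (-ν) * ‖u - u₀‖ ^ (-ν)) := by
        refine lintegral_mono_ae ?_
        have hsing : ∀ᵐ u : R2 ∂volume.restrict D, u ≠ u₀ :=
          ae_restrict_of_ae (by simp [ae_iff])
        filter_upwards [hsing, ae_restrict_mem hχ.isOpen.measurableSet] with u h1 h2
        exact hpt u h2 h1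
    _ ≤ ∫⁻ u in Metric.ball u₀ (R + R), ENNReal.ofReal ((κ / 2) ^ (-ν) * ‖u - u₀‖ ^ (-ν)) := by
        refine lintegral_mono_set fun u hu => ?_
        have h1 : ‖u‖ < R := by simpa using hR hu
        rw [Metric.mem_ball, dist_eq_norm]
        linarith [_root_.norm_sub_le u u₀]
    _ = _ := by
        rw [← lintegral_indicator Metric.isOpen_ball.measurableSet,
          ← lintegral_indicator Metric.isOpen_ball.measurableSet,
          ← lintegral_sub_right_eq_self ((Metric.ball (0 : R2) (R + R)).indicator _) u₀]
        refine lintegral_congr fun u => ?_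
        by_cases hu : u ∈ Metric.ball u₀ (R + R)
        · have hu' : u - u₀ ∈ Metric.ball (0 : R2) (R + R) := by
            simpa [dist_eq_norm] using hu
          rw [indicator_of_mem hu, indicator_of_mem hu']
        · have hu' : u - u₀ ∉ Metric.ball (0 : R2) (R + R) := by
            simpa [dist_eq_norm] using hu
          rw [indicator_of_notMem hu, indicator_of_notMem hu']

end Weight

/-! ### Surface measures -/

section SurfaceMeasure

variable {Γ : Set R3} {ι : Type*} [Fintype ι] {G : PatchDecomposition Γ ι} {κ K : ℝ}

instance sFinite_surfaceMeasure (G : PatchDecomposition Γ ι) (r : R3 → R3) :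
    SFinite (surfaceMeasure G r) := by
  unfold surfaceMeasure
  rw [← Measure.sum_fintype]
  infer_instance

theorem measurable_gramDet (χ : R2 → R3) : Measurable (gramDet χ) := by
  have h1 := measurable_fderiv_apply_const ℝ χ (EuclideanSpace.single 0 1)
  have h2 := measurable_fderiv_apply_const ℝ χ (EuclideanSpace.single 1 1)
  have : gramDet χ = fun u => (gramC (complexify (fderiv ℝ χ u (EuclideanSpace.single 0 1)))
      (complexify (fderiv ℝ χ u (EuclideanSpace.single 1 1)))).re := funext fun u => gramDet_eq χ u
  rw [this]
  have h3 : Measurable fun u => complexify (fderiv ℝ χ u (EuclideanSpace.single 0 1)) :=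
    continuous_complexify.measurable.comp h1
  have h4 : Measurable fun u => complexify (fderiv ℝ χ u (EuclideanSpace.single 1 1)) :=
    continuous_complexify.measurable.comp h2
  have h5 := continuous_gramC.measurable.comp (h3.prodMk h4)
  exact Complex.measurable_re.comp h5

theorem measurable_surfaceDensity (χ : R2 → R3) :
    Measurable fun u => ENNReal.ofReal (√(gramDet χ u)) :=
  (measurable_gramDet χ).sqrt.ennreal_ofReal

omit [Fintype ι] in
theorem aemeasurable_comp_chart (hG : ∀ τ, IsChart Γ (G.dom τ) (G.chart τ) κ K) {r : R3 → R3}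
    (hr : ContinuousOn r Γ) (τ : ι) :
    AEMeasurable (r ∘ G.chart τ) (volume.restrict (G.dom τ)) :=
  (hr.comp (hG τ).continuousOn (hG τ).mem).aemeasurable (G.isOpen_dom τ).measurableSet

omit [Fintype ι] in
theorem aemeasurable_comp_chart' (hG : ∀ τ, IsChart Γ (G.dom τ) (G.chart τ) κ K) {r : R3 → R3}
    (hr : ContinuousOn r Γ) (τ : ι) :
    AEMeasurable (r ∘ G.chart τ) ((volume.restrict (G.dom τ)).withDensity
      (fun u => ENNReal.ofReal (√(gramDet (r ∘ G.chart τ) u)))) :=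
  (aemeasurable_comp_chart hG hr τ).mono_ac (withDensity_absolutelyContinuous _ _)

theorem lintegral_surfaceMeasure (hG : ∀ τ, IsChart Γ (G.dom τ) (G.chart τ) κ K) {r : R3 → R3}
    (hr : ContinuousOn r Γ) {f : R3 → ℝ≥0∞} (hf : Measurable f) :
    ∫⁻ x, f x ∂surfaceMeasure G r = ∑ τ, ∫⁻ u in G.dom τ,
      ENNReal.ofReal (√(gramDet (r ∘ G.chart τ) u)) * f (r (G.chart τ u)) := by
  unfold surfaceMeasure
  rw [lintegral_finsetSum_measure]
  refine Finset.sum_congr rfl fun τ _ => ?_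
  rw [lintegral_map' hf.aemeasurable (aemeasurable_comp_chart' hG hr τ),
    lintegral_withDensity_eq_lintegral_mul_non_measurable₀ _
      (measurable_surfaceDensity _).aemeasurable (ae_of_all _ fun _ => ENNReal.ofReal_lt_top)]
  rfl

/-- Null sets of the surface measure pull back to planar null sets, if the density is positive. -/
theorem ae_comp_chart_of_ae (hG : ∀ τ, IsChart Γ (G.dom τ) (G.chart τ) κ K) {r : R3 → R3}
    (hr : ContinuousOn r Γ) (hpos : ∀ τ, ∀ᵐ u ∂volume.restrict (G.dom τ),
      0 < gramDet (r ∘ G.chart τ) u) {P : R3 → Prop} (hP : ∀ᵐ x ∂surfaceMeasure G r, P x) (τ : ι) :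
    ∀ᵐ u ∂volume.restrict (G.dom τ), P (r (G.chart τ u)) := by
  have h1 : ∀ᵐ x ∂((volume.restrict (G.dom τ)).withDensity
      (fun u => ENNReal.ofReal (√(gramDet (r ∘ G.chart τ) u)))).map (r ∘ G.chart τ), P x := by
    refine ae_mono ?_ hP
    unfold surfaceMeasure
    exact Finset.single_le_sum (f := fun τ => ((volume.restrict (G.dom τ)).withDensity
      (fun u => ENNReal.ofReal (√(gramDet (r ∘ G.chart τ) u)))).map (r ∘ G.chart τ))
      (fun _ _ => Measure.zero_le _) (Finset.mem_univ τ)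
  have h2 := ae_of_ae_map (aemeasurable_comp_chart' hG hr τ) h1
  rw [ae_withDensity_iff (measurable_surfaceDensity _)] at h2
  filter_upwards [h2, hpos τ] with u hu hu'
  exact hu (by simpa using hu')

/-- A measurable property that holds almost everywhere on all charts holds almost everywhere on the
surface. -/
theorem ae_surfaceMeasure_of_ae (hG : ∀ τ, IsChart Γ (G.dom τ) (G.chart τ) κ K) {r : R3 → R3}
    (hr : ContinuousOn r Γ) {P : R3 → Prop} (hP : MeasurableSet {x | P x})
    (h : ∀ τ, ∀ᵐ u ∂volume.restrict (G.dom τ), P (r (G.chart τ u))) :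
    ∀ᵐ x ∂surfaceMeasure G r, P x := by
  rw [ae_iff]
  show surfaceMeasure G r {x | P x}ᶜ = 0
  rw [← lintegral_indicator_one hP.compl, lintegral_surfaceMeasure hG hr
    (measurable_one.indicator hP.compl)]
  refine Finset.sum_eq_zero fun τ _ => ?_
  rw [lintegral_eq_zero_iff' ?_]
  · filter_upwards [h τ] with u hu
    have : r (G.chart τ u) ∉ {x | P x}ᶜ := fun hcon => hcon hu
    simp [indicator_of_notMem this]
  · exact (measurable_surfaceDensity _).aemeasurable.mul
      ((measurable_one.indicator hP.compl).comp_aemeasurable (aemeasurable_comp_chart hG hr τ))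

omit [Fintype ι] in
theorem le_gramDet_chart (hG : ∀ τ, IsChart Γ (G.dom τ) (G.chart τ) κ K) (τ : ι) :
    ∀ᵐ u ∂volume.restrict (G.dom τ), κ ^ 4 ≤ gramDet (id ∘ G.chart τ) u := by
  have hL : LipschitzOnWith K.toNNReal (G.chart τ) (G.dom τ) :=
    LipschitzOnWith.of_dist_le_mul fun u hu u' hu' => by
      rw [dist_eq_norm, dist_eq_norm, Real.coe_toNNReal _ (hG τ).nonneg]
      exact (hG τ).norm_sub_le u hu u' hu'
  filter_upwards [ae_differentiableAt_of_lipschitzOnWith (G.isOpen_dom τ) hL,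
    ae_restrict_mem (G.isOpen_dom τ).measurableSet] with u hu huD
  refine le_gramDet (hG τ).pos hu ?_
  filter_upwards [(G.isOpen_dom τ).mem_nhds huD] with v hv
  exact (hG τ).le_norm_sub v hv u huD

omit [Fintype ι] in
theorem gramDet_chart_le (hG : ∀ τ, IsChart Γ (G.dom τ) (G.chart τ) κ K) (τ : ι) {u : R2}
    (hu : u ∈ G.dom τ) : gramDet (id ∘ G.chart τ) u ≤ K ^ 4 := by
  have hL : LipschitzOnWith K.toNNReal (G.chart τ) (G.dom τ) :=
    LipschitzOnWith.of_dist_le_mul fun u hu u' hu' => by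
      rw [dist_eq_norm, dist_eq_norm, Real.coe_toNNReal _ (hG τ).nonneg]
      exact (hG τ).norm_sub_le u hu u' hu'
  have h1 := norm_fderiv_le_of_lipschitzOn ℝ ((G.isOpen_dom τ).mem_nhds hu) hL
  rw [Real.coe_toNNReal _ (hG τ).nonneg] at h1
  have h2 : ∀ i, ‖fderiv ℝ (G.chart τ) u (EuclideanSpace.single i 1)‖ ≤ K := fun i =>
    (ContinuousLinearMap.le_opNorm _ _).trans (by simpa using h1)
  rw [gramDet, Function.id_comp, Matrix.det_fin_two]
  simp only [Matrix.gram_apply, real_inner_self_eq_norm_sq]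
  rw [real_inner_comm (fderiv ℝ (G.chart τ) u (EuclideanSpace.single 0 1))
    (fderiv ℝ (G.chart τ) u (EuclideanSpace.single 1 1))]
  have h3 := pow_le_pow_left₀ (norm_nonneg _) (h2 0) 2
  have h4 := pow_le_pow_left₀ (norm_nonneg _) (h2 1) 2
  have h5 := mul_le_mul h3 h4 (by positivity) (by positivity)
  nlinarith [sq_nonneg (inner ℝ (fderiv ℝ (G.chart τ) u (EuclideanSpace.single 0 1))
    (fderiv ℝ (G.chart τ) u (EuclideanSpace.single 1 1)))]

theorem ae_mem_of_refMeasure (hG : ∀ τ, IsChart Γ (G.dom τ) (G.chart τ) κ K) :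
    ∀ᵐ x ∂refMeasure G, x ∈ Γ := by
  refine ae_surfaceMeasure_of_ae hG continuousOn_id G.isClosed.measurableSet fun τ => ?_
  filter_upwards [ae_restrict_mem (G.isOpen_dom τ).measurableSet] with u hu
  exact (hG τ).mem u hu

/-- Weakly singular weights satisfy the assumptions of the Schur test. -/
theorem exists_isSchurWeight (hΓ : Bornology.IsBounded Γ)
    (hG : ∀ τ, IsChart Γ (G.dom τ) (G.chart τ) κ K) {ν : ℝ} (hν : 0 ≤ ν) (hν2 : ν < 2) :
    ∃ A : ℝ≥0, ∀ τ, IsSchurWeight (refMeasure G) (volume.restrict (G.dom τ))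
      (singularWeight (G.dom τ) (G.chart τ) ν) A := by
  choose A hA using fun τ => (hG τ).exists_lintegral_singularWeight_le hΓ hν hν2
  set S : ℝ≥0 := ∑ τ, A τ
  refine ⟨S + (K ^ 2).toNNReal * S, fun τ => ⟨(hG τ).measurable_singularWeight,
    ae_of_all _ fun x => (hA τ x).trans ?_, ?_⟩⟩
  · exact_mod_cast (Finset.single_le_sum (f := A) (fun _ _ => zero_le) (Finset.mem_univ τ)).trans
      (le_add_of_nonneg_right zero_le)
  · filter_upwards [ae_restrict_mem (G.isOpen_dom τ).measurableSet] with u hu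
    have hWu : Measurable fun x => (singularWeight (G.dom τ) (G.chart τ) ν x u : ℝ≥0∞) :=
      ((hG τ).measurable_singularWeight.comp measurable_prodMk_right).coe_nnreal_ennreal
    rw [lintegral_surfaceMeasure hG continuousOn_id hWu]
    calc ∑ σ, ∫⁻ v in G.dom σ, ENNReal.ofReal (√(gramDet (id ∘ G.chart σ) v))
            * (singularWeight (G.dom τ) (G.chart τ) ν (G.chart σ v) u : ℝ≥0∞)
        ≤ ∑ σ, ENNReal.ofReal (K ^ 2) * (A σ : ℝ≥0∞) := by
          refine Finset.sum_le_sum fun σ _ => ?_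
          refine le_trans ?_ (mul_le_mul_right (hA σ (G.chart τ u)) _)
          rw [← lintegral_const_mul' _ _ ENNReal.ofReal_ne_top]
          refine lintegral_mono_ae ?_
          filter_upwards [ae_restrict_mem (G.isOpen_dom σ).measurableSet] with v hv
          refine mul_le_mul' (ENNReal.ofReal_le_ofReal ?_) (le_of_eq ?_)
          · refine Real.sqrt_le_iff.2 ⟨by positivity, (gramDet_chart_le hG σ hv).trans (le_of_eq ?_)⟩
            ring
          · -- the weight is symmetric in the two points of the surface
            simp only [singularWeight, chartExt_of_mem hu, chartExt_of_mem hv]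
            rw [← nnnorm_neg, neg_sub]
      _ = ((K ^ 2).toNNReal * S : ℝ≥0) := by
          rw [← Finset.mul_sum, ENNReal.coe_mul, ENNReal.ofNNReal_finsetSum]; rfl
      _ ≤ _ := by exact_mod_cast le_add_of_nonneg_left zero_le

/-- The composition `f ↦ f ∘ χ_τ` with a chart, as an operator on `L²`. -/
theorem exists_compChart (hG : ∀ τ, IsChart Γ (G.dom τ) (G.chart τ) κ K) (τ : ι) :
    ∃ T : Lp ℂ 2 (refMeasure G) →L[ℂ] Lp ℂ 2 (volume.restrict (G.dom τ)),
      ∀ f : Lp ℂ 2 (refMeasure G), T f =ᵐ[volume.restrict (G.dom τ)] fun u => f (G.chart τ u) := by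
  have hκ := (hG τ).pos
  have hpos : ∀ τ, ∀ᵐ u ∂volume.restrict (G.dom τ), 0 < gramDet (id ∘ G.chart τ) u := fun τ => by
    filter_upwards [le_gramDet_chart hG τ] with u hu
    exact lt_of_lt_of_le (by positivity) hu
  set C : ℝ≥0 := (κ⁻¹).toNNReal with hC
  have hbound : ∀ f : Lp ℂ 2 (refMeasure G),
      eLpNorm (fun u => f (G.chart τ u)) 2 (volume.restrict (G.dom τ))
        ≤ C * eLpNorm f 2 (refMeasure G) := by
    intro f
    have hf : Measurable fun x => ‖f x‖ₑ ^ 2 := (Lp.stronglyMeasurable f).enorm.pow_const 2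
    rw [← ENNReal.pow_le_pow_left_iff two_ne_zero, mul_pow, eLpNorm_two_sq, eLpNorm_two_sq,
      lintegral_surfaceMeasure hG continuousOn_id hf]
    refine le_trans ?_ (mul_le_mul_right (Finset.single_le_sum (f := fun τ => ∫⁻ u in G.dom τ,
      ENNReal.ofReal (√(gramDet (id ∘ G.chart τ) u)) * ‖f (id (G.chart τ u))‖ₑ ^ 2)
      (fun _ _ => zero_le) (Finset.mem_univ τ)) _)
    rw [← lintegral_const_mul' _ _ (by simp)]
    refine lintegral_mono_ae ?_
    filter_upwards [le_gramDet_chart hG τ] with u hu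
    rw [← mul_assoc]
    refine le_mul_of_one_le_left zero_le ?_
    have h1 : κ ^ 2 ≤ √(gramDet (id ∘ G.chart τ) u) :=
      Real.le_sqrt_of_sq_le (by rw [← pow_mul]; exact hu)
    have h2 : (C : ℝ≥0∞) = ENNReal.ofReal κ⁻¹ := rfl
    rw [h2, ← ENNReal.ofReal_pow (by positivity), ← ENNReal.ofReal_mul (by positivity),
      ENNReal.one_le_ofReal]
    calc (1 : ℝ) = κ⁻¹ ^ 2 * κ ^ 2 := by field_simp
      _ ≤ _ := by gcongr
  have hmem : ∀ f : Lp ℂ 2 (refMeasure G),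
      MemLp (fun u => f (G.chart τ u)) 2 (volume.restrict (G.dom τ)) := fun f =>
    ⟨((Lp.stronglyMeasurable f).measurable.comp_aemeasurable
      (aemeasurable_comp_chart hG continuousOn_id τ)).aestronglyMeasurable,
      (hbound f).trans_lt (ENNReal.mul_lt_top ENNReal.coe_lt_top (Lp.memLp f).2)⟩
  let T : Lp ℂ 2 (refMeasure G) →ₗ[ℂ] Lp ℂ 2 (volume.restrict (G.dom τ)) :=
    { toFun := fun f => (hmem f).toLp
      map_add' := fun f g => by
        ext1
        refine (MemLp.coeFn_toLp _).trans (EventuallyEq.trans ?_ (Lp.coeFn_add _ _).symm)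
        filter_upwards [(hmem f).coeFn_toLp, (hmem g).coeFn_toLp,
          ae_comp_chart_of_ae hG continuousOn_id hpos (Lp.coeFn_add f g) τ] with u hf hg hfg
        rw [Pi.add_apply, hf, hg]
        exact hfg
      map_smul' := fun t f => by
        ext1
        refine (MemLp.coeFn_toLp _).trans (EventuallyEq.trans ?_ (Lp.coeFn_smul _ _).symm)
        filter_upwards [(hmem f).coeFn_toLp,
          ae_comp_chart_of_ae hG continuousOn_id hpos (Lp.coeFn_smul t f) τ] with u hf htf
        rw [RingHom.id_apply, Pi.smul_apply, hf]
        exact htf }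
  refine ⟨T.mkContinuous C fun f => ?_, fun f => (hmem f).coeFn_toLp⟩
  rw [Lp.norm_def, Lp.norm_def]
  refine (ENNReal.toReal_mono (ENNReal.mul_ne_top ENNReal.coe_ne_top (Lp.memLp f).2.ne)
    ((eLpNorm_congr_ae (hmem f).coeFn_toLp).le.trans (hbound f))).trans (le_of_eq ?_)
  rw [ENNReal.toReal_mul, ENNReal.coe_toReal]

end SurfaceMeasure

/-! ### Continuity in the real parameters -/

section RealContinuity

variable {b : ℕ → ℝ}

theorem toComplex_mem_finDomain {η : ℝ} (hη : 0 < η) {y : ParamSpace}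
    (hy : ∀ j, b j = 0 → (y j : ℝ) = 0) : y.toComplex ∈ finDomain b η := by
  have h0 : ∀ j, gap (y.toComplex j) = 0 := fun j => gap_of_mem (y.toComplex_mem j)
  refine ⟨⟨fun j hj => by simp [ParamSpace.toComplex, hy j hj], ?_, ?_⟩, ?_⟩
  · simp_rw [h0, mul_zero]; exact summable_zero
  · simpa [h0] using hη
  · convert Set.finite_empty
    exact Set.eq_empty_of_forall_notMem fun j hj => hj (y.toComplex_mem j)

theorem norm_toComplex_sub (y y' : ParamSpace) (j : ℕ) :
    ‖y.toComplex j - y'.toComplex j‖ = |(y j : ℝ) - y' j| := by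
  rw [ParamSpace.toComplex, ParamSpace.toComplex, ← Complex.ofReal_sub, Complex.norm_real,
    Real.norm_eq_abs]

/-- The parameter that agrees with `y'` up to the index `N` and with `y` from there on. -/
def spliceParam (y y' : ParamSpace) (N : ℕ) : ParamSpace := fun j => if j < N then y' j else y j

/-- On real parameters, a bounded separately holomorphic map satisfies the same Lipschitz estimate
for arbitrary pairs of points as for pairs that differ in finitely many coordinates, provided that
it is continuous along splices. -/
theorem IsBoundedSepHolomorphic.norm_toComplex_sub_le {X : Type*} [NormedAddCommGroup X]
    [NormedSpace ℂ X] [CompleteSpace X] {H : (ℕ → ℂ) → X} {η B : ℝ} (hb : ∀ j, 0 ≤ b j)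
    (hbs : Summable b) (hη : 0 < η) (hB : 0 ≤ B) (hH : IsBoundedSepHolomorphic b (3 * η) B H)
    {y y' : ParamSpace}
    (hy : ∀ j, b j = 0 → (y j : ℝ) = 0) (hy' : ∀ j, b j = 0 → (y' j : ℝ) = 0)
    (hlim : Tendsto (fun N => H (spliceParam y y' N).toComplex) atTop (𝓝 (H y'.toComplex))) :
    ‖H y'.toComplex - H y.toComplex‖ ≤ 2 * B / η * ∑' j, b j * |(y' j : ℝ) - y j| := by
  refine le_of_tendsto (hlim.sub_const _).norm (Eventually.of_forall fun N => ?_)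
  have hsum : Summable fun j => b j * |(y' j : ℝ) - y j| := by
    simp_rw [← norm_toComplex_sub]
    exact summable_mul_norm_sub hb (summable_toComplex hb hbs _) (summable_toComplex hb hbs _)
  have hs : ∀ j, b j = 0 → ((spliceParam y y' N) j : ℝ) = 0 := fun j hj => by
    unfold spliceParam; split_ifs; exacts [hy' j hj, hy j hj]
  refine (hH.norm_sub_le hb hη (toComplex_mem_finDomain hη hy) (toComplex_mem_finDomain hη hs)
    (S := Finset.range N) fun j hj => ?_).trans (mul_le_mul_of_nonneg_left ?_ (by positivity))
  · rw [Finset.mem_range] at hj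
    simp [ParamSpace.toComplex, spliceParam, hj]
  · refine le_trans (Finset.sum_le_sum fun j hj => ?_)
      (hsum.sum_le_tsum (Finset.range N) fun j _ => mul_nonneg (hb j) (abs_nonneg _))
    rw [norm_toComplex_sub]
    simp [spliceParam, Finset.mem_range.1 hj]

variable {s : ℝ} {v₀ : R3} {v : ℕ → R3}

theorem summable_smul_real (hbs : Summable b) (hv : ∀ j, ‖v j‖ ≤ b j * s) {t : ℕ → ℝ} {M : ℝ}
    (ht : ∀ j, |t j| ≤ M) : Summable fun j => t j • v j := by
  refine ((hbs.mul_right s).mul_left M).of_norm_bounded fun j => ?_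
  rw [norm_smul, Real.norm_eq_abs]
  exact mul_le_mul (ht j) (hv j) (norm_nonneg _) ((abs_nonneg _).trans (ht j))

/-- Finitely many of the vectors `v_j`, of positive weight, suffice to compensate small
perturbations of a series `∑ t_j v_j`. -/
theorem exists_finset_correction (hbs : Summable b) (hv : ∀ j, ‖v j‖ ≤ b j * s) (y y' : ParamSpace) :
    ∃ J : Finset ℕ, (∀ j ∈ J, b j ≠ 0) ∧ ∃ t : ℕ → ℕ → ℝ, (∀ j, Tendsto (t · j) atTop (𝓝 0)) ∧
      ∀ N, ∑' j, ((spliceParam y y' N j : ℝ) - y' j) • v j = ∑ j ∈ J, t N j • v j := by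
  set V : Submodule ℝ R3 := Submodule.span ℝ (v '' {j | b j ≠ 0}) with hV
  have hvV : ∀ j, v j ∈ V := fun j => by
    by_cases hj : b j = 0
    · have : v j = 0 := norm_le_zero_iff.1 ((hv j).trans (by simp [hj]))
      rw [this]; exact V.zero_mem
    · exact Submodule.subset_span ⟨j, hj, rfl⟩
  obtain ⟨F, hF, hFspan⟩ := Submodule.fg_span_iff_fg_span_finset_subset _ |>.1
    (IsNoetherian.noetherian V)
  obtain ⟨J, hJ, rfl⟩ := Finset.subset_set_image_iff.1 hF
  refine ⟨J, fun j hj => hJ hj, ?_⟩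
  let vV : ℕ → V := fun j => ⟨v j, hvV j⟩
  let L : (J → ℝ) →ₗ[ℝ] V := Fintype.linearCombination ℝ (fun j : J => vV j)
  have hL : LinearMap.range L = ⊤ := by
    rw [Fintype.range_linearCombination]
    apply Submodule.map_injective_of_injective V.subtype_injective
    have himg : V.subtype '' range (fun j : J => vV j) = (Finset.image v J : Finset R3) := by
      ext x
      simpa [vV] using fun j _ hj => hj ▸ hvV j
    rw [Submodule.map_top, Submodule.range_subtype, Submodule.map_span, himg, ← hFspan]
  obtain ⟨g, hg⟩ := L.exists_rightInverse_of_surjective hL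
  have hvV' : ∀ j, ‖vV j‖ ≤ b j * s := hv
  have hd : ∀ N j, |(spliceParam y y' N j : ℝ) - y' j| ≤ 2 := fun N j => by
    have h1 := (spliceParam y y' N j).2
    have h2 := (y' j).2
    rw [abs_le]; constructor <;> linarith [h1.1, h1.2, h2.1, h2.2]
  have hsum : ∀ N, Summable fun j => ((spliceParam y y' N j : ℝ) - y' j) • vV j := fun N => by
    refine ((hbs.mul_right s).mul_left 2).of_norm_bounded fun j => ?_
    rw [norm_smul, Real.norm_eq_abs]
    exact mul_le_mul (hd N j) (hvV' j) (norm_nonneg _) zero_le_two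
  let e : ℕ → V := fun N => ∑' j, ((spliceParam y y' N j : ℝ) - y' j) • vV j
  have he : Tendsto e atTop (𝓝 0) := by
    have htail := (tendsto_sum_nat_add fun j => 2 * (b j * s))
    refine squeeze_zero_norm (fun N => ?_) htail
    have h0 : ∑ j ∈ Finset.range N, ((spliceParam y y' N j : ℝ) - y' j) • vV j = 0 :=
      Finset.sum_eq_zero fun j hj => by simp [spliceParam, Finset.mem_range.1 hj]
    have h1 := (hsum N).sum_add_tsum_nat_add N
    rw [h0, zero_add] at h1
    show ‖∑' j, ((spliceParam y y' N j : ℝ) - y' j) • vV j‖ ≤ _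
    rw [← h1]
    have h2 : Summable fun j => 2 * (b j * s) := (hbs.mul_right s).mul_left 2
    refine tsum_of_norm_bounded ((summable_nat_add_iff N).2 h2).hasSum fun j => ?_
    rw [norm_smul, Real.norm_eq_abs]
    exact mul_le_mul (hd N _) (hvV' _) (norm_nonneg _) zero_le_two
  have hge : Tendsto (fun N => g (e N)) atTop (𝓝 0) := by
    have := (LinearMap.continuous_of_finiteDimensional g).tendsto 0
    rw [map_zero] at this
    exact this.comp he
  refine ⟨fun N j => if hj : j ∈ J then g (e N) ⟨j, hj⟩ else 0, fun j => ?_, fun N => ?_⟩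
  · by_cases hj : j ∈ J
    · simpa [hj] using (tendsto_pi_nhds.1 hge) ⟨j, hj⟩
    · simp [hj]
  · have h1 : L (g (e N)) = e N := LinearMap.congr_fun hg (e N)
    have h2 : (e N : R3) = ∑' j, ((spliceParam y y' N j : ℝ) - y' j) • v j :=
      V.subtypeL.map_tsum (hsum N)
    rw [← h2, ← h1, ← Finset.sum_coe_sort J]
    simp [L, Fintype.linearCombination_apply, vV]

/-- Let `H(z) = F(z, ζ_z)` with an affine series `ζ_z`, where `F(·, ζ)` is known to be continuous on
the real parameters only for fixed `ζ`. Then `H` is still continuous along splices: finitely many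
coordinates can be corrected by a small amount so as to keep `ζ` fixed, and the error made by the
correction is controlled by the Lipschitz estimate. -/
theorem tendsto_of_continuous_of_fixed {η B : ℝ} (hb : ∀ j, 0 ≤ b j) (hbs : Summable b)
    (hη : 0 < η) (hB : 0 ≤ B) (hv : ∀ j, ‖v j‖ ≤ b j * s) {F : (ℕ → ℂ) → C3 → ℂ}
    (hH : IsBoundedSepHolomorphic b (3 * η) B fun z => F z (affineSeries v₀ v z))
    (hF : ∀ y₀ : ParamSpace, (∀ j, b j = 0 → (y₀ j : ℝ) = 0) → ∃ f : ParamSpace → ℂ, Continuous f ∧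
      ∀ y : ParamSpace, (∀ j, b j = 0 → (y j : ℝ) = 0) →
        F y.toComplex (affineSeries v₀ v y₀.toComplex) = f y)
    {y y' : ParamSpace} (hy : ∀ j, b j = 0 → (y j : ℝ) = 0)
    (hy' : ∀ j, b j = 0 → (y' j : ℝ) = 0) :
    Tendsto (fun N => F (spliceParam y y' N).toComplex
      (affineSeries v₀ v (spliceParam y y' N).toComplex)) atTop
      (𝓝 (F y'.toComplex (affineSeries v₀ v y'.toComplex))) := by
  classical
  obtain ⟨J, hJ, t, ht, hcorr⟩ := exists_finset_correction hbs hv y y'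
  set H : (ℕ → ℂ) → ℂ := fun z => F z (affineSeries v₀ v z) with hHdef
  show Tendsto (fun N => H (spliceParam y y' N).toComplex) atTop (𝓝 (H y'.toComplex))
  set Λ : ℝ := 2 * B / η with hΛ
  have hΛ0 : 0 ≤ Λ := by positivity
  have hSJ : 0 ≤ ∑ j ∈ J, b j := Finset.sum_nonneg fun j _ => hb j
  rw [Metric.tendsto_atTop']
  intro ε hε
  -- shrinking the coordinates in `J` by the factor `1 - δ` makes room for the correction
  obtain ⟨δ, hδ0, hδ1, hδ⟩ : ∃ δ > 0, δ < 1 ∧ Λ * (3 * δ * ∑ j ∈ J, b j) < ε / 2 := by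
    refine ⟨min (1 / 2) (ε / 2 / (3 * Λ * (∑ j ∈ J, b j) + 1)), by positivity,
      (min_le_left _ _).trans_lt (by norm_num), ?_⟩
    have h1 : min (1 / 2) (ε / 2 / (3 * Λ * (∑ j ∈ J, b j) + 1))
        ≤ ε / 2 / (3 * Λ * (∑ j ∈ J, b j) + 1) := min_le_right _ _
    have h2 := (le_div_iff₀ (by positivity)).1 h1
    have h3 : 0 < min (1 / 2) (ε / 2 / (3 * Λ * (∑ j ∈ J, b j) + 1)) := by positivity
    nlinarith
  have hle : (-1 : ℝ) ≤ 1 := by norm_num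
  let ys : ParamSpace := fun j => if j ∈ J then projIcc (-1) 1 hle ((1 - δ) * y' j) else y' j
  let yc : ℕ → ParamSpace := fun N j =>
    if j ∈ J then projIcc (-1) 1 hle ((1 - δ) * y' j - t N j) else spliceParam y y' N j
  have hys : ∀ j ∈ J, (ys j : ℝ) = (1 - δ) * y' j := fun j hj => by
    have h1 : |(y' j : ℝ)| ≤ 1 := abs_le.2 (y' j).2
    have h2 : (1 - δ) * (y' j : ℝ) ∈ Icc (-1 : ℝ) 1 := by
      rw [mem_Icc, ← abs_le, abs_mul, abs_of_nonneg (by linarith)]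
      nlinarith [abs_nonneg (y' j : ℝ)]
    simp [ys, hj, projIcc_of_mem hle h2]
  have hsupp_ys : ∀ j, b j = 0 → (ys j : ℝ) = 0 := fun j hj => by
    have hjJ : j ∉ J := fun h => hJ j h hj
    simp [ys, hjJ, hy' j hj]
  have hsupp_s : ∀ N j, b j = 0 → (spliceParam y y' N j : ℝ) = 0 := fun N j hj => by
    unfold spliceParam; split_ifs; exacts [hy' j hj, hy j hj]
  have hsupp_yc : ∀ N j, b j = 0 → (yc N j : ℝ) = 0 := fun N j hj => by
    have hjJ : j ∉ J := fun h => hJ j h hj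
    simp [yc, hjJ, hsupp_s N j hj]
  -- eventually the correction is small and acts on coordinates that are not spliced
  have hev : ∀ᶠ N in atTop, ∀ j ∈ J, |t N j| ≤ δ ∧ j < N := by
    rw [Finset.eventually_all]
    intro j _
    have h1 := (ht j).abs
    rw [abs_zero] at h1
    filter_upwards [h1.eventually (ge_mem_nhds hδ0), eventually_gt_atTop j] with N h2 h3
    exact ⟨h2, h3⟩
  have hyc : ∀ᶠ N in atTop, ∀ j ∈ J, (yc N j : ℝ) = (1 - δ) * y' j - t N j ∧
      |t N j| ≤ δ ∧ spliceParam y y' N j = y' j := by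
    filter_upwards [hev] with N hN j hj
    obtain ⟨h3, h4⟩ := hN j hj
    have h1 : |(y' j : ℝ)| ≤ 1 := abs_le.2 (y' j).2
    have h2 : (1 - δ) * (y' j : ℝ) - t N j ∈ Icc (-1 : ℝ) 1 := by
      rw [mem_Icc, ← abs_le]
      refine (abs_sub _ _).trans ?_
      rw [abs_mul, abs_of_nonneg (show 0 ≤ 1 - δ by linarith)]
      nlinarith [abs_nonneg (y' j : ℝ)]
    exact ⟨by simp [yc, hj, projIcc_of_mem hle h2], h3, by simp [spliceParam, h4]⟩
  obtain ⟨f, hf, hfF⟩ := hF ys hsupp_ys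
  have hHys : H ys.toComplex = f ys := hfF ys hsupp_ys
  have hHyc : ∀ᶠ N in atTop, H (yc N).toComplex = f (yc N) := by
    filter_upwards [hyc] with N hN
    rw [← hfF (yc N) (hsupp_yc N)]
    show F _ _ = F _ _
    congr 1
    rw [affineSeries_toComplex, affineSeries_toComplex]
    congr 2
    have habs : ∀ (y : ParamSpace) j, |(y j : ℝ)| ≤ 1 := fun y j => abs_le.2 (y j).2
    have hd : ∀ j, |(spliceParam y y' N j : ℝ) - y' j| ≤ 2 := fun j =>
      (abs_sub _ _).trans (by linarith [habs (spliceParam y y' N) j, habs y' j])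
    rw [← sub_eq_zero, ← (summable_smul_real hbs hv (habs _)).tsum_sub
      (summable_smul_real hbs hv (habs _))]
    have hterm : ∀ j, (yc N j : ℝ) • v j - (ys j : ℝ) • v j
        = ((spliceParam y y' N j : ℝ) - y' j) • v j - if j ∈ J then t N j • v j else 0 := by
      intro j
      by_cases hj : j ∈ J
      · obtain ⟨h1, -, h3⟩ := hN j hj
        rw [h1, hys j hj, h3, if_pos hj, ← sub_smul, ← sub_smul]
        congr 1; ring
      · simp [yc, ys, hj, sub_smul]
    have hfin : HasSum (fun j => if j ∈ J then t N j • v j else 0) (∑ j ∈ J, t N j • v j) := by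
      have : HasSum (fun j => if j ∈ J then t N j • v j else 0)
          (∑ j ∈ J, if j ∈ J then t N j • v j else 0) :=
        hasSum_sum_of_ne_finset_zero fun j hj => if_neg hj
      rwa [Finset.sum_congr rfl fun j hj => if_pos hj] at this
    simp_rw [hterm]
    rw [(summable_smul_real hbs hv hd).tsum_sub hfin.summable, hcorr, hfin.tsum_eq, sub_self]
  have hlim : Tendsto yc atTop (𝓝 ys) := by
    rw [tendsto_pi_nhds]
    intro j
    by_cases hj : j ∈ J
    · simp only [yc, ys, if_pos hj]
      refine (continuous_projIcc.tendsto _).comp ?_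
      simpa using (ht j).const_sub ((1 - δ) * (y' j : ℝ))
    · simp only [yc, ys, if_neg hj]
      refine tendsto_const_nhds.congr' ?_
      filter_upwards [eventually_gt_atTop j] with N hN
      simp [spliceParam, hN]
  have hHlim : Tendsto (fun N => H (yc N).toComplex) atTop (𝓝 (H ys.toComplex)) := by
    rw [hHys]
    exact ((hf.tendsto ys).comp hlim).congr' (hHyc.mono fun N h => h.symm)
  have h1 : ‖H ys.toComplex - H y'.toComplex‖ ≤ Λ * (δ * ∑ j ∈ J, b j) := by
    refine (hH.norm_sub_le hb hη (toComplex_mem_finDomain hη hy')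
      (toComplex_mem_finDomain hη hsupp_ys) (S := J) fun j hj => ?_).trans
      (mul_le_mul_of_nonneg_left ?_ hΛ0)
    · simp [ParamSpace.toComplex, ys, hj]
    · rw [Finset.mul_sum]
      refine Finset.sum_le_sum fun j hj => ?_
      rw [norm_toComplex_sub, hys j hj, mul_comm]
      refine mul_le_mul_of_nonneg_right ?_ (hb j)
      have h1 : |(y' j : ℝ)| ≤ 1 := abs_le.2 (y' j).2
      rw [show (1 - δ) * (y' j : ℝ) - y' j = -(δ * y' j) by ring, abs_neg, abs_mul,
        abs_of_pos hδ0]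
      nlinarith
  have h2 : ∀ᶠ N in atTop, ‖H (spliceParam y y' N).toComplex - H (yc N).toComplex‖
      ≤ Λ * (2 * δ * ∑ j ∈ J, b j) := by
    filter_upwards [hyc] with N hN
    rw [norm_sub_rev]
    refine (hH.norm_sub_le hb hη (toComplex_mem_finDomain hη (hsupp_s N))
      (toComplex_mem_finDomain hη (hsupp_yc N)) (S := J) fun j hj => ?_).trans
      (mul_le_mul_of_nonneg_left ?_ hΛ0)
    · simp [ParamSpace.toComplex, yc, hj]
    · rw [Finset.mul_sum]
      refine Finset.sum_le_sum fun j hj => ?_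
      obtain ⟨h3, h4, h5⟩ := hN j hj
      rw [norm_toComplex_sub, h3, h5, mul_comm]
      refine mul_le_mul_of_nonneg_right ?_ (hb j)
      have h1 : |(y' j : ℝ)| ≤ 1 := abs_le.2 (y' j).2
      rw [show (1 - δ) * (y' j : ℝ) - t N j - y' j = -(δ * y' j + t N j) by ring, abs_neg]
      refine (abs_add_le _ _).trans ?_
      rw [abs_mul, abs_of_pos hδ0]
      nlinarith
  have h3 := hHlim.eventually (Metric.ball_mem_nhds _ (half_pos hε))
  obtain ⟨N₀, hN₀⟩ := eventually_atTop.1 (h2.and h3)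
  refine ⟨N₀, fun N hN => ?_⟩
  obtain ⟨h4, h5⟩ := hN₀ N hN.le
  rw [dist_eq_norm] at h5
  rw [dist_eq_norm]
  calc ‖H (spliceParam y y' N).toComplex - H y'.toComplex‖
      = ‖(H (spliceParam y y' N).toComplex - H (yc N).toComplex)
          + (H (yc N).toComplex - H ys.toComplex) + (H ys.toComplex - H y'.toComplex)‖ := by
        congr 1; ring
    _ ≤ Λ * (2 * δ * ∑ j ∈ J, b j) + ‖H (yc N).toComplex - H ys.toComplex‖
          + Λ * (δ * ∑ j ∈ J, b j) :=
        (norm_add_le _ _).trans (add_le_add ((norm_add_le _ _).trans (add_le_add h4 le_rfl)) h1)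
    _ < ε := by linarith

end RealContinuity

/-! ### The kernel on the reference surface -/

theorem IsBoundedSepHolomorphic.mul {b : ℕ → ℝ} {η B₁ B₂ : ℝ} {H₁ H₂ : (ℕ → ℂ) → ℂ}
    (h₁ : IsBoundedSepHolomorphic b η B₁ H₁) (h₂ : IsBoundedSepHolomorphic b η B₂ H₂) :
    IsBoundedSepHolomorphic b η (B₁ * B₂) fun z => H₁ z * H₂ z where
  bound z hz := by
    rw [norm_mul]
    exact mul_le_mul (h₁.bound z hz) (h₂.bound z hz) (norm_nonneg _)
      ((norm_nonneg _).trans (h₁.bound z hz))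
  differentiableAt z hz j hj := (h₁.differentiableAt z hz j hj).mul (h₂.differentiableAt z hz j hj)

theorem IsBoundedSepHolomorphic.mono {X : Type*} [NormedAddCommGroup X] [NormedSpace ℂ X]
    {b : ℕ → ℝ} {η η' B : ℝ} {H : (ℕ → ℂ) → X} (h : IsBoundedSepHolomorphic b η B H)
    (hη : η' ≤ η) : IsBoundedSepHolomorphic b η' B H :=
  ⟨fun z hz => h.bound z (finDomain_mono hη hz),
    fun z hz => h.differentiableAt z (finDomain_mono hη hz)⟩

theorem IsExtendedKernel.mono {Γ : Set R3} {ι : Type*} {G : PatchDecomposition Γ ι}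
    {φ₀ : R3 → R3} {φ : ℕ → R3 → R3} {b : ℕ → ℝ} {a : ParamSpace → R3 → C3 → ℂ}
    {K : ι → R2 → (ℕ → ℂ) → C3 → ℂ} {η η' C ν : ℝ} (h : IsExtendedKernel G φ₀ φ b a K η C ν)
    (hη : η' ≤ η) : IsExtendedKernel G φ₀ φ b a K η' C ν where
  eq_real τ u hu ζ hζ y hy := h.eq_real τ u hu ζ hζ y (finDomain_mono hη hy)
  differentiableAt_param τ u hu ζ hζ z hz :=
    h.differentiableAt_param τ u hu ζ hζ z (finDomain_mono hη hz)
  differentiableOn τ u hu z hz := h.differentiableOn τ u hu z (finDomain_mono hη hz)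
  bound τ u hu z hz := h.bound τ u hu z (finDomain_mono hη hz)

open Classical in
/-- The kernel of the integral operator, transported to the reference surface and, in the second
variable, to a chart: `a(r_z(χ_τ(u)), r_z(x) - r_z(χ_τ(u)))` times the surface element. It is set to
zero on the diagonal. -/
def surfaceKernel {Γ : Set R3} {ι : Type*} (G : PatchDecomposition Γ ι) (φ₀ : R3 → R3)
    (φ : ℕ → R3 → R3) (K : ι → R2 → (ℕ → ℂ) → C3 → ℂ) (τ : ι) (z : ℕ → ℂ) (x : R3) (u : R2) : ℂ :=
  if x ∈ Γ ∧ u ∈ G.dom τ ∧ x ≠ G.chart τ u then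
    K τ u z (rComplex φ₀ φ z x - rComplex φ₀ φ z (G.chart τ u)) *
      jacobian φ₀ φ (G.dom τ) (G.chart τ) z u
  else 0

section Kernel

variable {Γ : Set R3} {ι : Type*} {G : PatchDecomposition Γ ι} {φ₀ : R3 → R3}
  {φ : ℕ → R3 → R3} {b : ℕ → ℝ} {c η C ν κ Λ B : ℝ} {a : ParamSpace → R3 → C3 → ℂ}
  {K : ι → R2 → (ℕ → ℂ) → C3 → ℂ} {τ : ι} {x : R3} {u : R2}

/-- The kernel depends on `z_j` both through the parameter and through the chord. Joint holomorphy
is Hartogs' theorem, as no bound on the kernel is available off the diagonal. -/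
theorem isBoundedSepHolomorphic_kernel (h : IsControlledFamily Γ φ₀ φ b c)
    (hG : ∀ τ, IsChart Γ (G.dom τ) (G.chart τ) κ Λ) (hC : 0 ≤ C) (hν : 0 ≤ ν)
    (hK : IsExtendedKernel G φ₀ φ b a K η C ν) (hη : 4 * η ≤ c) (hx : x ∈ Γ) (hu : u ∈ G.dom τ)
    (hne : x ≠ G.chart τ u) :
    IsBoundedSepHolomorphic b η (C * (c / 2) ^ (-ν) * singularWeight (G.dom τ) (G.chart τ) ν x u)
      fun z => K τ u z (rComplex φ₀ φ z x - rComplex φ₀ φ z (G.chart τ u)) := by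
  have hc := h.pos
  have hχu := (hG τ).mem u hu
  have hpos : 0 < ‖x - G.chart τ u‖ := norm_pos_iff.2 (sub_ne_zero.2 hne)
  refine ⟨fun z hz => ?_, fun z hz j hj => ?_⟩
  · obtain ⟨h1, h2⟩ := h.mem_kernelDomain hη hz.1 hx hχu hne
    refine (hK.bound τ u hu z hz x hx hne h1).trans ?_
    rw [div_eq_mul_inv, ← Real.rpow_neg (norm_nonneg _), mul_assoc]
    refine mul_le_mul_of_nonneg_left ?_ hC
    rw [singularWeight, NNReal.coe_rpow, coe_nnnorm, chartExt_of_mem hu,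
      ← Real.mul_rpow (by positivity) (norm_nonneg _)]
    exact Real.rpow_le_rpow_of_nonpos (by positivity) h2 (by linarith)
  · set ζ := rComplex φ₀ φ z x - rComplex φ₀ φ z (G.chart τ u)
    set v := complexify (φ j x - φ j (G.chart τ u))
    have hupd : ∀ w, rComplex φ₀ φ (Function.update z j w) x
        - rComplex φ₀ φ (Function.update z j w) (G.chart τ u) = ζ + (w - z j) • v := fun w =>
      h.rComplex_update_sub hz.1 hx hχu j w
    have hO : {w | Function.update z j w ∈ fullDomain b η} ∈ 𝓝 (z j) :=
      (isOpen_update_mem_fullDomain hz.1 hj).mem_nhds (by simpa using hz.1)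
    obtain ⟨R, hR, hRO⟩ := Metric.mem_nhds_iff.1 hO
    have hdom : ∀ s ∈ Metric.ball (z j) R, ζ + (s - z j) • v ∈ kernelDomain := fun s hs => by
      rw [← hupd]
      exact (h.mem_kernelDomain hη (hRO hs) hx hχu hne).1
    have hsep : SepHolomorphicOn
        (fun w s => K τ u (Function.update z j w) (ζ + (s - z j) • v))
        (Metric.ball (z j) R) (Metric.ball (z j) R) := by
      refine ⟨fun s hs w hw => ?_, fun w hw => ?_⟩
      · have h1 := hK.differentiableAt_param τ u hu _ (hdom s hs) _
          ((update_mem_finDomain_iff hz).2 (hRO hw)) j hj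
        simp only [Function.update_idem, Function.update_self] at h1
        exact h1.differentiableWithinAt
      · refine (hK.differentiableOn τ u hu _ ((update_mem_finDomain_iff hz).2 (hRO hw))).comp
          (f := fun s : ℂ => ζ + (s - z j) • v) ?_ hdom
        fun_prop
    simp only [hupd]
    exact hsep.differentiableAt_diag hR

theorem isBoundedSepHolomorphic_surfaceKernel (h : IsControlledFamily Γ φ₀ φ b c)
    (hG : ∀ τ, IsChart Γ (G.dom τ) (G.chart τ) κ Λ) (hC : 0 ≤ C) (hν : 0 ≤ ν)
    (hK : IsExtendedKernel G φ₀ φ b a K η C ν) (hη : 4 * η ≤ c) (hB : 0 ≤ B)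
    (hJ : ∀ τ u, IsBoundedSepHolomorphic b η B
      fun z => jacobian φ₀ φ (G.dom τ) (G.chart τ) z u) (τ : ι) (x : R3) (u : R2) :
    IsBoundedSepHolomorphic b η
      (C * (c / 2) ^ (-ν) * B * singularWeight (G.dom τ) (G.chart τ) ν x u)
      fun z => surfaceKernel G φ₀ φ K τ z x u := by
  have hc := h.pos
  by_cases hS : x ∈ Γ ∧ u ∈ G.dom τ ∧ x ≠ G.chart τ u
  · simp only [surfaceKernel, if_pos hS]
    rw [mul_right_comm]
    exact (isBoundedSepHolomorphic_kernel h hG hC hν hK hη hS.1 hS.2.1 hS.2.2).mul (hJ τ u)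
  · simp only [surfaceKernel, if_neg hS]
    refine ⟨fun z _ => ?_, fun z _ j _ => differentiableAt_const _⟩
    rw [norm_zero]
    positivity

theorem tendsto_spliceParam (y y' : ParamSpace) :
    Tendsto (spliceParam y y') atTop (𝓝 y') := by
  rw [tendsto_pi_nhds]
  intro j
  refine tendsto_const_nhds.congr' ?_
  filter_upwards [eventually_gt_atTop j] with N hN
  simp [spliceParam, hN]

theorem norm_surfaceKernel_sub_le (h : IsControlledFamily Γ φ₀ φ b c)
    (hG : ∀ τ, IsChart Γ (G.dom τ) (G.chart τ) κ Λ) (hC : 0 ≤ C) (hν : 0 ≤ ν) (hη0 : 0 < η)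
    (hK : IsExtendedKernel G φ₀ φ b a K (3 * η) C ν) (hη : 4 * (3 * η) ≤ c) (hB : 0 ≤ B)
    (hJ : ∀ τ u, IsBoundedSepHolomorphic b (3 * η) B
      fun z => jacobian φ₀ φ (G.dom τ) (G.chart τ) z u)
    (hcont : ∀ τ, ∀ u ∈ G.dom τ, ∀ ζ ∈ kernelDomain,
      Continuous fun y => a y (rReal φ₀ φ y (G.chart τ u)) ζ)
    (τ : ι) (x : R3) (u : R2) {y y' : ParamSpace} (hy : ∀ j, b j = 0 → (y j : ℝ) = 0)
    (hy' : ∀ j, b j = 0 → (y' j : ℝ) = 0) :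
    ‖surfaceKernel G φ₀ φ K τ y'.toComplex x u - surfaceKernel G φ₀ φ K τ y.toComplex x u‖
      ≤ 2 * (C * (c / 2) ^ (-ν) * B) / η * (∑' j, b j * |(y' j : ℝ) - y j|)
        * singularWeight (G.dom τ) (G.chart τ) ν x u := by
  have hc := h.pos
  have hs : ∀ N j, b j = 0 → (spliceParam y y' N j : ℝ) = 0 := fun N j hj => by
    unfold spliceParam; split_ifs; exacts [hy' j hj, hy j hj]
  have hlim : Tendsto (fun N => surfaceKernel G φ₀ φ K τ (spliceParam y y' N).toComplex x u) atTop
      (𝓝 (surfaceKernel G φ₀ φ K τ y'.toComplex x u)) := by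
    by_cases hS : x ∈ Γ ∧ u ∈ G.dom τ ∧ x ≠ G.chart τ u
    · simp only [surfaceKernel, if_pos hS]
      obtain ⟨hx, hu, hne⟩ := hS
      have hχu := (hG τ).mem u hu
      refine Tendsto.mul ?_ (((continuous_jacobian_toComplex h (hG τ) u).tendsto y').comp
        (tendsto_spliceParam y y'))
      have hv : ∀ j, ‖φ j x - φ j (G.chart τ u)‖ ≤ b j * ‖x - G.chart τ u‖ := fun j =>
        h.norm_sub_le j x hx _ hχu
      have hker := isBoundedSepHolomorphic_kernel h hG hC hν hK hη hx hu hne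
      have hser : IsBoundedSepHolomorphic b (3 * η)
          (C * (c / 2) ^ (-ν) * singularWeight (G.dom τ) (G.chart τ) ν x u)
          fun z => K τ u z (affineSeries (φ₀ x - φ₀ (G.chart τ u))
            (fun j => φ j x - φ j (G.chart τ u)) z) := by
        refine ⟨fun z hz => ?_, fun z hz j hj => ?_⟩
        · rw [← h.rComplex_sub hz.1 hx hχu]
          exact hker.bound z hz
        · refine (hker.differentiableAt z hz j hj).congr_of_eventuallyEq ?_
          filter_upwards [(isOpen_update_mem_fullDomain (η' := 3 * η) hz.1 hj).mem_nhds
            (by simpa using hz.1)] with w hw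
          rw [h.rComplex_sub hw hx hχu]
      have := tendsto_of_continuous_of_fixed h.nonneg h.summable hη0 (by positivity) hv
        (F := K τ u) hser (fun y₀ hy₀ => ?_) hy hy'
      · have hmem : ∀ y : ParamSpace, (∀ j, b j = 0 → (y j : ℝ) = 0) →
            y.toComplex ∈ fullDomain b η := fun y hy => (toComplex_mem_finDomain hη0 hy).1
        simp_rw [h.rComplex_sub (hmem _ (hs _)) hx hχu, h.rComplex_sub (hmem _ hy') hx hχu]
        exact this
      · have hy₀mem := toComplex_mem_finDomain (η := 3 * η) (by positivity) hy₀
        have hζ := (h.mem_kernelDomain hη hy₀mem.1 hx hχu hne).1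
        rw [h.rComplex_sub hy₀mem.1 hx hχu] at hζ
        exact ⟨_, hcont τ u hu _ hζ, fun y hy => hK.eq_real τ u hu _ hζ y
          (toComplex_mem_finDomain (by positivity) hy)⟩
    · simp only [surfaceKernel, if_neg hS]
      exact tendsto_const_nhds
  have := (isBoundedSepHolomorphic_surfaceKernel h hG hC hν hK hη hB hJ τ x
    u).norm_toComplex_sub_le h.nonneg h.summable hη0 (by positivity) hy hy' hlim
  refine this.trans (le_of_eq ?_)
  ring

/-- Measurability of the extended kernel in the surface variable, one nonreal coordinate at a
time. -/
theorem measurable_extendedKernel (h : IsControlledFamily Γ φ₀ φ b c)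
    (hG : ∀ τ, IsChart Γ (G.dom τ) (G.chart τ) κ Λ) (hK : IsExtendedKernel G φ₀ φ b a K η C ν)
    (ha : ∀ y, Measurable (Function.uncurry (a y))) (τ : ι) {ζ : C3} (hζ : ζ ∈ kernelDomain)
    {z : ℕ → ℂ} (hz : z ∈ finDomain b η) : Measurable fun u : G.dom τ => K τ u z ζ := by
  have key : ∀ (S : Finset ℕ) (z : ℕ → ℂ), z ∈ finDomain b η → (∀ j ∉ S, z j ∈ realInterval) →
      Measurable fun u : G.dom τ => K τ u z ζ := by
    intro S
    induction S using Finset.induction_on with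
    | empty =>
      intro z hz hS
      obtain ⟨y, rfl⟩ := exists_toComplex_eq fun j => hS j (Finset.notMem_empty j)
      have h1 : (fun u : G.dom τ => K τ u y.toComplex ζ)
          = fun u : G.dom τ => a y (rReal φ₀ φ y (G.chart τ u)) ζ :=
        funext fun u => hK.eq_real τ u u.2 ζ hζ y hz
      rw [h1]
      obtain ⟨L, hL⟩ := h.exists_lipschitzOnWith_rReal
      have h2 : Measurable fun u : G.dom τ => rReal φ₀ φ y (G.chart τ u) :=
        ((hL y).continuousOn.comp (hG τ).continuousOn (hG τ).mem).domRestrict.measurable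
      exact (ha y).comp (h2.prodMk measurable_const)
    | insert j S _ ih =>
      intro z hz hS
      by_cases hjr : z j ∈ realInterval
      · refine ih z hz fun i hi => ?_
        by_cases hij : i = j
        · rwa [hij]
        · exact hS i (by simp [hij, hi])
      have hj : b j ≠ 0 := fun hj => hjr (by rw [hz.1.1 j hj]; exact zero_mem_realInterval)
      have hbj : 0 < b j := lt_of_le_of_ne (h.nonneg j) hj.symm
      set O : Set ℂ := {w | Function.update z j w ∈ fullDomain b η}
      have hO : IsOpen O := isOpen_update_mem_fullDomain hz.1 hj
      have hOiff : ∀ w, w ∈ O ↔ ∑' i, b i * gap (z i) + b j * (gap w - gap (z j)) < η := fun w =>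
        update_mem_fullDomain_iff hz.1 hj w
      have hI : realInterval ⊆ O := fun t ht => by
        rw [hOiff, gap_of_mem ht]
        nlinarith [hz.1.2.2, gap_nonneg (z j)]
      set r : ℝ := gap (z j) + (η - ∑' i, b i * gap (z i)) / b j with hr
      have hθ : 0 < (η - ∑' i, b i * gap (z i)) / b j := div_pos (by linarith [hz.1.2.2]) hbj
      have hball : Metric.ball ((nearest (z j) : ℝ) : ℂ) r ⊆ O := fun w hw => by
        rw [Metric.mem_ball, dist_eq_norm] at hw
        have h1 := gap_le_add w ((nearest (z j) : ℝ) : ℂ)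
        rw [gap_of_mem (nearest_mem _), zero_add] at h1
        rw [hOiff]
        have h2 : gap w - gap (z j) < (η - ∑' i, b i * gap (z i)) / b j := by linarith
        rw [lt_div_iff₀ hbj] at h2
        linarith
      have hres := measurable_of_measurable_realInterval
        (F := fun (u : G.dom τ) w => K τ u (Function.update z j w) ζ) hO hI (fun u w hw => ?_)
        (fun t ht => ?_) (nearest_mem (z j)) hball (w := z j) ?_
      · simpa using hres
      · have h1 := hK.differentiableAt_param τ u u.2 ζ hζ _
          ((update_mem_finDomain_iff hz).2 hw) j hj
        simp only [Function.update_idem, Function.update_self] at h1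
        exact h1.differentiableWithinAt
      · refine ih _ ((update_mem_finDomain_iff hz).2 (hI ht)) fun i hi => ?_
        by_cases hij : i = j
        · subst hij; simpa using ht
        · simpa [hij] using hS i (by simp [hij, hi])
      · rw [Metric.mem_ball, dist_eq_norm, norm_sub_nearest]
        linarith
  exact key hz.2.toFinset z hz fun j hj => by simpa using hj

theorem measurable_surfaceKernel [Finite ι] (h : IsControlledFamily Γ φ₀ φ b c)
    (hG : ∀ τ, IsChart Γ (G.dom τ) (G.chart τ) κ Λ) (hK : IsExtendedKernel G φ₀ φ b a K η C ν)
    (hη : 4 * η ≤ c) (ha : ∀ y, Measurable (Function.uncurry (a y))) (τ : ι)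
    {z : ℕ → ℂ} (hz : z ∈ finDomain b η) :
    Measurable (Function.uncurry (surfaceKernel G φ₀ φ K τ z)) := by
  have hjoint : Measurable (Function.uncurry
      fun (ζ : kernelDomain) (u : G.dom τ) => K τ u z ζ) :=
    measurable_uncurry_of_continuous_of_measurable
      (fun u => (hK.differentiableOn τ u u.2 z hz).continuousOn.domRestrict)
      fun ζ => measurable_extendedKernel h hG hK ha τ ζ.2 hz
  obtain ⟨L, hL⟩ := h.lipschitz_zero
  have hr : Measurable fun x : Γ => rComplex φ₀ φ z x :=
    measurable_affineSeries (b := b) (S := fun _ => 1) hL.continuousOn.domRestrict.measurable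
      (fun j => (h.continuousOn j).domRestrict.measurable) (h.summable_norm hz.1)
      fun j x => by simpa using h.norm_le j x x.2
  set S : Set (R3 × R2) := {q | q.1 ∈ Γ ∧ q.2 ∈ G.dom τ ∧ q.1 ≠ G.chart τ q.2} with hSdef
  have hSeq : S = (Γ ×ˢ G.dom τ) ∩ {q | q.1 = chartExt (G.dom τ) (G.chart τ) q.2}ᶜ := by
    ext q
    simp only [hSdef, mem_ofPred_eq, mem_inter_iff, mem_prod, mem_compl_iff, and_assoc]
    refine and_congr_right fun _ => and_congr_right fun hq => ?_
    rw [chartExt_of_mem hq]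
  have hS : MeasurableSet S := by
    rw [hSeq]
    exact (G.isClosed.measurableSet.prod (G.isOpen_dom τ).measurableSet).inter
      (measurableSet_eq_fun measurable_fst
        ((hG τ).measurable_chartExt.comp measurable_snd)).compl
  refine measurable_of_restrict_of_restrict_compl hS ?_ ?_
  · have hx : Measurable fun q : S => (⟨q.1.1, q.2.1⟩ : Γ) :=
      (measurable_fst.comp measurable_subtype_coe).subtype_mk
    have hu : Measurable fun q : S => (⟨q.1.2, q.2.2.1⟩ : G.dom τ) :=
      (measurable_snd.comp measurable_subtype_coe).subtype_mk
    have hχ : Measurable fun u : G.dom τ => (⟨G.chart τ u, (hG τ).mem u u.2⟩ : Γ) :=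
      ((hG τ).continuousOn.domRestrict.measurable).subtype_mk
    have hζ : Measurable fun q : S => (⟨rComplex φ₀ φ z q.1.1 - rComplex φ₀ φ z (G.chart τ q.1.2),
        (h.mem_kernelDomain hη hz.1 q.2.1 ((hG τ).mem _ q.2.2.1) q.2.2.2).1⟩ : kernelDomain) :=
      ((hr.comp hx).sub (hr.comp (hχ.comp hu))).subtype_mk
    have hres : S.domRestrict (Function.uncurry (surfaceKernel G φ₀ φ K τ z)) = fun q : S =>
        K τ q.1.2 z (rComplex φ₀ φ z q.1.1 - rComplex φ₀ φ z (G.chart τ q.1.2)) *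
          jacobian φ₀ φ (G.dom τ) (G.chart τ) z q.1.2 :=
      funext fun q => if_pos q.2
    rw [hres]
    exact (hjoint.comp (hζ.prodMk hu)).mul ((measurable_jacobian h (hG τ) hz.1).comp
      (measurable_snd.comp measurable_subtype_coe))
  · have hres : Sᶜ.domRestrict (Function.uncurry (surfaceKernel G φ₀ φ K τ z)) = fun _ => 0 :=
      funext fun q => if_neg q.2
    rw [hres]
    exact measurable_const

end Kernel

/-! ### The transported operator -/

section PulledBack

theorem boundedOperator_spec {μ m : Measure R3} {F : (R3 → ℂ) → R3 → ℂ}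
    (h : boundedOperator μ m F ≠ 0) (f : Lp ℂ 2 μ) : boundedOperator μ m F f =ᵐ[m] F f := by
  unfold boundedOperator at h ⊢
  split_ifs at h ⊢ with h'
  · exact h'.choose_spec f
  · exact absurd rfl h

variable {Γ : Set R3} {ι : Type*} [Fintype ι] {G : PatchDecomposition Γ ι} {κ Λ : ℝ} {r : R3 → R3}

/-- A property that holds almost everywhere on `r(Γ)` holds almost everywhere on `Γ` after
composition with `r`. -/
theorem ae_comp_of_ae_surfaceMeasure (hG : ∀ τ, IsChart Γ (G.dom τ) (G.chart τ) κ Λ)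
    (hr : ContinuousOn r Γ) (hpos : ∀ τ, ∀ᵐ u ∂volume.restrict (G.dom τ),
      0 < gramDet (r ∘ G.chart τ) u) {P : R3 → Prop} (hP : ∀ᵐ x ∂surfaceMeasure G r, P x) :
    ∀ᵐ x ∂refMeasure G, P (r x) := by
  classical
  -- restrict to a measurable subset of `P` and to the measurable modification of `r` off `Γ`
  obtain ⟨N, hNP, hN, hN0⟩ := exists_measurable_superset_of_null (ae_iff.1 hP)
  have hr' : Measurable (Γ.indicator r) := by
    have := hr.measurable_piecewise (g := (0 : R3 → R3)) continuousOn_const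
      G.isClosed.measurableSet
    rwa [piecewise_eq_indicator] at this
  have hPN : ∀ᵐ x ∂surfaceMeasure G r, x ∉ N := by rw [ae_iff]; simpa using hN0
  have h1 : ∀ᵐ x ∂refMeasure G, Γ.indicator r x ∉ N := by
    refine ae_surfaceMeasure_of_ae hG continuousOn_id (hr' hN.compl) fun τ => ?_
    filter_upwards [ae_comp_chart_of_ae hG hr hpos hPN τ,
      ae_restrict_mem (G.isOpen_dom τ).measurableSet] with u hu huD
    rwa [id, indicator_of_mem ((hG τ).mem u huD)]
  filter_upwards [h1, ae_mem_of_refMeasure hG] with x hx hxΓ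
  rw [indicator_of_mem hxΓ] at hx
  by_contra hcon
  exact hx (hNP hcon)

theorem integral_surfaceMeasure (hG : ∀ τ, IsChart Γ (G.dom τ) (G.chart τ) κ Λ)
    (hr : ContinuousOn r Γ) {F : R3 → ℂ} (hF : Measurable F)
    (hint : ∀ τ, Integrable (fun u => (√(gramDet (r ∘ G.chart τ) u) : ℂ) * F (r (G.chart τ u)))
      (volume.restrict (G.dom τ))) :
    ∫ x, F x ∂surfaceMeasure G r = ∑ τ, ∫ u in G.dom τ,
      (√(gramDet (r ∘ G.chart τ) u) : ℂ) * F (r (G.chart τ u)) := by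
  have hdens : ∀ τ u, ((ENNReal.ofReal (√(gramDet (r ∘ G.chart τ) u))).toReal)
      • F ((r ∘ G.chart τ) u) = (√(gramDet (r ∘ G.chart τ) u) : ℂ) * F (r (G.chart τ u)) := by
    intro τ u
    rw [ENNReal.toReal_ofReal (Real.sqrt_nonneg _), Complex.real_smul]
    rfl
  unfold surfaceMeasure
  rw [integral_finsetSum_measure]
  · refine Finset.sum_congr rfl fun τ _ => ?_
    rw [integral_map (aemeasurable_comp_chart' hG hr τ) hF.aestronglyMeasurable,
      integral_withDensity_eq_integral_toReal_smul (measurable_surfaceDensity _)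
        (ae_of_all _ fun _ => ENNReal.ofReal_lt_top)]
    simp_rw [hdens]
  · intro τ _
    rw [integrable_map_measure hF.aestronglyMeasurable (aemeasurable_comp_chart' hG hr τ),
      integrable_withDensity_iff_integrable_smul' (measurable_surfaceDensity _)
        (ae_of_all _ fun _ => ENNReal.ofReal_lt_top)]
    refine (hint τ).congr (ae_of_all _ fun u => ?_)
    exact (hdens τ u).symm

/-- If the transported operator is invertible, it is the integral operator with the transported
kernel. Invertibility guarantees that the operators entering its definition are the intended ones:
a bounded operator that does not exist is zero by convention. -/
theorem pulledBackOperator_eq [Nontrivial (Lp ℂ 2 (refMeasure G))]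
    (hG : ∀ τ, IsChart Γ (G.dom τ) (G.chart τ) κ Λ) (hr : ContinuousOn r Γ)
    (hpos : ∀ τ, ∀ᵐ u ∂volume.restrict (G.dom τ), 0 < gramDet (r ∘ G.chart τ) u)
    {c : ℂ} {a : R3 → C3 → ℂ} (ha : Measurable (Function.uncurry a)) {k : ι → R3 → R2 → ℂ}
    {T : ∀ τ, Lp ℂ 2 (volume.restrict (G.dom τ)) →L[ℂ] Lp ℂ 2 (refMeasure G)}
    (hT : ∀ τ, IsKernelOp (k τ) (T τ))
    (hint : ∀ τ (f : Lp ℂ 2 (volume.restrict (G.dom τ))), ∀ᵐ x ∂refMeasure G,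
      Integrable (fun u => k τ x u * f u) (volume.restrict (G.dom τ)))
    {S : ∀ τ, Lp ℂ 2 (refMeasure G) →L[ℂ] Lp ℂ 2 (volume.restrict (G.dom τ))}
    (hS : ∀ τ (f : Lp ℂ 2 (refMeasure G)),
      S τ f =ᵐ[volume.restrict (G.dom τ)] fun u => f (G.chart τ u))
    (hk : ∀ τ, ∀ᵐ x ∂refMeasure G, ∀ᵐ u ∂volume.restrict (G.dom τ), k τ x u
      = a (r (G.chart τ u)) (complexify (r x - r (G.chart τ u)))
        * (√(gramDet (r ∘ G.chart τ) u) : ℂ))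
    (hinv : (pulledBackOperator G c a r).IsInvertible) :
    pulledBackOperator G c a r = c • 1 + ∑ τ, T τ ∘L S τ := by
  have hne : pulledBackOperator G c a r ≠ 0 := by
    intro h0
    rw [h0, ContinuousLinearMap.isInvertible_zero_iff] at hinv
    exact not_subsingleton _ hinv.1
  set P := pullback G r with hPdef
  set A := boundaryOperator c a (surfaceMeasure G r) with hAdef
  have hop : pulledBackOperator G c a r = P ∘L A ∘L P.inverse := rfl
  have hP0 : P ≠ 0 := fun h0 => hne (by rw [hop, h0, ContinuousLinearMap.zero_comp])
  have hA0 : A ≠ 0 := fun h0 => hne (by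
    rw [hop, h0, ContinuousLinearMap.zero_comp, ContinuousLinearMap.comp_zero])
  have hPinv : P.IsInvertible := by
    by_contra hcon
    refine hne ?_
    rw [hop, ContinuousLinearMap.inverse_of_not_isInvertible hcon, ContinuousLinearMap.comp_zero,
      ContinuousLinearMap.comp_zero]
  have hPspec : ∀ g, P g =ᵐ[refMeasure G] g ∘ r := fun g => boundedOperator_spec hP0 g
  have hAspec : ∀ g : Lp ℂ 2 (surfaceMeasure G r), A g =ᵐ[surfaceMeasure G r] fun x =>
      c * g x + ∫ x', a x' (complexify (x - x')) * g x' ∂surfaceMeasure G r := fun g =>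
    boundedOperator_spec hA0 g
  have hposid : ∀ τ, ∀ᵐ u ∂volume.restrict (G.dom τ), 0 < gramDet (id ∘ G.chart τ) u := fun τ => by
    have hκ := (hG τ).pos
    filter_upwards [le_gramDet_chart hG τ] with u hu
    exact lt_of_lt_of_le (by positivity) hu
  ext1 f
  set g := P.inverse f with hg
  have hfg : f =ᵐ[refMeasure G] g ∘ r := by
    have h1 := hPspec g
    rwa [hg, hPinv.self_apply_inverse] at h1
  have hLHS : pulledBackOperator G c a r f =ᵐ[refMeasure G] fun x =>
      c * g (r x) + ∫ x', a x' (complexify (r x - x')) * g x' ∂surfaceMeasure G r :=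
    (hPspec (A g)).trans (ae_comp_of_ae_surfaceMeasure hG hr hpos (hAspec g))
  have hRHS : ((c • 1 + ∑ τ, T τ ∘L S τ : Lp ℂ 2 (refMeasure G) →L[ℂ] Lp ℂ 2 (refMeasure G)) f)
      =ᵐ[refMeasure G] fun x => c * f x + ∑ τ, ∫ u in G.dom τ, k τ x u * S τ f u := by
    have e : (c • 1 + ∑ τ, T τ ∘L S τ : Lp ℂ 2 (refMeasure G) →L[ℂ] Lp ℂ 2 (refMeasure G)) f
        = c • f + ∑ τ, T τ (S τ f) := by
      simp
    rw [e]
    have hTS : ∀ᵐ x ∂refMeasure G, ∀ τ, T τ (S τ f) x = ∫ u in G.dom τ, k τ x u * S τ f u :=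
      ae_all_iff.2 fun τ => hT τ (S τ f)
    have hsum : (∑ τ, T τ (S τ f) : Lp ℂ 2 (refMeasure G)) =ᵐ[refMeasure G]
        fun x => ∑ τ, T τ (S τ f) x := by
      refine (Lp.coeFn_finsetSum _ _).trans (Eventually.of_forall fun x => ?_)
      simp
    filter_upwards [Lp.coeFn_add (c • f) (∑ τ, T τ (S τ f)), Lp.coeFn_smul c f, hsum, hTS]
      with x h1 h2 h3 h4
    rw [h1, Pi.add_apply, h2, Pi.smul_apply, h3, smul_eq_mul]
    simp_rw [h4]
  have hkall : ∀ᵐ x ∂refMeasure G, ∀ τ, ∀ᵐ u ∂volume.restrict (G.dom τ), k τ x u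
      = a (r (G.chart τ u)) (complexify (r x - r (G.chart τ u)))
        * (√(gramDet (r ∘ G.chart τ) u) : ℂ) := ae_all_iff.2 hk
  have hintall : ∀ᵐ x ∂refMeasure G, ∀ τ, Integrable (fun u => k τ x u * S τ f u)
      (volume.restrict (G.dom τ)) := ae_all_iff.2 fun τ => hint τ (S τ f)
  ext1
  refine hLHS.trans (EventuallyEq.trans ?_ hRHS.symm)
  filter_upwards [hfg, hkall, hintall] with x h1 h2 h3
  rw [h1, Function.comp_apply]
  congr 1
  have hcongr : ∀ τ, (fun u => k τ x u * S τ f u) =ᵐ[volume.restrict (G.dom τ)] fun u =>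
      (√(gramDet (r ∘ G.chart τ) u) : ℂ) * (a (r (G.chart τ u))
        (complexify (r x - r (G.chart τ u))) * g (r (G.chart τ u))) := fun τ => by
    filter_upwards [h2 τ, hS τ f, ae_comp_chart_of_ae hG continuousOn_id hposid hfg τ]
      with u h4 h5 h6
    rw [h4, h5]
    have h7 : f (G.chart τ u) = g (r (G.chart τ u)) := h6
    rw [h7]; ring
  have hF : Measurable fun x' => a x' (complexify (r x - x')) * g x' := by
    refine Measurable.mul ?_ (Lp.stronglyMeasurable g).measurable
    exact ha.comp (measurable_id.prodMk
      (continuous_complexify.measurable.comp (measurable_const.sub measurable_id)))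
  rw [integral_surfaceMeasure hG hr hF fun τ => (h3 τ).congr (hcongr τ)]
  exact Finset.sum_congr rfl fun τ _ => (integral_congr_ae (hcongr τ)).symm

end PulledBack

/-! ### Holomorphy of the transported operators -/

section Assembly

variable {Γ : Set R3} {ι : Type*} [Fintype ι] {G : PatchDecomposition Γ ι} {φ₀ : R3 → R3}
  {φ : ℕ → R3 → R3} {b : ℕ → ℝ} {c η C ν κ Λ B : ℝ} {a : ParamSpace → R3 → C3 → ℂ}
  {K : ι → R2 → (ℕ → ℂ) → C3 → ℂ}

open Classical in
/-- The integral operator with kernel `surfaceKernel` over one chart (zero if it does not exist). -/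
def chartOperator (G : PatchDecomposition Γ ι) (φ₀ : R3 → R3) (φ : ℕ → R3 → R3)
    (K : ι → R2 → (ℕ → ℂ) → C3 → ℂ) (τ : ι) (z : ℕ → ℂ) :
    Lp ℂ 2 (volume.restrict (G.dom τ)) →L[ℂ] Lp ℂ 2 (refMeasure G) :=
  if h : ∃ T : Lp ℂ 2 (volume.restrict (G.dom τ)) →L[ℂ] Lp ℂ 2 (refMeasure G),
    IsKernelOp (surfaceKernel G φ₀ φ K τ z) T then h.choose else 0

/-- Everything that the construction of the operators requires of the extended kernel and of the
surface element, on a common neighbourhood of the parameter space. -/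
structure IsKernelSetup (G : PatchDecomposition Γ ι) (φ₀ : R3 → R3) (φ : ℕ → R3 → R3)
    (b : ℕ → ℝ) (a : ParamSpace → R3 → C3 → ℂ) (K : ι → R2 → (ℕ → ℂ) → C3 → ℂ)
    (c κ Λ η C ν B : ℝ) (A : ℝ≥0) : Prop where
  controlled : IsControlledFamily Γ φ₀ φ b c
  chart : ∀ τ, IsChart Γ (G.dom τ) (G.chart τ) κ Λ
  pos : 0 < η
  le : 4 * (3 * η) ≤ c
  kernel : IsExtendedKernel G φ₀ φ b a K (3 * η) C ν
  const_nonneg : 0 ≤ C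
  exponent_nonneg : 0 ≤ ν
  bound_nonneg : 0 ≤ B
  jacobian : ∀ τ u, IsBoundedSepHolomorphic b (3 * η) B
    fun z => jacobian φ₀ φ (G.dom τ) (G.chart τ) z u
  measurable : ∀ y, Measurable (Function.uncurry (a y))
  continuous : ∀ τ, ∀ u ∈ G.dom τ, ∀ ζ ∈ kernelDomain,
    Continuous fun y => a y (rReal φ₀ φ y (G.chart τ u)) ζ
  weight : ∀ τ, IsSchurWeight (refMeasure G) (volume.restrict (G.dom τ))
    (singularWeight (G.dom τ) (G.chart τ) ν) A

variable {A : ℝ≥0} (h : IsKernelSetup G φ₀ φ b a K c κ Λ η C ν B A)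
include h

theorem IsKernelSetup.constant_nonneg : 0 ≤ C * (c / 2) ^ (-ν) * B := by
  have := h.controlled.pos
  have := h.const_nonneg
  have := h.bound_nonneg
  positivity

theorem IsKernelSetup.surfaceKernel_holomorphic (τ : ι) (x : R3) (u : R2) :
    IsBoundedSepHolomorphic b (3 * η)
      (C * (c / 2) ^ (-ν) * B * singularWeight (G.dom τ) (G.chart τ) ν x u)
      fun z => surfaceKernel G φ₀ φ K τ z x u :=
  isBoundedSepHolomorphic_surfaceKernel h.controlled h.chart h.const_nonneg h.exponent_nonneg
    h.kernel h.le h.bound_nonneg h.jacobian τ x u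

theorem IsKernelSetup.surfaceKernel_measurable (τ : ι) {z : ℕ → ℂ} (hz : z ∈ finDomain b (3 * η)) :
    Measurable (Function.uncurry (surfaceKernel G φ₀ φ K τ z)) :=
  measurable_surfaceKernel h.controlled h.chart h.kernel h.le h.measurable τ hz

theorem IsKernelSetup.isKernelOp_chartOperator (τ : ι) {z : ℕ → ℂ}
    (hz : z ∈ finDomain b (3 * η)) :
    IsKernelOp (surfaceKernel G φ₀ φ K τ z) (chartOperator G φ₀ φ K τ z) := by
  have hex := (h.weight τ).exists_isKernelOp (h.surfaceKernel_measurable τ hz) h.constant_nonneg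
    fun x u => (h.surfaceKernel_holomorphic τ x u).bound z hz
  rw [chartOperator, dif_pos hex]
  exact hex.choose_spec

theorem IsKernelSetup.isBoundedSepHolomorphic_chartOperator (τ : ι) :
    IsBoundedSepHolomorphic b (3 * η) (C * (c / 2) ^ (-ν) * B * A)
      (chartOperator G φ₀ φ K τ) := by
  refine ⟨fun z hz => (h.isKernelOp_chartOperator τ hz).norm_le (h.weight τ) h.constant_nonneg
    fun x u => (h.surfaceKernel_holomorphic τ x u).bound z hz, fun z hz j hj => ?_⟩
  have hO : {w | Function.update z j w ∈ fullDomain b (3 * η)} ∈ 𝓝 (z j) :=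
    (isOpen_update_mem_fullDomain hz.1 hj).mem_nhds (by simpa using hz.1)
  obtain ⟨R, hR, hRO⟩ := Metric.mem_nhds_iff.1 hO
  have hmem : ∀ w ∈ Metric.ball (z j) R, Function.update z j w ∈ finDomain b (3 * η) :=
    fun w hw => (update_mem_finDomain_iff hz).2 (hRO hw)
  exact differentiableAt_of_isKernelOp (h.weight τ)
    (k := fun w => surfaceKernel G φ₀ φ K τ (Function.update z j w)) hR h.constant_nonneg
    (fun w hw => h.surfaceKernel_measurable τ (hmem w hw))
    (fun w hw x u => (h.surfaceKernel_holomorphic τ x u).bound _ (hmem w hw))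
    (fun x u => ((h.surfaceKernel_holomorphic τ x u).differentiableOn_update hz hj).mono hRO)
    fun w hw => h.isKernelOp_chartOperator τ (hmem w hw)

theorem IsKernelSetup.norm_chartOperator_sub_le (τ : ι) {y y' : ParamSpace}
    (hy : ∀ j, b j = 0 → (y j : ℝ) = 0) (hy' : ∀ j, b j = 0 → (y' j : ℝ) = 0) :
    ‖chartOperator G φ₀ φ K τ y'.toComplex - chartOperator G φ₀ φ K τ y.toComplex‖
      ≤ 2 * (C * (c / 2) ^ (-ν) * B) / η * (∑' j, b j * |(y' j : ℝ) - y j|) * A := by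
  have hη := h.pos
  have hC := h.constant_nonneg
  have hη3 : 0 < 3 * η := by positivity
  have hz := toComplex_mem_finDomain hη3 hy
  have hz' := toComplex_mem_finDomain hη3 hy'
  have hsum : 0 ≤ ∑' j, b j * |(y' j : ℝ) - y j| :=
    tsum_nonneg fun j => mul_nonneg (h.controlled.nonneg j) (abs_nonneg _)
  exact ((h.isKernelOp_chartOperator τ hz').sub (h.weight τ) (h.surfaceKernel_measurable τ hz')
    (h.surfaceKernel_measurable τ hz) hC
    (fun x u => (h.surfaceKernel_holomorphic τ x u).bound _ hz') hC
    (fun x u => (h.surfaceKernel_holomorphic τ x u).bound _ hz)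
    (h.isKernelOp_chartOperator τ hz)).norm_le (h.weight τ) (by positivity) fun x u =>
      norm_surfaceKernel_sub_le h.controlled h.chart h.const_nonneg h.exponent_nonneg hη h.kernel
        h.le h.bound_nonneg h.jacobian h.continuous τ x u hy hy'

theorem IsKernelSetup.pos_gramDet (y : ParamSpace) (τ : ι) :
    ∀ᵐ u ∂volume.restrict (G.dom τ), 0 < gramDet (rReal φ₀ φ y ∘ G.chart τ) u := by
  filter_upwards [ae_mem_goodSet h.controlled (h.chart τ)] with u hu
  have := mul_pos h.controlled.pos (h.chart τ).pos
  exact lt_of_lt_of_le (by positivity) (le_gramDet_rReal_comp h.controlled (h.chart τ) hu y)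

/-- On real parameters, `surfaceKernel` is the kernel of the transported operator. -/
theorem IsKernelSetup.surfaceKernel_restrictReal
    (happly : ∀ τ, ∀ u ∈ G.dom τ, ∀ ζ ∈ kernelDomain, ∀ y,
      a (restrictReal b y) (rReal φ₀ φ (restrictReal b y) (G.chart τ u)) ζ
        = a y (rReal φ₀ φ y (G.chart τ u)) ζ) (y : ParamSpace) (τ : ι) :
    ∀ᵐ x ∂refMeasure G, ∀ᵐ u ∂volume.restrict (G.dom τ),
      surfaceKernel G φ₀ φ K τ (restrictReal b y).toComplex x u
        = a y (rReal φ₀ φ y (G.chart τ u))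
            (complexify (rReal φ₀ φ y x - rReal φ₀ φ y (G.chart τ u)))
          * (√(gramDet (rReal φ₀ φ y ∘ G.chart τ) u) : ℂ) := by
  have hη := h.pos
  filter_upwards [ae_mem_of_refMeasure h.chart] with x hx
  have hoff : ∀ᵐ u ∂volume.restrict (G.dom τ), u ∉ {u | u ∈ G.dom τ ∧ x = G.chart τ u} := by
    refine measure_eq_zero_iff_ae_notMem.1 (Set.Subsingleton.measure_zero ?_ _)
    rintro u ⟨hu, hxu⟩ u' ⟨hu', hxu'⟩
    have h1 := (h.chart τ).le_norm_sub u hu u' hu'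
    rw [← hxu, ← hxu', sub_self, norm_zero] at h1
    have h2 := (h.chart τ).pos
    rw [← sub_eq_zero, ← norm_le_zero_iff]
    exact le_of_not_gt fun hcon => by nlinarith
  filter_upwards [ae_mem_goodSet h.controlled (h.chart τ), hoff] with u hu hne
  have huD := hu.1
  have hχu := (h.chart τ).mem u huD
  have hxu : x ≠ G.chart τ u := fun hcon => hne ⟨huD, hcon⟩
  set y₀ := restrictReal b y with hy₀
  have hmem : y₀.toComplex ∈ finDomain b (3 * η) :=
    toComplex_mem_finDomain (by positivity) fun j hj => by simp [hy₀, restrictReal, hj]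
  have hchord : rComplex φ₀ φ y₀.toComplex x - rComplex φ₀ φ y₀.toComplex (G.chart τ u)
      = complexify (rReal φ₀ φ y x - rReal φ₀ φ y (G.chart τ u)) := by
    rw [rComplex_toComplex, rComplex_toComplex, ← complexify_sub,
      h.controlled.rReal_restrictReal hx, h.controlled.rReal_restrictReal hχu]
  have hζ := (h.controlled.mem_kernelDomain h.le hmem.1 hx hχu hxu).1
  have hgram : gramDet (rReal φ₀ φ y₀ ∘ G.chart τ) u = gramDet (rReal φ₀ φ y ∘ G.chart τ) u := by
    have hev : rReal φ₀ φ y₀ ∘ G.chart τ =ᶠ[𝓝 u] rReal φ₀ φ y ∘ G.chart τ := by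
      filter_upwards [(G.isOpen_dom τ).mem_nhds huD] with v hv
      exact h.controlled.rReal_restrictReal ((h.chart τ).mem v hv) y
    rw [gramDet, gramDet, hev.fderiv_eq]
  rw [surfaceKernel, if_pos ⟨hx, huD, hxu⟩, h.kernel.eq_real τ u huD _ hζ y₀ hmem,
    happly τ u huD _ hζ, hchord, jacobian_toComplex h.controlled (h.chart τ) hu, hgram]

/-- The transported operators are the values, at the real parameters, of a bounded separately
holomorphic operator family, and depend on the real parameters in a Lipschitz continuous way. -/
theorem IsKernelSetup.exists_family [Nontrivial (Lp ℂ 2 (refMeasure G))]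
    (happly : ∀ τ, ∀ u ∈ G.dom τ, ∀ ζ ∈ kernelDomain, ∀ y,
      a (restrictReal b y) (rReal φ₀ φ (restrictReal b y) (G.chart τ u)) ζ
        = a y (rReal φ₀ φ y (G.chart τ u)) ζ) {c₀ : ℂ}
    (hinv : ∀ y, (pulledBackOperator G c₀ (a y) (rReal φ₀ φ y)).IsInvertible) :
    ∃ (H : (ℕ → ℂ) → Lp ℂ 2 (refMeasure G) →L[ℂ] Lp ℂ 2 (refMeasure G)) (M L : ℝ),
      IsBoundedSepHolomorphic b (3 * η) M H ∧
      (∀ y, pulledBackOperator G c₀ (a y) (rReal φ₀ φ y) = H (restrictSupport b y.toComplex)) ∧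
      ∀ y y', ‖pulledBackOperator G c₀ (a y) (rReal φ₀ φ y)
        - pulledBackOperator G c₀ (a y') (rReal φ₀ φ y')‖
          ≤ L * ∑' j, b j * |(y j : ℝ) - y' j| := by
  have hη := h.pos
  have hC := h.constant_nonneg
  choose S hS using exists_compChart h.chart
  set H : (ℕ → ℂ) → Lp ℂ 2 (refMeasure G) →L[ℂ] Lp ℂ 2 (refMeasure G) :=
    fun z => c₀ • 1 + ∑ τ, chartOperator G φ₀ φ K τ z ∘L S τ with hH
  have hsupp : ∀ y j, b j = 0 → (restrictReal b y j : ℝ) = 0 := fun y j hj => by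
    simp [restrictReal, hj]
  have heq : ∀ y, pulledBackOperator G c₀ (a y) (rReal φ₀ φ y)
      = H (restrictReal b y).toComplex := fun y => by
    have hmem : (restrictReal b y).toComplex ∈ finDomain b (3 * η) :=
      toComplex_mem_finDomain (by positivity) (hsupp y)
    obtain ⟨L, hL⟩ := h.controlled.exists_lipschitzOnWith_rReal
    exact pulledBackOperator_eq h.chart (hL y).continuousOn (h.pos_gramDet y) (h.measurable y)
      (fun τ => h.isKernelOp_chartOperator τ hmem)
      (fun τ f => (h.weight τ).ae_integrable (h.surfaceKernel_measurable τ hmem) hC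
        (fun x u => (h.surfaceKernel_holomorphic τ x u).bound _ hmem) f)
      hS (h.surfaceKernel_restrictReal happly y) (hinv y)
  refine ⟨H, ‖c₀ • (1 : Lp ℂ 2 (refMeasure G) →L[ℂ] Lp ℂ 2 (refMeasure G))‖
    + ∑ τ, C * (c / 2) ^ (-ν) * B * A * ‖S τ‖,
    ∑ τ, 2 * (C * (c / 2) ^ (-ν) * B) / η * A * ‖S τ‖, ⟨fun z hz => ?_, fun z hz j hj => ?_⟩,
    fun y => by rw [heq, toComplex_restrictReal], fun y y' => ?_⟩
  · refine (norm_add_le _ _).trans (add_le_add le_rfl ((norm_sum_le _ _).trans ?_))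
    refine Finset.sum_le_sum fun τ _ => (ContinuousLinearMap.opNorm_comp_le _ _).trans ?_
    exact mul_le_mul_of_nonneg_right
      ((h.isBoundedSepHolomorphic_chartOperator τ).bound z hz) (norm_nonneg _)
  · refine (DifferentiableAt.fun_sum fun τ _ => ?_).const_add _
    exact ((h.isBoundedSepHolomorphic_chartOperator τ).differentiableAt z hz j hj).clm_comp
      (differentiableAt_const _)
  · rw [heq, heq, hH]
    simp only [add_sub_add_left_eq_sub, ← Finset.sum_sub_distrib, ← ContinuousLinearMap.sub_comp]
    rw [Finset.sum_mul]
    refine (norm_sum_le _ _).trans (Finset.sum_le_sum fun τ _ => ?_)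
    refine (ContinuousLinearMap.opNorm_comp_le _ _).trans ?_
    have h1 := h.norm_chartOperator_sub_le τ (hsupp y') (hsupp y)
    have h2 : ∑' j, b j * |(restrictReal b y j : ℝ) - restrictReal b y' j|
        = ∑' j, b j * |(y j : ℝ) - y' j| := by
      refine tsum_congr fun j => ?_
      unfold restrictReal
      split_ifs with hj
      · simp [hj]
      · rfl
    rw [h2] at h1
    calc _ ≤ 2 * (C * (c / 2) ^ (-ν) * B) / η * (∑' j, b j * |(y j : ℝ) - y' j|) * A * ‖S τ‖ :=
          mul_le_mul_of_nonneg_right h1 (norm_nonneg _)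
      _ = _ := by ring

end Assembly

/-- The data required to build the operators exist on some neighbourhood of the parameter space. -/
theorem exists_isKernelSetup {Γ : Set R3} {ι : Type*} [Fintype ι] (hΓ : Bornology.IsBounded Γ)
    (G : PatchDecomposition Γ ι) {p : ℝ} (hp₀ : 0 < p) (hp₁ : p < 1) {φ₀ : R3 → R3}
    {φ : ℕ → R3 → R3} (hφ : IsAdmissibleFamily Γ φ₀ φ p) {a : ParamSpace → R3 → C3 → ℂ}
    (ha_meas : ∀ y, Measurable (Function.uncurry (a y))) {ε : ℝ} (hε : 0 < ε)
    (ha : IsHolomorphicSingularKernel G φ₀ φ p ε a) :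
    ∃ K c κ Λ η C ν B A,
      IsKernelSetup G φ₀ φ (fun j => lipNorm Γ (φ j)) a K c κ Λ η C ν B A := by
  obtain ⟨c, h⟩ := hφ.exists_isControlledFamily hΓ hp₀ hp₁
  obtain ⟨κ, Λ, hG⟩ := G.exists_isChart
  have hc := h.pos
  obtain ⟨M, hM, hMle⟩ := h.exists_norm_rComplex_sub_le ε
  obtain ⟨d, hd⟩ := Metric.isBounded_iff.1 hΓ
  obtain ⟨K, η₁, hη₁, C, hC, ν, hν, hν2, hK⟩ := exists_isExtendedKernel h.nonneg hε ha (R := M * d)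
    (fun z hz x hx x' hx' => (hMle z hz.1 x hx x' hx').trans
      (mul_le_mul_of_nonneg_left (by rw [← dist_eq_norm]; exact hd hx hx') hM.le))
    fun τ u hu => G.chart_mem τ hu
  choose ηJ hηJ BJ hBJ using fun τ => exists_isBoundedSepHolomorphic_jacobian h (hG τ)
  obtain ⟨A, hA⟩ := exists_isSchurWeight (G := G) hΓ hG hν hν2
  -- a common radius for the finitely many charts
  have hev : ∀ᶠ η in 𝓝[>] (0 : ℝ), (∀ τ, 3 * η ≤ ηJ τ) ∧ 3 * η ≤ η₁ ∧ 4 * (3 * η) ≤ c ∧ 0 < η := by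
    have hlin : ∀ {m t : ℝ}, 0 < m → 0 < t → ∀ᶠ η in 𝓝[>] (0 : ℝ), m * η ≤ t := fun {m t} hm ht => by
      filter_upwards [Ioo_mem_nhdsGT (div_pos ht hm)] with η hη
      rw [mul_comm]
      exact ((lt_div_iff₀ hm).1 hη.2).le
    refine (eventually_all.2 fun τ => hlin three_pos (hηJ τ)).and ((hlin three_pos hη₁).and
      (Eventually.and ?_ self_mem_nhdsWithin))
    filter_upwards [hlin (show (0 : ℝ) < 12 by norm_num) hc] with η hη
    linarith
  obtain ⟨η, h1, h2, h3, h4⟩ := hev.exists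
  exact ⟨K, c, κ, Λ, η, C, ν, ∑ τ, |BJ τ|, A,
    { controlled := h
      chart := hG
      pos := h4
      le := h3
      kernel := hK.mono h2
      const_nonneg := hC.le
      exponent_nonneg := hν
      bound_nonneg := Finset.sum_nonneg fun _ _ => abs_nonneg _
      jacobian := fun τ u =>
        { bound := fun z hz => (((hBJ τ u).mono (h1 τ)).bound z hz).trans ((le_abs_self _).trans
            (Finset.single_le_sum (f := fun τ => |BJ τ|) (fun _ _ => abs_nonneg _)
              (Finset.mem_univ τ)))
          differentiableAt := ((hBJ τ u).mono (h1 τ)).differentiableAt }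
      measurable := ha_meas
      continuous := fun τ u hu ζ hζ => (ha.holomorphic_param τ u hu ζ hζ).2
      weight := hA }⟩

end ShapeHolomorphy

end

open ShapeHolomorphy in
theorem mainTheorem3 {Γ : Set R3} {ι : Type*} [Fintype ι]
    (hΓ : Bornology.IsBounded Γ) (G : PatchDecomposition Γ ι)
    (p : ℝ) (hp₀ : 0 < p) (hp₁ : p < 1)
    (φ₀ : R3 → R3) (φ : ℕ → R3 → R3) (hφ : IsAdmissibleFamily Γ φ₀ φ p)
    (c : ℂ) (a : ParamSpace → R3 → C3 → ℂ)
    (ha_meas : ∀ y, Measurable (Function.uncurry (a y)))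
    (ha : ∃ ε > 0, IsHolomorphicSingularKernel G φ₀ φ p ε a)
    (hA : ∀ y, (pulledBackOperator G c (a y) (rReal φ₀ φ y)).IsInvertible)
    (f : ParamSpace → MeasureTheory.Lp ℂ 2 (refMeasure G))
    (hf : ∃ ε > 0, IsBPEHolomorphic (fun j => lipNorm Γ (φ j)) p ε f)
    (hf_cont : Continuous f) :
    ∃ ε' > 0,
      IsBPEHolomorphic (fun j => lipNorm Γ (φ j)) p ε'
        (fun y => (pulledBackOperator G c (a y) (rReal φ₀ φ y)).inverse (f y)) ∧
      Continuous
        (fun y => (pulledBackOperator G c (a y) (rReal φ₀ φ y)).inverse (f y)) := by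
  obtain ⟨ε, hε, ha⟩ := ha
  -- on the zero space there is nothing to prove
  rcases subsingleton_or_nontrivial (Lp ℂ 2 (refMeasure G)) with hE | hE
  · have hsol : (fun y => (pulledBackOperator G c (a y) (rReal φ₀ φ y)).inverse (f y)) = f :=
      funext fun y => Subsingleton.elim _ _
    obtain ⟨ε', hε', hf'⟩ := hf
    exact ⟨ε', hε', by rw [hsol]; exact hf', by rw [hsol]; exact hf_cont⟩
  obtain ⟨K, _, _, _, η, _, _, _, _, h⟩ := exists_isKernelSetup hΓ G hp₀ hp₁ hφ ha_meas hε ha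
  obtain ⟨H, M, L, hH, hHA, hL⟩ := h.exists_family (fun τ u hu ζ hζ y =>
    (ha.holomorphic_param τ u hu ζ hζ).1.apply_restrictReal hε
      (ha.holomorphic_param τ u hu ζ hζ).2 y) hA
  exact isBPEHolomorphic_inverse_apply h.controlled.nonneg h.controlled.summable h.pos hH hHA hL hA
    hf hf_cont
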